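/- Let $A$ be a definite quaternion algebra over $\mathbb{Q}$, identified with a $\mathbb{Q}$-subalgebra of Hamilton's quaternions $\mathbb{H}$, with reduced norm $\mathtt{n}(x)=x\bar x$ and with reduced discriminant $D_A$ (the product of the primes $p$ such that $A\otimes_{\mathbb Q}\mathbb{Q}_p$ is a division algebra). Let $\mathcal{O}$ be a maximal order in $A$. For $\alpha\in A$ let $I_\alpha=\mathcal{O}\alpha+\mathcal{O}$, with reduced norm $\mathtt{n}(I_\alpha)$ (the reduced norm of a nonzero left ideal contained in $\mathcal{O}$ is the greatest common divisor of the reduced norms of its nonzero elements, and $\mathtt{n}(I_\alpha)=\mathtt{n}(cI_\alpha)/\mathtt{n}(c)$ for any positive integer $c$ with $cI_\alpha\subset\mathcal{O}$). In the upper half-space model $\mathbb{H}^5_{\mathbb{R}}=\{(z,r): z\in\mathbb{H},\ r>0\}$ of real hyperbolic 5-space, put $d_\infty(z,r)=\frac1r$ and $d_\alpha(z,r)=\frac{\mathtt{n}(z-\alpha)+r^2}{r\,\mathtt{n}(I_\alpha)}$ for $\alpha\in A$. For $\alpha\in A\cup\{\infty\}$, the Ford-Voronoi cell of $\alpha$ is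 $$\mathcal{H}_\alpha=\{x\in\mathbb{H}^5_{\mathbb{R}}: d_\alpha(x)\le d_\beta(x)\ \text{for all } \beta\in A\cup\{\infty\}\}.$$ The spine $X_{\mathcal{O}}=\bigcup_{\alpha\neq\beta}\mathcal{H}_\alpha\cap\mathcal{H}_\beta$ is the codimension 1 skeleton of the decomposition of $\mathbb{H}^5_{\mathbb{R}}$ into Ford-Voronoi cells. Its 4-dimensional cells are the 4-dimensional intersections $\mathcal{H}_\alpha\cap\mathcal{H}_\beta$ with $\alpha\ne\beta$, that is, those with nonempty interior in the hyperbolic hyperplane $\{d_\alpha=d_\beta\}$. Its fundamental cell is $\Sigma_{\mathcal{O}}=\mathcal{H}_0\cap\mathcal{H}_\infty$. Let $\mathrm{SL}_2(\mathcal{O})$ be the group of $2\times2$ matrices with entries in $\mathcal{O}$ and Dieudonné determinant $1$, acting on $\mathbb{H}^5_{\mathbb{R}}$ by $$\begin{pmatrix} a & b\\ c & d\end{pmatrix}\cdot(z,r)=\left(\frac{(az+b)\overline{(cz+d)}+a\bar c r^2}{\mathtt{n}(cz+d)+r^2\mathtt{n}(c)},\ \frac{r}{\mathtt{n}(cz+d)+r^2\mathtt{n}(c)}\right).$$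 Then the following hold. 1. $\mathrm{SL}_2(\mathcal{O})$ acts transitively on the set of 4-dimensional cells of $X_{\mathcal{O}}$ if and only if $D_A\in\{2,3,5\}$. 2. $D_A\in\{2,3,5\}$ if and only if $\mathcal{O}$ is left-Euclidean, that is, for all $a,b\in\mathcal{O}$ with $b\ne0$ there exist $c,d\in\mathcal{O}$ with $a=cb+d$ and $\mathtt{n}(d)<\mathtt{n}(b)$. 3. If $D_A\in\{2,3,5\}$, then the image of $\Sigma_{\mathcal{O}}$ under the horizontal projection $(z,r)\mapsto z$ is the Euclidean Voronoi cell of $0$ for the lattice $\mathcal{O}$ in $\mathbb{H}$, that is, the set of $z\in\mathbb{H}$ with $|z|\le|z-\alpha|$ for all $\alpha\in\mathcal{O}$, where $|z|=\sqrt{\mathtt{n}(z)}$. -/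

import Mathlib

open scoped Quaternion TensorProduct

noncomputable section

namespace HamiltonBianchi

/-! ### Definite quaternion algebras over the rationals and their orders -/

/-- A definite quaternion algebra over `ℚ`: a four-dimensional central simple `ℚ`-algebra whose
scalar extension to `ℝ` is isomorphic to Hamilton's quaternions. -/
structure IsDefiniteQuaternionAlgebra (A : Type*) [Ring A] [Algebra ℚ A] : Prop where
  central : Algebra.IsCentral ℚ A
  simple : IsSimpleRing A
  finrank_eq : Module.finrank ℚ A = 4
  definite : Nonempty (ℝ ⊗[ℚ] A ≃ₐ[ℝ] ℍ[ℝ])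

/-- `A` is ramified at the prime `p`: the algebra `ℚ_p ⊗ A` is a division algebra. -/
def IsRamifiedAt (A : Type*) [Ring A] [Algebra ℚ A] (p : Nat.Primes) : Prop :=
  haveI : Fact (p : ℕ).Prime := ⟨p.2⟩
  ∀ x : ℚ_[(p : ℕ)] ⊗[ℚ] A, x ≠ 0 → IsUnit x

/-- The reduced discriminant `D_A`, the product of the primes at which `A` is ramified
(there are finitely many of them for a quaternion algebra). -/
def reducedDiscriminant (A : Type*) [Ring A] [Algebra ℚ A] : ℕ :=
  ∏ᶠ (p : Nat.Primes) (_ : IsRamifiedAt A p), (p : ℕ)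

/-- An order of `A`: a unital subring that is a finitely generated `ℤ`-module generating `A` as a
`ℚ`-vector space. -/
def IsOrder {A : Type*} [Ring A] [Algebra ℚ A] (O : Subring A) : Prop :=
  O.toAddSubgroup.FG ∧ Submodule.span ℚ (O : Set A) = ⊤

/-- A maximal order of `A`. -/
def IsMaximalOrder {A : Type*} [Ring A] [Algebra ℚ A] (O : Subring A) : Prop :=
  Maximal IsOrder O

/-- The reduced trace `x + x̄` of a Hamilton quaternion, as a real number.
The reduced norm `x x̄` is `Quaternion.normSq x`. -/
def tr (x : ℍ[ℝ]) : ℝ := 2 * x.re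

/-! From here on `A` is a `ℚ`-subalgebra of `ℍ` and `O` a subring of `A`. -/

/-- `O` is left-Euclidean for the reduced norm. -/
def IsLeftEuclidean {A : Subalgebra ℚ ℍ[ℝ]} (O : Subring A) : Prop :=
  ∀ a ∈ O, ∀ b ∈ O, b ≠ 0 → ∃ c ∈ O, ∃ d ∈ O,
    a = c * b + d ∧ Quaternion.normSq (d : ℍ[ℝ]) < Quaternion.normSq (b : ℍ[ℝ])

/-- The greatest common divisor of the reduced norms of the nonzero elements of `S`, meant for
sets of elements whose norms are integers. -/
def gcdNorm (S : Set ℍ[ℝ]) : ℕ :=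
  sSup {d : ℕ | ∀ x ∈ S, x ≠ 0 → ∃ k : ℤ, Quaternion.normSq x = (d : ℝ) * k}

open Classical in
/-- The reduced norm of a nonzero left fractional ideal `I` of `O`: it is `n(cI) / n(c)` where
`c` is a positive integer with `cI ⊆ O` (the quotient does not depend on `c`, the least one is
taken) and the norm of `cI` is the greatest common divisor of the norms of its nonzero elements. -/
def idealNorm {A : Subalgebra ℚ ℍ[ℝ]} (O : Subring A) (I : Submodule O A) : ℝ :=
  if h : ∃ c : ℕ, 0 < c ∧ ∀ x ∈ I, (c : A) * x ∈ O then
    (gcdNorm ((fun x : A => (((Nat.find h : ℕ) : A) * x : ℍ[ℝ])) '' (I : Set A)) : ℝ) /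
      Quaternion.normSq ((Nat.find h : ℕ) : ℍ[ℝ])
  else 0

/-- The left fractional ideal `I_α = Oα + O`. -/
def cuspIdeal {A : Subalgebra ℚ ℍ[ℝ]} (O : Subring A) (α : A) : Submodule O A :=
  Submodule.span O {α, 1}

/-! ### The group `SL₂(O)` and its action on hyperbolic 5-space

Hyperbolic 5-space is the upper half-space of the pairs `(z, r)` in `ℍ × ℝ` with `0 < r`. -/

/-- The Dieudonné determinant of a `2 × 2` quaternionic matrix. -/
def dieudonneDet (g : Matrix (Fin 2) (Fin 2) ℍ[ℝ]) : ℝ :=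
  Real.sqrt (Quaternion.normSq (g 0 0 * g 1 1) + Quaternion.normSq (g 0 1 * g 1 0)
    - tr (g 0 0 * star (g 1 0) * g 1 1 * star (g 0 1)))

/-- The Hamilton-Bianchi group `SL₂(O)`, as a set of matrices: entries in `O` and Dieudonné
determinant `1`. -/
def SL2 {A : Subalgebra ℚ ℍ[ℝ]} (O : Subring A) : Set (Matrix (Fin 2) (Fin 2) ℍ[ℝ]) :=
  {g | dieudonneDet g = 1 ∧ ∀ i j, ∃ x : A, x ∈ O ∧ (x : ℍ[ℝ]) = g i j}

/-- The action of a matrix on the upper half-space (the Poincaré extension of the homography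
`z ↦ (az + b)(cz + d)⁻¹`). -/
def act (g : Matrix (Fin 2) (Fin 2) ℍ[ℝ]) (x : ℍ[ℝ] × ℝ) : ℍ[ℝ] × ℝ :=
  ((Quaternion.normSq (g 1 0 * x.1 + g 1 1) + x.2 ^ 2 * Quaternion.normSq (g 1 0))⁻¹ •
      ((g 0 0 * x.1 + g 0 1) * star (g 1 0 * x.1 + g 1 1)
        + (x.2 ^ 2) • (g 0 0 * star (g 1 0))),
    x.2 / (Quaternion.normSq (g 1 0 * x.1 + g 1 1) + x.2 ^ 2 * Quaternion.normSq (g 1 0)))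

/-! ### Binary Hamiltonian forms and distances to the cusps -/

/-- A binary Hamiltonian form `f(u, v) = a n(u) + tr(ū b v) + c n(v)`, given by its
coefficients. -/
structure BinaryHamiltonianForm where
  a : ℝ
  b : ℍ[ℝ]
  c : ℝ

/-- The symmetric bilinear form `⟨f, f'⟩` on binary Hamiltonian forms for which
`⟨f, f⟩ = -2 (n(b) - a c)`. -/
def pairing (f f' : BinaryHamiltonianForm) : ℝ :=
  f.a * f'.c + f.c * f'.a - tr (star f.b * f'.b)

/-- The positive definite form of discriminant `-1` associated with the point `(z, r)` of the
upper half-space, of matrix `r⁻¹ (1, -z; -z̄, n(z) + r²)`. -/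
def theta (x : ℍ[ℝ] × ℝ) : BinaryHamiltonianForm where
  a := 1 / x.2
  b := -((1 / x.2) • x.1)
  c := (Quaternion.normSq x.1 + x.2 ^ 2) / x.2

/-- The normalised degenerate form `f_α` associated with a point `α` of the right projective line
`P¹(A) = A ∪ {∞}`. Its matrix is `(0, 0; 0, 1)` for `α = ∞` and
`n(I_α)⁻¹ (1, -α; -ᾱ, n(α))` for `α` in `A`. -/
def cuspForm {A : Subalgebra ℚ ℍ[ℝ]} (O : Subring A) : OnePoint A → BinaryHamiltonianForm
  | none => ⟨0, 0, 1⟩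
  | some α =>
    ⟨1 / idealNorm O (cuspIdeal O α),
      -((1 / idealNorm O (cuspIdeal O α)) • (α : ℍ[ℝ])),
      Quaternion.normSq (α : ℍ[ℝ]) / idealNorm O (cuspIdeal O α)⟩

/-- The distance `d_α(x) = ⟨f_α, Θ(x)⟩` from the point `x` to the point at infinity `α`. -/
def cuspDist {A : Subalgebra ℚ ℍ[ℝ]} (O : Subring A) (α : OnePoint A) (x : ℍ[ℝ] × ℝ) : ℝ :=
  pairing (cuspForm O α) (theta x)

/-! ### The Ford-Voronoi cells and the spine -/

/-- The Ford-Voronoi cell of the cusp `α`. -/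
def fordVoronoiCell {A : Subalgebra ℚ ℍ[ℝ]} (O : Subring A) (α : OnePoint A) :
    Set (ℍ[ℝ] × ℝ) :=
  {x | 0 < x.2 ∧ ∀ β : OnePoint A, cuspDist O α x ≤ cuspDist O β x}

/-- The set of points equidistant to the cusps `α` and `β`, which is a hyperbolic hyperplane when
`α ≠ β`. -/
def equidistant {A : Subalgebra ℚ ℍ[ℝ]} (O : Subring A) (α β : OnePoint A) :
    Set (ℍ[ℝ] × ℝ) :=
  {x | 0 < x.2 ∧ cuspDist O α x = cuspDist O β x}

/-- The 4-dimensional cells of the spine, which is the codimension 1 skeleton of the cell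
decomposition of the upper half-space into Ford-Voronoi cells: the intersections of two distinct
Ford-Voronoi cells that are 4-dimensional, that is, have nonempty interior in the hyperbolic
hyperplane containing them. -/
def IsFourCell {A : Subalgebra ℚ ℍ[ℝ]} (O : Subring A) (C : Set (ℍ[ℝ] × ℝ)) : Prop :=
  ∃ α β : OnePoint A, α ≠ β ∧ C = fordVoronoiCell O α ∩ fordVoronoiCell O β ∧
    ∃ U : Set (ℍ[ℝ] × ℝ), IsOpen U ∧ (U ∩ equidistant O α β).Nonempty ∧
      U ∩ equidistant O α β ⊆ C

/-- `SL₂(O)` acts transitively on the 4-dimensional cells of its spine. -/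
def IsTransitiveOnFourCells {A : Subalgebra ℚ ℍ[ℝ]} (O : Subring A) : Prop :=
  ∀ C C' : Set (ℍ[ℝ] × ℝ), IsFourCell O C → IsFourCell O C' → ∃ g ∈ SL2 O, act g '' C = C'

/-- The fundamental cell of the spine, the intersection of the Ford-Voronoi cells of `0`
and `∞`. -/
def fundamentalCell {A : Subalgebra ℚ ℍ[ℝ]} (O : Subring A) : Set (ℍ[ℝ] × ℝ) :=
  fordVoronoiCell O ((0 : A) : OnePoint A) ∩ fordVoronoiCell O OnePoint.infty

/-- The Voronoi cell of `0` for the lattice `O` in the Euclidean space `ℍ`. -/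
def latticeVoronoiCell {A : Subalgebra ℚ ℍ[ℝ]} (O : Subring A) : Set ℍ[ℝ] :=
  {z | ∀ α ∈ O, dist z 0 ≤ dist z (α : ℍ[ℝ])}

end HamiltonBianchi

end

/-! Maximality of the order enters through one property, `IsNormMaximal`: an element x of R with
n(x) in k²ℤ and all tr(xy), y in R, in kℤ lies in kR. With it, the discriminant of the alternating
form tr([x,y]z) on R is squarefree, and its prime divisors are exactly the primes at which the norm
form is anisotropic over ℚ_p. So D_A is the absolute value of this discriminant
(`reducedDiscriminant_eq`), and conditions on D_A become conditions on a ℤ-basis.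

Euclidean implies D_A in {2,3,5} (`disc_of_isEuclid`). A Euclidean order has units besides ±1, hence
contains a root of unity u of order 3 or 4. Then R = ℤ[u] + ℤ[u]j with j in a short list of normal
forms, and testing the division at deep holes of the lattice leaves only the discriminants 2, 3, 5.

Conversely, for these discriminants Hermite's bound yields a root of unity, the normal form is
explicit, and every x in ℍ is a convex combination of lattice points whose mean squared distance to
x is less than 1 (`HasIntegralBasis.hasSimplex`). Some lattice point is then at distance less than 1
from x, which is Euclidean division. Moreover, if n(I_α) = 1/N, integrality improves the bound at α
to 1 - 1/N, so the hemisphere of the cusp α does not rise above the unit hemispheres centred in O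
(`HasFloor`). The cell of ∞ is therefore bounded by unit hemispheres only, and this gives the
projection statement. The neighbours of ∞ across 4-cells lie in O, so Euclid's algorithm, run with
translations and the inversion, carries every 4-cell to the fundamental one.

If division fails, some β in A is at distance at least 1 from all of O. The floor near β is then
made of hemispheres of cusps outside O, and Baire's theorem gives a 4-cell between ∞ and some γ not
in O. Since (0,1) lies only in the cells of 0 and ∞, a group element carrying the fundamental cell
there would send {0,∞} to {γ,∞}, and the entries of its inverse would force γ into O. -/

noncomputable section

namespace HamiltonBianchi

open Quaternion (normSq)

/-! ### Integral bases of orders -/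

section Basis

variable {A : Subalgebra ℚ ℍ[ℝ]}

/-- The natural map `ℝ ⊗ A → ℍ`. -/
def extendScalars (A : Subalgebra ℚ ℍ[ℝ]) : ℝ ⊗[ℚ] A →ₐ[ℝ] ℍ[ℝ] :=
  Algebra.TensorProduct.lift (Algebra.ofId ℝ ℍ[ℝ]) A.val
    (fun r x => show Commute (algebraMap ℝ ℍ[ℝ] r) (A.val x) from Algebra.commutes r (A.val x))

theorem extendScalars_tmul (r : ℝ) (x : A) :
    extendScalars A (r ⊗ₜ x) = algebraMap ℝ ℍ[ℝ] r * (x : ℍ[ℝ]) :=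
  Algebra.TensorProduct.lift_tmul _ _ _ _ _

/-- The source is isomorphic to the division ring ℍ, out of which every ring homomorphism to a
nontrivial ring is injective. This is how definiteness turns rational independence into real
independence. -/
theorem extendScalars_injective (hA : IsDefiniteQuaternionAlgebra A) :
    Function.Injective (extendScalars A) := by
  obtain ⟨φ⟩ := hA.definite
  have h : Function.Injective ((extendScalars A).toRingHom.comp φ.symm.toAlgHom.toRingHom) :=
    RingHom.injective _
  intro x y hxy
  apply φ.injective
  apply h
  simpa using hxy

theorem linearIndependent_real (hA : IsDefiniteQuaternionAlgebra A) {ι : Type*}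
    (b : Module.Basis ι ℚ A) : LinearIndependent ℝ (fun i => (b i : ℍ[ℝ])) := by
  have h := (Algebra.TensorProduct.basis ℝ b).linearIndependent.map'
    (extendScalars A).toLinearMap (LinearMap.ker_eq_bot.mpr (extendScalars_injective hA))
  convert! h using 1
  ext1 i
  rw [Function.comp_apply, Algebra.TensorProduct.basis_apply, AlgHom.toLinearMap_apply,
    extendScalars_tmul, map_one, one_mul]

theorem IsOrder.isIntegral {A : Type*} [Ring A] [Algebra ℚ A] {O : Subring A} (hO : IsOrder O)
    {x : A} (hx : x ∈ O) : IsIntegral ℤ x := by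
  have : Module.Finite ℤ O := by
    rw [Module.Finite.iff_addGroup_fg]
    exact (AddGroup.fg_iff_addSubgroup_fg _).mpr hO.1
  have h : IsIntegral ℤ (⟨x, hx⟩ : O) := Algebra.IsIntegral.isIntegral _
  exact h.map O.subtype.toIntAlgHom

theorem IsOrder.exists_int_of_rat {A : Type*} [Ring A] [Nontrivial A] [Algebra ℚ A]
    {O : Subring A} (hO : IsOrder O) {q : ℚ} (hq : algebraMap ℚ A q ∈ O) : ∃ k : ℤ, q = k := by
  have h := hO.isIntegral hq
  have h2 : IsIntegral ℤ q :=
    (isIntegral_algHom_iff ((algebraMap ℚ A).toIntAlgHom) (algebraMap ℚ A).injective).mp h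
  obtain ⟨k, hk⟩ := IsIntegrallyClosed.isIntegral_iff.mp h2
  exact ⟨k, by simpa using hk.symm⟩

/-- A rational number in an order is integral, hence an integer, so the quotient of O by ℤ·1 is
torsion free. A basis of this quotient lifts and completes 1 to a basis. Having 1 as first vector
removes one coordinate from every trace against a commutator. -/
theorem IsOrder.exists_basis {A : Type*} [Ring A] [Nontrivial A] [Algebra ℚ A]
    (hr : Module.finrank ℚ A = 4) {O : Subring A} (hO : IsOrder O) :
    ∃ (b : Module.Basis (Fin 4) ℤ O) (c : Module.Basis (Fin 4) ℚ A), b 0 = 1 ∧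
      ∀ i, c i = b i := by
  classical
  have : Module.Finite ℤ O := by
    rw [Module.Finite.iff_addGroup_fg]
    exact (AddGroup.fg_iff_addSubgroup_fg _).mpr hO.1
  have : CharZero A := algebraRat.charZero A
  have : CharZero O := ⟨fun m n h => by
    have := congrArg (Subtype.val) h
    push_cast at this
    exact_mod_cast this⟩
  have hQ : Module.IsTorsionFree ℤ (O ⧸ Submodule.span ℤ {(1 : O)}) := by
    rw [Module.isTorsionFree_iff_smul_eq_zero]
    intro m y hy
    obtain ⟨x, rfl⟩ := Submodule.Quotient.mk_surjective _ y
    by_cases hm : m = 0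
    · exact Or.inl hm
    right
    rw [← Submodule.Quotient.mk_smul, Submodule.Quotient.mk_eq_zero,
      Submodule.mem_span_singleton] at hy
    obtain ⟨k, hk⟩ := hy
    have hk' : (k : A) = m * (x : A) := by
      have := congrArg (Subtype.val) hk
      simpa [zsmul_eq_mul] using this
    have hmA : (m : ℚ) ≠ 0 := by exact_mod_cast hm
    have hx : algebraMap ℚ A (k / m) = x := by
      have h1 : (m : ℚ) • (algebraMap ℚ A (k / m)) = (m : ℚ) • (x : A) := by
        rw [Algebra.smul_def, Algebra.smul_def, ← map_mul, mul_div_cancel₀ _ hmA]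
        simpa using hk'
      exact smul_right_injective A hmA h1
    obtain ⟨l, hl⟩ := hO.exists_int_of_rat (q := k / m) (by rw [hx]; exact x.2)
    rw [Submodule.Quotient.mk_eq_zero, Submodule.mem_span_singleton]
    refine ⟨l, Subtype.ext ?_⟩
    rw [← hx, hl]
    simp
  obtain ⟨r, bQ⟩ := Module.basisOfFiniteTypeTorsionFree' (R := ℤ)
    (M := O ⧸ Submodule.span ℤ {(1 : O)})
  have hOt : Module.IsTorsionFree ℤ O := by
    rw [Module.isTorsionFree_iff_smul_eq_zero]
    intro m y hy
    by_contra! h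
    have h2 : (m : ℚ) • (y : A) = 0 := by
      have := congrArg Subtype.val hy
      rw [Algebra.smul_def]
      simpa [zsmul_eq_mul] using this
    rcases smul_eq_zero.mp h2 with h3 | h3
    · exact h.1 (by exact_mod_cast h3)
    · exact h.2 (Subtype.ext h3)
  have h1 : LinearIndependent ℤ (fun _ : Fin 1 => (1 : O)) := by
    rw [linearIndependent_unique_iff]
    exact one_ne_zero
  let bW0 := Module.Basis.span h1
  let bW : Module.Basis (Fin 1) ℤ (Submodule.span ℤ {(1 : O)}) :=
    bW0.map (LinearEquiv.ofEq _ _ (by simp))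
  let bS := Module.Basis.sumQuot bW bQ
  have hli : LinearIndependent ℚ (fun i => (bS i : A)) := by
    rw [← LinearIndependent.iff_fractionRing ℤ ℚ]
    exact bS.linearIndependent.map' (O.subtype.toAddMonoidHom.toIntLinearMap)
      (LinearMap.ker_eq_bot.mpr Subtype.val_injective)
  have hsp : ⊤ ≤ Submodule.span ℚ (Set.range (fun i => (bS i : A))) := by
    rw [← hO.2, Submodule.span_le]
    intro x hx
    have := bS.sum_repr ⟨x, hx⟩
    have h2 := congrArg Subtype.val this
    have h3 : x = ∑ i, (bS.repr ⟨x, hx⟩ i : ℚ) • (bS i : A) := by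
      refine h2.symm.trans ?_
      push_cast
      refine Finset.sum_congr rfl fun i _ => ?_
      rw [zsmul_eq_mul, Algebra.smul_def]
      simp
    rw [h3]
    exact Submodule.sum_mem _ fun i _ => Submodule.smul_mem _ _
      (Submodule.subset_span ⟨i, rfl⟩)
  let cS := Module.Basis.mk hli hsp
  have hcard := Module.finrank_eq_card_basis cS
  rw [hr] at hcard
  have hr3 : r = 3 := by simp at hcard; omega
  subst hr3
  refine ⟨bS.reindex finSumFinEquiv, cS.reindex finSumFinEquiv, ?_, fun i => ?_⟩
  · have : (0 : Fin 4) = finSumFinEquiv (Sum.inl (0 : Fin 1) : Fin 1 ⊕ Fin 3) := rfl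
    rw [this, Module.Basis.reindex_apply, Equiv.symm_apply_apply]
    simp only [bS, Module.Basis.sumQuot_inl, bW, bW0, Module.Basis.map_apply]
    simp [Module.Basis.span_apply]
  · simp [cS]

end Basis

/-! ### Subrings of `ℍ` with an integral basis -/

/-- `e` is a `ℤ`-basis of the subring `R` of `ℍ`, and an `ℝ`-basis of `ℍ`, with first vector `1`. -/
structure HasIntegralBasis (R : Subring ℍ[ℝ]) (e : Fin 4 → ℍ[ℝ]) : Prop where
  one : e 0 = 1
  li : LinearIndependent ℝ e
  mem : ∀ x, x ∈ R ↔ ∃ c : Fin 4 → ℤ, x = ∑ i, (c i : ℝ) • e i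

/-- The four real coordinates of a quaternion. -/
def coordEquiv : ℍ[ℝ] ≃ₗ[ℝ] (Fin 4 → ℝ) where
  toFun x := ![x.re, x.imI, x.imJ, x.imK]
  invFun v := ⟨v 0, v 1, v 2, v 3⟩
  map_add' x y := by ext i; fin_cases i <;> simp
  map_smul' c x := by ext i; fin_cases i <;> simp
  left_inv x := by ext <;> rfl
  right_inv v := by ext i; fin_cases i <;> rfl

theorem coordEquiv_apply (x : ℍ[ℝ]) : coordEquiv x = ![x.re, x.imI, x.imJ, x.imK] := rfl

theorem coordEquiv_symm_re (v : Fin 4 → ℝ) : (coordEquiv.symm v).re = v 0 := rfl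

theorem coordEquiv_symm_imI (v : Fin 4 → ℝ) : (coordEquiv.symm v).imI = v 1 := rfl

theorem coordEquiv_symm_imJ (v : Fin 4 → ℝ) : (coordEquiv.symm v).imJ = v 2 := rfl

theorem coordEquiv_symm_imK (v : Fin 4 → ℝ) : (coordEquiv.symm v).imK = v 3 := rfl

theorem toMatrix_mulLeft (x : ℍ[ℝ]) :
    ∃ B : Module.Basis (Fin 4) ℝ ℍ[ℝ], LinearMap.toMatrix B B (LinearMap.mulLeft ℝ x) =
      !![x.re, -x.imI, -x.imJ, -x.imK; x.imI, x.re, -x.imK, x.imJ;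
         x.imJ, x.imK, x.re, -x.imI; x.imK, -x.imJ, x.imI, x.re] := by
  refine ⟨Module.Basis.ofEquivFun coordEquiv, ?_⟩
  ext i j
  rw [LinearMap.toMatrix_apply, LinearMap.mulLeft_apply, Module.Basis.coe_ofEquivFun,
    Module.Basis.ofEquivFun_repr_apply]
  fin_cases i <;> fin_cases j <;>
    simp [coordEquiv_apply, coordEquiv_symm_re, coordEquiv_symm_imI, coordEquiv_symm_imJ,
      coordEquiv_symm_imK]

theorem det_mulLeft (x : ℍ[ℝ]) : LinearMap.det (LinearMap.mulLeft ℝ x) = normSq x ^ 2 := by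
  obtain ⟨B, hB⟩ := toMatrix_mulLeft x
  rw [← LinearMap.det_toMatrix B, hB, Quaternion.normSq_def']
  simp [Matrix.det_succ_row_zero, Fin.sum_univ_succ, Fin.succAbove]
  ring

theorem trace_mulLeft (x : ℍ[ℝ]) : LinearMap.trace ℝ _ (LinearMap.mulLeft ℝ x) = 2 * tr x := by
  obtain ⟨B, hB⟩ := toMatrix_mulLeft x
  rw [LinearMap.trace_eq_matrix_trace ℝ B, hB]
  simp [Matrix.trace, Fin.sum_univ_succ, tr]
  ring

namespace HasIntegralBasis

variable {R : Subring ℍ[ℝ]} {e : Fin 4 → ℍ[ℝ]}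

theorem basis_mem (h : HasIntegralBasis R e) (j : Fin 4) : e j ∈ R :=
  (h.mem _).mpr ⟨Pi.single j 1, by simp [Pi.single_apply]⟩

/-- Left multiplication by x has an integer matrix in the basis e, while its determinant and trace
on ℍ are n(x)² and 2 tr(x). -/
theorem exists_mulLeft (h : HasIntegralBasis R e) {x : ℍ[ℝ]} (hx : x ∈ R) :
    (∃ k : ℤ, normSq x ^ 2 = k) ∧ ∃ k : ℤ, 2 * tr x = k := by
  choose c hc using fun j => (h.mem _).mp (R.mul_mem hx (h.basis_mem j))
  let B : Module.Basis (Fin 4) ℝ ℍ[ℝ] := basisOfLinearIndependentOfCardEqFinrank h.li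
    (by rw [Quaternion.finrank_eq_four]; rfl)
  have hB : ∀ i, B i = e i := fun i => by simp [B]
  have hM : LinearMap.toMatrix B B (LinearMap.mulLeft ℝ x) =
      (Matrix.of fun i j => c j i).map (Int.cast : ℤ → ℝ) := by
    ext i j
    rw [LinearMap.toMatrix_apply, hB, LinearMap.mulLeft_apply, hc]
    simp_rw [← hB]
    simp [Finsupp.single_apply]
  refine ⟨⟨(Matrix.of fun i j => c j i).det, ?_⟩, ⟨(Matrix.of fun i j => c j i).trace, ?_⟩⟩
  · rw [← det_mulLeft, ← LinearMap.det_toMatrix B, hM]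
    exact (RingHom.map_det (Int.castRingHom ℝ) _).symm
  · rw [← trace_mulLeft, LinearMap.trace_eq_matrix_trace ℝ B, hM]
    simp [Matrix.trace]

/-- Only squares of norms are known to be integers at this point. The identity n(x+1)² + n(x-1)² =
2n(x)² + 4n(x) + 2 + 2tr(x)² shows that n(x) is rational, and a rational number with integral square
is an integer. -/
theorem exists_normSq_eq (h : HasIntegralBasis R e) {x : ℍ[ℝ]} (hx : x ∈ R) :
    ∃ k : ℤ, normSq x = k := by
  obtain ⟨⟨m, hm⟩, t, ht⟩ := h.exists_mulLeft hx
  obtain ⟨⟨m₁, hm₁⟩, -⟩ := h.exists_mulLeft (R.add_mem hx R.one_mem)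
  obtain ⟨⟨m₂, hm₂⟩, -⟩ := h.exists_mulLeft (R.sub_mem hx R.one_mem)
  have e₁ : normSq (x + 1) = normSq x + tr x + 1 := by
    simp [Quaternion.normSq_def', tr]; ring
  have e₂ : normSq (x - 1) = normSq x - tr x + 1 := by
    simp [Quaternion.normSq_def', tr]; ring
  rw [e₁] at hm₁
  rw [e₂] at hm₂
  have hq : normSq x = (((m₁ + m₂ - 2 * m - 2 - t ^ 2 / 2 : ℚ) / 4 : ℚ) : ℝ) := by
    push_cast
    rw [← ht, ← hm, ← hm₁, ← hm₂]
    ring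
  set q : ℚ := (m₁ + m₂ - 2 * m - 2 - t ^ 2 / 2 : ℚ) / 4
  have hq2 : q ^ 2 = m := by
    have : ((q ^ 2 : ℚ) : ℝ) = ((m : ℚ) : ℝ) := by push_cast; rw [← hq, hm]
    exact_mod_cast this
  have hint : IsIntegral ℤ q := by
    refine IsIntegral.of_pow (n := 2) (by norm_num) ?_
    rw [hq2]
    exact isIntegral_algebraMap (R := ℤ) (A := ℚ) (x := m)
  obtain ⟨k, hk⟩ := IsIntegrallyClosed.isIntegral_iff.mp hint
  refine ⟨k, ?_⟩
  rw [hq, ← hk]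
  simp

theorem exists_tr_eq (h : HasIntegralBasis R e) {x : ℍ[ℝ]} (hx : x ∈ R) :
    ∃ k : ℤ, tr x = k := by
  obtain ⟨m, hm⟩ := h.exists_normSq_eq hx
  obtain ⟨m₁, hm₁⟩ := h.exists_normSq_eq (R.add_mem hx R.one_mem)
  refine ⟨m₁ - m - 1, ?_⟩
  push_cast
  rw [← hm, ← hm₁]
  simp [Quaternion.normSq_def', tr]
  ring

theorem star_mem (h : HasIntegralBasis R e) {x : ℍ[ℝ]} (hx : x ∈ R) : star x ∈ R := by
  obtain ⟨k, hk⟩ := h.exists_tr_eq hx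
  have : star x = (k : ℍ[ℝ]) - x := by
    have h2 : ((k : ℝ) : ℍ[ℝ]) = (k : ℍ[ℝ]) := Quaternion.coe_intCast k
    rw [← h2, ← hk]
    ext <;> simp [tr]
    ring
  rw [this]
  exact R.sub_mem (intCast_mem R k) hx

end HasIntegralBasis

/-- The image in `ℍ` of a subring of `A`. -/
def image {A : Subalgebra ℚ ℍ[ℝ]} (O : Subring A) : Subring ℍ[ℝ] :=
  O.map (A.val : A →+* ℍ[ℝ])

theorem mem_image {A : Subalgebra ℚ ℍ[ℝ]} {O : Subring A} {x : ℍ[ℝ]} :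
    x ∈ image O ↔ ∃ a : A, a ∈ O ∧ (a : ℍ[ℝ]) = x := by
  simp [image, Subring.mem_map]

theorem coe_mem_image {A : Subalgebra ℚ ℍ[ℝ]} {O : Subring A} {a : A} :
    (a : ℍ[ℝ]) ∈ image O ↔ a ∈ O := by
  rw [mem_image]
  exact ⟨fun ⟨b, hb, h⟩ => Subtype.ext h ▸ hb, fun h => ⟨a, h, rfl⟩⟩

/-- An order of a definite quaternion algebra has an integral basis, which is also a rational basis
of the algebra. -/
theorem IsOrder.exists_hasIntegralBasis {A : Subalgebra ℚ ℍ[ℝ]}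
    (hA : IsDefiniteQuaternionAlgebra A) {O : Subring A} (hO : IsOrder O) :
    ∃ (e : Fin 4 → ℍ[ℝ]) (c : Module.Basis (Fin 4) ℚ A), HasIntegralBasis (image O) e ∧
      ∀ i, (c i : ℍ[ℝ]) = e i := by
  obtain ⟨b, c, hb, hc⟩ := hO.exists_basis hA.finrank_eq
  refine ⟨fun i => (c i : ℍ[ℝ]), c, ⟨by rw [hc, hb]; rfl, linearIndependent_real hA c, fun x => ?_⟩,
    fun i => rfl⟩
  have key : ∀ d : Fin 4 → ℤ, ((∑ i, d i • b i : O) : A) = ∑ i, (d i : ℚ) • c i := fun d => by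
    push_cast
    refine Finset.sum_congr rfl fun i _ => ?_
    rw [zsmul_eq_mul, Algebra.smul_def, hc]
    simp
  have key2 : ∀ d : Fin 4 → ℤ, ((∑ i, (d i : ℚ) • c i : A) : ℍ[ℝ]) =
      ∑ i, (d i : ℝ) • (c i : ℍ[ℝ]) := fun d => by
    rw [AddSubmonoidClass.coe_finsetSum]
    refine Finset.sum_congr rfl fun i _ => ?_
    rw [Subalgebra.coe_smul, Algebra.smul_def, Algebra.smul_def]
    simp
  rw [mem_image]
  constructor
  · rintro ⟨a, ha, rfl⟩
    refine ⟨fun i => b.repr ⟨a, ha⟩ i, ?_⟩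
    rw [← key2, ← key, b.sum_repr]
  · rintro ⟨d, rfl⟩
    exact ⟨_, (∑ i, d i • b i : O).2, by rw [key, key2]⟩

/-! ### Maximal orders and the norm form -/

/-- An element of `R` that is divisible by `k` as far as the norm form can tell is divisible by `k`
in `R`. -/
def IsNormMaximal (R : Subring ℍ[ℝ]) : Prop :=
  ∀ x ∈ R, ∀ k : ℕ, 0 < k → (∀ y ∈ R, ∃ t : ℤ, tr (x * y) = k * t) →
    (∃ t : ℤ, normSq x = (k : ℝ) ^ 2 * t) → ∃ y ∈ R, x = (k : ℝ) • y

theorem star_eq_tr_sub (x : ℍ[ℝ]) : star x = ((tr x : ℝ) : ℍ[ℝ]) - x := by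
  ext <;> simp [tr]
  ring

theorem mul_eq_tr_sub (x y : ℍ[ℝ]) : x * y = ((tr (x * y) : ℝ) : ℍ[ℝ]) - star y * star x := by
  rw [← star_mul, star_eq_tr_sub]
  simp

theorem star_mul_self_eq (x : ℍ[ℝ]) : star x * x = ((normSq x : ℝ) : ℍ[ℝ]) :=
  Quaternion.star_mul_self x

/-- The left module `R + R z` is a ring when `z` has integral norm and integral traces against
`R`. -/
def adjoinIntegral (R : Subring ℍ[ℝ]) (hR : ∀ x ∈ R, star x ∈ R) (z : ℍ[ℝ])
    (ht : ∀ y ∈ R, ∃ t : ℤ, tr (z * y) = t) (hn : ∃ t : ℤ, normSq z = t) : Subring ℍ[ℝ] where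
  carrier := {w | ∃ a ∈ R, ∃ b ∈ R, w = a + b * z}
  one_mem' := ⟨1, R.one_mem, 0, R.zero_mem, by simp⟩
  zero_mem' := ⟨0, R.zero_mem, 0, R.zero_mem, by simp⟩
  neg_mem' := by
    rintro _ ⟨a, ha, b, hb, rfl⟩
    exact ⟨-a, R.neg_mem ha, -b, R.neg_mem hb, by rw [neg_add, neg_mul]⟩
  add_mem' := by
    rintro _ _ ⟨a, ha, b, hb, rfl⟩ ⟨c, hc, d, hd, rfl⟩
    exact ⟨a + c, R.add_mem ha hc, b + d, R.add_mem hb hd, by rw [add_mul]; abel⟩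
  mul_mem' := by
    rintro _ _ ⟨a, ha, b, hb, rfl⟩ ⟨c, hc, d, hd, rfl⟩
    obtain ⟨s, hs⟩ := ht 1 R.one_mem
    rw [mul_one] at hs
    obtain ⟨t, htc⟩ := ht c hc
    obtain ⟨u, hud⟩ := ht d hd
    obtain ⟨n, hn⟩ := hn
    have hz : star z = (s : ℍ[ℝ]) - z := by
      rw [star_eq_tr_sub, hs, Quaternion.coe_intCast]
    -- Both identities move z to the right: zc = tr(zc) - c̄z̄ with z̄ = tr(z) - z, and zdz =
    -- tr(zd)z - d̄ n(z).
    have hzc : z * c = (t : ℍ[ℝ]) - star c * s + star c * z := by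
      rw [mul_eq_tr_sub, htc, Quaternion.coe_intCast, hz, mul_sub]
      abel
    have hzd : z * d * z = (u : ℍ[ℝ]) * z - star d * n := by
      rw [mul_eq_tr_sub z d, hud, Quaternion.coe_intCast, sub_mul, mul_assoc, star_mul_self_eq, hn,
        Quaternion.coe_intCast]
    refine ⟨a * c + b * (t - star c * s) - b * (star d * n), ?_,
      a * d + b * star c + b * u, ?_, ?_⟩
    · exact R.sub_mem (R.add_mem (R.mul_mem ha hc) (R.mul_mem hb (R.sub_mem (intCast_mem R t)
        (R.mul_mem (hR c hc) (intCast_mem R s))))) (R.mul_mem hb (R.mul_mem (hR d hd)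
        (intCast_mem R n)))
    · exact R.add_mem (R.add_mem (R.mul_mem ha hd) (R.mul_mem hb (hR c hc)))
        (R.mul_mem hb (intCast_mem R u))
    · calc (a + b * z) * (c + d * z) = a * c + a * d * z + b * (z * c) + b * (z * d * z) := by
            noncomm_ring
        _ = _ := by
            rw [hzc, hzd]
            noncomm_ring

/-- For z = x/k the module O + Oz is a ring, finitely generated, and contains O. It is therefore an
order, and maximality puts z in O. -/
theorem IsMaximalOrder.isNormMaximal {A : Subalgebra ℚ ℍ[ℝ]}
    (hA : IsDefiniteQuaternionAlgebra A) {O : Subring A} (hO : IsMaximalOrder O) :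
    IsNormMaximal (image O) := by
  obtain ⟨e, -, he, -⟩ := hO.1.exists_hasIntegralBasis hA
  intro x hx k hk ht hn
  obtain ⟨a, ha, rfl⟩ := mem_image.mp hx
  have hk0 : (k : ℝ) ≠ 0 := by positivity
  set z : A := (k : ℚ)⁻¹ • a with hz
  have hzx : (z : ℍ[ℝ]) = (k : ℝ)⁻¹ • (a : ℍ[ℝ]) := by
    rw [hz, Subalgebra.coe_smul, Algebra.smul_def, Algebra.smul_def]
    simp
  let L := adjoinIntegral (image O) (fun x hx => he.star_mem hx) z
    (fun y hy => by
      obtain ⟨t, h⟩ := ht y hy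
      refine ⟨t, ?_⟩
      have h2 : tr ((k : ℝ)⁻¹ • (a : ℍ[ℝ]) * y) = (k : ℝ)⁻¹ * tr (a * y) := by
        rw [smul_mul_assoc]; simp only [tr, Quaternion.re_smul, smul_eq_mul]; ring
      rw [hzx, h2, h]
      field_simp)
    (by
      obtain ⟨t, h⟩ := hn
      refine ⟨t, ?_⟩
      rw [hzx, Quaternion.normSq_smul, h]
      field_simp)
  let L' : Subring A := L.comap (A.val : A →+* ℍ[ℝ])
  have hOL : O ≤ L' := fun y hy =>
    ⟨y, coe_mem_image.mpr hy, 0, Subring.zero_mem _, by simp⟩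
  have hL : IsOrder L' := by
    refine ⟨?_, ?_⟩
    · have : L'.toAddSubgroup = O.toAddSubgroup ⊔ O.toAddSubgroup.map (AddMonoidHom.mulRight z) := by
        ext w
        rw [AddSubgroup.mem_sup]
        constructor
        · rintro ⟨b, hb, c, hc, h⟩
          obtain ⟨b, hb, rfl⟩ := mem_image.mp hb
          obtain ⟨c, hc, rfl⟩ := mem_image.mp hc
          exact ⟨b, coe_mem_image.mp hb, c * z, ⟨c, coe_mem_image.mp hc, rfl⟩, Subtype.ext h.symm⟩
        · rintro ⟨b, hb, _, ⟨c, hc, rfl⟩, rfl⟩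
          exact ⟨b, coe_mem_image.mpr hb, c, coe_mem_image.mpr hc, rfl⟩
      rw [this]
      refine AddSubgroup.FG.sup hO.1.1 ?_
      obtain ⟨S, hS⟩ := hO.1.1
      classical
      exact ⟨S.image (AddMonoidHom.mulRight z), by
        rw [Finset.coe_image, ← AddMonoidHom.map_closure, hS]⟩
    · rw [eq_top_iff, ← hO.1.2]
      exact Submodule.span_mono hOL
  have hzO : z ∈ O := hO.2 hL hOL
    ⟨0, Subring.zero_mem _, 1, Subring.one_mem _, by simp⟩
  refine ⟨z, coe_mem_image.mpr hzO, ?_⟩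
  rw [hzx, smul_smul, mul_inv_cancel₀ hk0, one_smul]

/-! ### Divisibility in an order -/

/-- The real numbers that are integral multiples of `k`. -/
abbrev mult (k : ℤ) : AddSubgroup ℝ := AddSubgroup.zmultiples (k : ℝ)

theorem mem_mult {k : ℤ} {r : ℝ} : r ∈ mult k ↔ ∃ t : ℤ, r = k * t := by
  rw [AddSubgroup.mem_zmultiples_iff]
  exact exists_congr fun t => by rw [zsmul_eq_mul, mul_comm]; exact eq_comm

theorem intCast_mem_mult {k m : ℤ} : (m : ℝ) ∈ mult k ↔ k ∣ m := by
  rw [mem_mult]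
  exact exists_congr fun t => by norm_cast

theorem mult_le_of_dvd {k l : ℤ} (h : k ∣ l) : mult l ≤ mult k := by
  obtain ⟨m, rfl⟩ := h
  intro r hr
  obtain ⟨t, rfl⟩ := mem_mult.mp hr
  exact mem_mult.mpr ⟨m * t, by push_cast; ring⟩

theorem mul_mem_mult {k : ℤ} {a b : ℝ} (ha : a ∈ mult k) (hb : b ∈ mult 1) : a * b ∈ mult k := by
  obtain ⟨s, rfl⟩ := mem_mult.mp ha
  obtain ⟨t, rfl⟩ := mem_mult.mp hb
  exact mem_mult.mpr ⟨s * t, by push_cast; ring⟩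

theorem mul_mem_mult' {k : ℤ} {a b : ℝ} (ha : a ∈ mult 1) (hb : b ∈ mult k) : a * b ∈ mult k := by
  rw [mul_comm]; exact mul_mem_mult hb ha

theorem mul_mem_mult_mul {k l : ℤ} {a b : ℝ} (ha : a ∈ mult k) (hb : b ∈ mult l) :
    a * b ∈ mult (k * l) := by
  obtain ⟨s, rfl⟩ := mem_mult.mp ha
  obtain ⟨t, rfl⟩ := mem_mult.mp hb
  exact mem_mult.mpr ⟨s * t, by push_cast; ring⟩

/-- The elements of the form `k y` with `y` in `R`. -/
def multiples (R : Subring ℍ[ℝ]) (k : ℤ) : AddSubgroup ℍ[ℝ] where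
  carrier := {x | ∃ y ∈ R, x = (k : ℝ) • y}
  zero_mem' := ⟨0, R.zero_mem, by simp⟩
  add_mem' := by
    rintro _ _ ⟨a, ha, rfl⟩ ⟨b, hb, rfl⟩
    exact ⟨a + b, R.add_mem ha hb, by rw [smul_add]⟩
  neg_mem' := by
    rintro _ ⟨a, ha, rfl⟩
    exact ⟨-a, R.neg_mem ha, by rw [smul_neg]⟩

section

variable {R : Subring ℍ[ℝ]} {e : Fin 4 → ℍ[ℝ]} {k : ℤ} {x y z : ℍ[ℝ]}

theorem smul_mem_multiples (hx : x ∈ R) : (k : ℝ) • x ∈ multiples R k := ⟨x, hx, rfl⟩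

theorem smul_mem_of_mem (m : ℤ) (hx : x ∈ R) : (m : ℝ) • x ∈ R := by
  have : (m : ℝ) • x = (m : ℍ[ℝ]) * x := by
    rw [← Quaternion.coe_intCast, Quaternion.coe_mul_eq_smul]
  rw [this]
  exact R.mul_mem (intCast_mem R m) hx

theorem multiples_le (hx : x ∈ multiples R k) : x ∈ R := by
  obtain ⟨y, hy, rfl⟩ := hx
  exact smul_mem_of_mem k hy

theorem mul_mem_multiples (hx : x ∈ multiples R k) (hy : y ∈ R) : x * y ∈ multiples R k := by
  obtain ⟨w, hw, rfl⟩ := hx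
  exact ⟨w * y, R.mul_mem hw hy, by rw [smul_mul_assoc]⟩

theorem mul_mem_multiples' (hx : x ∈ R) (hy : y ∈ multiples R k) : x * y ∈ multiples R k := by
  obtain ⟨w, hw, rfl⟩ := hy
  exact ⟨x * w, R.mul_mem hx hw, by rw [mul_smul_comm]⟩

theorem zsmul_mem_multiples (m : ℤ) (hx : x ∈ multiples R k) : (m : ℝ) • x ∈ multiples R k := by
  obtain ⟨w, hw, rfl⟩ := hx
  exact ⟨(m : ℝ) • w, smul_mem_of_mem m hw, by rw [smul_comm]⟩

theorem smul_mem_multiples_of_dvd {m : ℤ} (h : k ∣ m) (hx : x ∈ R) :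
    (m : ℝ) • x ∈ multiples R k := by
  obtain ⟨t, rfl⟩ := h
  exact ⟨(t : ℝ) • x, smul_mem_of_mem t hx, by rw [smul_smul]; push_cast; rfl⟩

theorem tr_add : tr (x + y) = tr x + tr y := by simp [tr]; ring
theorem tr_sub : tr (x - y) = tr x - tr y := by simp [tr]; ring
theorem tr_smul (r : ℝ) : tr (r • x) = r * tr x := by simp [tr]; ring
theorem tr_mul_comm : tr (x * y) = tr (y * x) := by simp [tr]; ring
theorem tr_star : tr (star x) = tr x := by simp [tr]
theorem normSq_add_eq : normSq (x + y) = normSq x + normSq y + tr (x * star y) := by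
  simp [Quaternion.normSq_def', tr]; ring
theorem normSq_sub_eq : normSq (x - y) = normSq x + normSq y - tr (x * star y) := by
  simp [Quaternion.normSq_def', tr]; ring
-- The commutator c is a pure quaternion, so n(c) = -c², and tr(c(xy + yx)) = 0. The norm of a
-- commutator thereby becomes a value of the trilinear form below.
theorem normSq_commutator : normSq (x * y - y * x) = -tr ((x * y - y * x) * (x * y)) := by
  simp only [Quaternion.normSq_def', tr, Quaternion.re_mul, Quaternion.imI_mul,
    Quaternion.imJ_mul, Quaternion.imK_mul, Quaternion.re_sub, Quaternion.imI_sub,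
    Quaternion.imJ_sub, Quaternion.imK_sub]
  ring

/-- The alternating trilinear form `tr([x, y] z)`. -/
def tripleTrace (x y z : ℍ[ℝ]) : ℝ := tr ((x * y - y * x) * z)

theorem tripleTrace_eq (x y z : ℍ[ℝ]) : tripleTrace x y z =
    -4 * (x.imI * (y.imJ * z.imK - y.imK * z.imJ) - x.imJ * (y.imI * z.imK - y.imK * z.imI)
      + x.imK * (y.imI * z.imJ - y.imJ * z.imI)) := by
  simp [tripleTrace, tr]
  ring

/-- The form is alternating and vanishes when an argument is real, so only the 3×3 determinant of
the coordinates along `e 1`, `e 2`, `e 3` survives. -/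
theorem tripleTrace_sum (h1 : e 0 = 1) (a b c : Fin 4 → ℝ) :
    tripleTrace (∑ i, a i • e i) (∑ i, b i • e i) (∑ i, c i • e i) =
      (a 1 * (b 2 * c 3 - b 3 * c 2) - a 2 * (b 1 * c 3 - b 3 * c 1)
        + a 3 * (b 1 * c 2 - b 2 * c 1)) * tripleTrace (e 1) (e 2) (e 3) := by
  simp only [tripleTrace_eq, Fin.sum_univ_four, h1, Quaternion.imI_add, Quaternion.imJ_add,
    Quaternion.imK_add, Quaternion.imI_smul, Quaternion.imJ_smul, Quaternion.imK_smul,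
    Quaternion.imI_one, Quaternion.imJ_one, Quaternion.imK_one, smul_eq_mul]
  ring

end

/-! ### The discriminant of an integral basis, and the norm form at primes not dividing it. -/

namespace HasIntegralBasis

variable {R : Subring ℍ[ℝ]} {e : Fin 4 → ℍ[ℝ]} {x y z : ℍ[ℝ]}

theorem normSq_mem (h : HasIntegralBasis R e) (hx : x ∈ R) : normSq x ∈ mult 1 := by
  obtain ⟨k, hk⟩ := h.exists_normSq_eq hx
  exact mem_mult.mpr ⟨k, by simpa using hk⟩

theorem tr_mem (h : HasIntegralBasis R e) (hx : x ∈ R) : tr x ∈ mult 1 := by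
  obtain ⟨k, hk⟩ := h.exists_tr_eq hx
  exact mem_mult.mpr ⟨k, by simpa using hk⟩

theorem smul_sum_mem_iff (h : HasIntegralBasis R e) {k : ℤ} (c : Fin 4 → ℤ) :
    ∑ i, (c i : ℝ) • e i ∈ multiples R k ↔ ∀ i, k ∣ c i := by
  constructor
  · rintro ⟨y, hy, hxy⟩ i
    obtain ⟨d, rfl⟩ := (h.mem _).mp hy
    have h2 : ∑ i, ((c i : ℝ) - k * d i) • e i = 0 := by
      simp only [sub_smul, Finset.sum_sub_distrib, hxy, Finset.smul_sum, smul_smul, sub_self]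
    have h3 := (Fintype.linearIndependent_iff.mp h.li) _ h2 i
    refine ⟨d i, ?_⟩
    have : (c i : ℝ) = k * d i := by linarith
    exact_mod_cast this
  · intro hc
    choose d hd using hc
    refine ⟨∑ i, (d i : ℝ) • e i, (h.mem _).mpr ⟨d, rfl⟩, ?_⟩
    rw [Finset.smul_sum]
    refine Finset.sum_congr rfl fun i _ => ?_
    rw [smul_smul, hd]
    push_cast
    rfl

theorem exists_disc (h : HasIntegralBasis R e) :
    ∃ d : ℤ, tripleTrace (e 1) (e 2) (e 3) = d :=
  h.exists_tr_eq (R.mul_mem (R.sub_mem (R.mul_mem (h.basis_mem 1) (h.basis_mem 2))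
    (R.mul_mem (h.basis_mem 2) (h.basis_mem 1))) (h.basis_mem 3))

/-- The (signed) reduced discriminant of the basis `e`. -/
def disc (h : HasIntegralBasis R e) : ℤ := h.exists_disc.choose

theorem tripleTrace_basis (h : HasIntegralBasis R e) :
    tripleTrace (e 1) (e 2) (e 3) = h.disc := h.exists_disc.choose_spec

theorem exists_real_coords (h : HasIntegralBasis R e) (x : ℍ[ℝ]) :
    ∃ c : Fin 4 → ℝ, x = ∑ i, c i • e i := by
  let B : Module.Basis (Fin 4) ℝ ℍ[ℝ] := basisOfLinearIndependentOfCardEqFinrank h.li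
    (by rw [Quaternion.finrank_eq_four]; rfl)
  have hB : ∀ i, B i = e i := fun i => by simp [B]
  refine ⟨fun i => B.repr x i, ?_⟩
  simp_rw [← hB]
  exact (B.sum_repr x).symm

theorem disc_ne_zero (h : HasIntegralBasis R e) : h.disc ≠ 0 := by
  intro h0
  obtain ⟨a, ha⟩ := h.exists_real_coords (coordEquiv.symm ![0, 1, 0, 0])
  obtain ⟨b, hb⟩ := h.exists_real_coords (coordEquiv.symm ![0, 0, 1, 0])
  obtain ⟨c, hc⟩ := h.exists_real_coords (coordEquiv.symm ![0, 0, 0, 1])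
  have h1 := tripleTrace_sum h.one a b c
  rw [← ha, ← hb, ← hc, h.tripleTrace_basis, h0, tripleTrace_eq] at h1
  simp only [coordEquiv_symm_imI, coordEquiv_symm_imJ, coordEquiv_symm_imK] at h1
  simp at h1

theorem tripleTrace_mem (h : HasIntegralBasis R e) (hx : x ∈ R) (hy : y ∈ R) (hz : z ∈ R) :
    tripleTrace x y z ∈ mult h.disc := by
  obtain ⟨a, rfl⟩ := (h.mem _).mp hx
  obtain ⟨b, rfl⟩ := (h.mem _).mp hy
  obtain ⟨c, rfl⟩ := (h.mem _).mp hz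
  rw [tripleTrace_sum h.one, h.tripleTrace_basis, mem_mult]
  exact ⟨a 1 * (b 2 * c 3 - b 3 * c 2) - a 2 * (b 1 * c 3 - b 3 * c 1)
        + a 3 * (b 1 * c 2 - b 2 * c 1), by push_cast; ring⟩

/-- The radical of the norm form modulo `k`. -/
def radical (_ : HasIntegralBasis R e) (k : ℤ) (x : ℍ[ℝ]) : Prop :=
  x ∈ R ∧ normSq x ∈ mult k ∧ ∀ y ∈ R, tr (x * y) ∈ mult k

/-- Pairing x with the commutator of two of the basis vectors `e 1`, `e 2`, `e 3` returns the
coordinate of x along the third one, times the discriminant. So p divides these three coordinates,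
and the norm of x is then congruent to the square of the remaining one. -/
theorem mem_multiples_of_radical_of_not_dvd (h : HasIntegralBasis R e) {p : ℕ} (hp : p.Prime)
    (hd : ¬ (p : ℤ) ∣ h.disc) (hx : h.radical p x) : x ∈ multiples R p := by
  obtain ⟨hxR, hn, ht⟩ := hx
  have hpZ : Prime (p : ℤ) := Nat.prime_iff_prime_int.mp hp
  obtain ⟨a, rfl⟩ := (h.mem _).mp hxR
  have key : ∀ i j k : Fin 4, ∀ m : ℤ, tripleTrace (e i) (e j) (∑ i, (a i : ℝ) • e i) =
      (m : ℝ) * h.disc → (p : ℤ) ∣ m := fun i j k m hm => by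
    have h2 := ht _ (R.sub_mem (R.mul_mem (h.basis_mem i) (h.basis_mem j))
      (R.mul_mem (h.basis_mem j) (h.basis_mem i)))
    rw [tr_mul_comm, ← tripleTrace, hm] at h2
    have h3 : (p : ℤ) ∣ m * h.disc := intCast_mem_mult.mp (by push_cast; exact h2)
    exact (hpZ.dvd_or_dvd h3).resolve_right hd
  have hsingle : ∀ i, e i = ∑ j, ((Pi.single i 1 : Fin 4 → ℝ) j) • e j := fun i => by
    simp [Pi.single_apply]
  have h1 : (p : ℤ) ∣ a 1 := key 2 3 1 _ (by
    rw [hsingle 2, hsingle 3, tripleTrace_sum h.one, h.tripleTrace_basis]; simp)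
  have h2 : (p : ℤ) ∣ a 2 := key 3 1 1 _ (by
    rw [hsingle 3, hsingle 1, tripleTrace_sum h.one, h.tripleTrace_basis]; simp)
  have h3 : (p : ℤ) ∣ a 3 := key 1 2 1 _ (by
    rw [hsingle 1, hsingle 2, tripleTrace_sum h.one, h.tripleTrace_basis]; simp)
  have h0 : (p : ℤ) ∣ a 0 := by
    obtain ⟨b1, hb1⟩ := h1
    obtain ⟨b2, hb2⟩ := h2
    obtain ⟨b3, hb3⟩ := h3
    set w : ℍ[ℝ] := (b1 : ℝ) • e 1 + (b2 : ℝ) • e 2 + (b3 : ℝ) • e 3 with hw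
    have hwR : w ∈ R := R.add_mem (R.add_mem (smul_mem_of_mem _ (h.basis_mem 1))
      (smul_mem_of_mem _ (h.basis_mem 2))) (smul_mem_of_mem _ (h.basis_mem 3))
    have hx2 : ∑ i, (a i : ℝ) • e i = ((a 0 : ℝ) : ℍ[ℝ]) + (p : ℝ) • w := by
      rw [Fin.sum_univ_four, h.one, hb1, hb2, hb3, hw]
      push_cast
      ext <;> simp <;> ring
    obtain ⟨n, hn'⟩ := h.exists_normSq_eq hwR
    obtain ⟨t, ht'⟩ := h.exists_tr_eq hwR
    have h4 : normSq (((a 0 : ℝ) : ℍ[ℝ]) + (p : ℝ) • w) =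
        ((a 0 ^ 2 + p * (a 0 * t + p * n) : ℤ) : ℝ) := by
      push_cast
      rw [← hn', ← ht']
      simp [Quaternion.normSq_def', tr]
      ring
    rw [hx2, h4, intCast_mem_mult] at hn
    have h5 := (dvd_add_left (dvd_mul_right _ _)).mp hn
    exact hpZ.dvd_of_dvd_pow h5
  rw [h.smul_sum_mem_iff]
  intro i
  fin_cases i
  exacts [h0, h1, h2, h3]

end HasIntegralBasis

/-! ### The norm form at the primes dividing the discriminant -/

namespace HasIntegralBasis

variable {R : Subring ℍ[ℝ]} {e : Fin 4 → ℍ[ℝ]} {x y z : ℍ[ℝ]} {p : ℕ}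

theorem tr_mem_of_multiples (h : HasIntegralBasis R e) {k : ℤ} (hx : x ∈ multiples R k) :
    tr x ∈ mult k := by
  obtain ⟨w, hw, rfl⟩ := hx
  rw [tr_smul]
  exact mul_mem_mult (mem_mult.mpr ⟨1, by simp⟩) (h.tr_mem hw)

theorem normSq_mem_of_multiples (h : HasIntegralBasis R e) {k : ℤ} (hx : x ∈ multiples R k) :
    normSq x ∈ mult (k * k) := by
  obtain ⟨w, hw, rfl⟩ := hx
  rw [Quaternion.normSq_smul, pow_two]
  have hk : (k : ℝ) ∈ mult k := mem_mult.mpr ⟨1, by simp⟩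
  exact mul_mem_mult (mul_mem_mult_mul hk hk) (h.normSq_mem hw)

theorem radical_of_multiples (h : HasIntegralBasis R e) {k : ℤ} (hx : x ∈ multiples R k) :
    h.radical k x :=
  ⟨multiples_le hx, mult_le_of_dvd (dvd_mul_right k k) (h.normSq_mem_of_multiples hx),
    fun _ hy => h.tr_mem_of_multiples (mul_mem_multiples hx hy)⟩

theorem radical_add (h : HasIntegralBasis R e) {k : ℤ} (hx : h.radical k x) (hy : h.radical k y) :
    h.radical k (x + y) :=
  ⟨R.add_mem hx.1 hy.1, by
    rw [normSq_add_eq]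
    exact add_mem (add_mem hx.2.1 hy.2.1) (hx.2.2 _ (h.star_mem hy.1)),
   fun z hz => by rw [add_mul, tr_add]; exact add_mem (hx.2.2 z hz) (hy.2.2 z hz)⟩

theorem mul_radical (h : HasIntegralBasis R e) {k : ℤ} (hx : x ∈ R) (hy : h.radical k y) :
    h.radical k (x * y) :=
  ⟨R.mul_mem hx hy.1, by rw [map_mul]; exact mul_mem_mult' (h.normSq_mem hx) hy.2.1,
   fun z hz => by
    rw [mul_assoc, tr_mul_comm, mul_assoc]
    exact hy.2.2 _ (R.mul_mem hz hx)⟩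

theorem coe_int_eq (m : ℤ) : ((m : ℝ) : ℍ[ℝ]) = (m : ℍ[ℝ]) := Quaternion.coe_intCast m

theorem zsmul_radical (h : HasIntegralBasis R e) {k : ℤ} (m : ℤ) (hx : h.radical k x) :
    h.radical k ((m : ℝ) • x) := by
  have : (m : ℝ) • x = (m : ℍ[ℝ]) * x := by
    rw [← coe_int_eq, Quaternion.coe_mul_eq_smul]
  rw [this]
  exact h.mul_radical (intCast_mem R m) hx

theorem mem_multiples_of_radical (h : HasIntegralBasis R e) (hM : IsNormMaximal R) (hp : 0 < p)
    (hx : h.radical p x) (hn : normSq x ∈ mult (p * p)) : x ∈ multiples R p := by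
  obtain ⟨y, hy, hxy⟩ := hM x hx.1 p hp
    (fun y hy => by
      obtain ⟨t, ht⟩ := mem_mult.mp (hx.2.2 y hy)
      exact ⟨t, by simpa using ht⟩)
    (by
      obtain ⟨t, ht⟩ := mem_mult.mp hn
      exact ⟨t, by rw [ht]; push_cast; ring⟩)
  exact ⟨y, hy, by simpa using hxy⟩

/-- The product stays in the radical and each factor contributes one p to the norm, so norm
maximality applies. -/
theorem mul_mem_multiples_of_radical (h : HasIntegralBasis R e) (hM : IsNormMaximal R) (hp : 0 < p)
    (hx : x ∈ R) (hnx : normSq x ∈ mult p) (hy : h.radical p y) : x * y ∈ multiples R p := by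
  refine h.mem_multiples_of_radical hM hp (h.mul_radical hx hy) ?_
  rw [map_mul]
  exact mul_mem_mult_mul hnx hy.2.1

theorem commutator_mem (_ : HasIntegralBasis R e) (hx : x ∈ R) (hy : y ∈ R) :
    x * y - y * x ∈ R :=
  R.sub_mem (R.mul_mem hx hy) (R.mul_mem hy hx)

theorem tr_commutator_mem (h : HasIntegralBasis R e) {k : ℤ} (hd : k ∣ h.disc) (hx : x ∈ R)
    (hy : y ∈ R) (hz : z ∈ R) : tr ((x * y - y * x) * z) ∈ mult k :=
  mult_le_of_dvd hd (h.tripleTrace_mem hx hy hz)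

theorem radical_commutator (h : HasIntegralBasis R e) {k : ℤ} (hd : k ∣ h.disc) (hx : x ∈ R)
    (hy : y ∈ R) : h.radical k (x * y - y * x) :=
  ⟨h.commutator_mem hx hy, by
    rw [normSq_commutator]
    exact neg_mem (h.tr_commutator_mem hd hx hy (R.mul_mem hx hy)),
   fun _ hz => h.tr_commutator_mem hd hx hy hz⟩

theorem dvd_of_combination (h : HasIntegralBasis R e) {k : ℤ} (a b c d : ℤ)
    (hx : (a : ℝ) • (1 : ℍ[ℝ]) + (b : ℝ) • e 1 + (c : ℝ) • e 2 + (d : ℝ) • e 3 ∈ multiples R k) :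
    k ∣ b ∧ k ∣ c := by
  have h1 : (a : ℝ) • (1 : ℍ[ℝ]) + (b : ℝ) • e 1 + (c : ℝ) • e 2 + (d : ℝ) • e 3 =
      ∑ i, ((![a, b, c, d] i : ℤ) : ℝ) • e i := by
    rw [Fin.sum_univ_four, h.one]
    simp
  rw [h1, h.smul_sum_mem_iff] at hx
  exact ⟨hx 1, hx 2⟩

theorem dvd_of_mem (h : HasIntegralBasis R e) {k : ℤ} (a b c : ℤ)
    (hx : (a : ℍ[ℝ]) + (b : ℝ) • e 1 + (c : ℝ) • e 2 ∈ multiples R k) :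
    k ∣ b ∧ k ∣ c := by
  refine h.dvd_of_combination a b c 0 ?_
  convert hx using 1
  rw [← coe_int_eq]
  ext <;> simp

theorem intCast_mem_multiples (m : ℤ) {k : ℤ} (hk : k ∣ m) : (m : ℍ[ℝ]) ∈ multiples R k := by
  obtain ⟨t, rfl⟩ := hk
  refine ⟨t, intCast_mem R t, ?_⟩
  rw [← coe_int_eq, ← coe_int_eq]
  ext <;> simp

/-- If `R` is commutative modulo `p`, then all elements have a residue that is an integer modulo
the radical of the norm form. -/
theorem exists_sub_intCast_radical (h : HasIntegralBasis R e) (hp : p.Prime)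
    (hc : ∀ x ∈ R, ∀ y ∈ R, x * y - y * x ∈ multiples R p) (hx : x ∈ R) :
    ∃ m : ℤ, h.radical p (x - m) := by
  have hpZ : Prime (p : ℤ) := Nat.prime_iff_prime_int.mp hp
  rcases hp.eq_two_or_odd' with rfl | hodd
  -- If all traces are even, the radical modulo 2 consists of the elements of even norm, and
  -- subtracting 1 changes the parity of the norm.
  · by_cases hall : ∀ u ∈ R, tr u ∈ mult (2 : ℕ)
    · obtain ⟨n, hn⟩ := h.exists_normSq_eq hx
      obtain ⟨t, ht⟩ := mem_mult.mp (hall x hx)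
      rcases Int.even_or_odd' n with ⟨m, hm | hm⟩
      · refine ⟨0, by simpa using hx, ?_, fun y hy => hall _ (R.mul_mem (by simpa using hx) hy)⟩
        rw [Int.cast_zero, sub_zero, hn, intCast_mem_mult]
        exact ⟨m, hm⟩
      · have h1 : x - ((1 : ℤ) : ℍ[ℝ]) ∈ R := R.sub_mem hx (intCast_mem R 1)
        refine ⟨1, h1, ?_, fun y hy => hall _ (R.mul_mem h1 hy)⟩
        rw [normSq_sub_eq, Int.cast_one, star_one, mul_one, ht, hn, mem_mult, hm]
        exact ⟨m + 1 - t, by push_cast; simp; ring⟩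
    -- With an element u of odd trace, commutativity modulo 2 makes every x of even trace congruent
    -- to the integer tr(xu). But one of `e 1`, `e 2`, `e 1 + e 2` has even trace and is not an
    -- integer modulo 2.
    · exfalso
      push Not at hall
      obtain ⟨u, hu, hut⟩ := hall
      obtain ⟨s, hs⟩ := h.exists_tr_eq hu
      rw [hs, intCast_mem_mult] at hut
      have key : ∀ x ∈ R, tr x ∈ mult (2 : ℕ) → ∃ m : ℤ, (m : ℍ[ℝ]) + x ∈ multiples R (2 : ℕ) := by
        intro x hx htx
        obtain ⟨t, ht⟩ := mem_mult.mp htx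
        obtain ⟨r, hr⟩ := h.exists_tr_eq (R.mul_mem hx hu)
        obtain ⟨q, hq⟩ : Odd s := by
          rw [← Int.not_even_iff_odd, even_iff_two_dvd]; exact_mod_cast hut
        refine ⟨r, ?_⟩
        have h1 := hc u hu x hx
        have h2 : (2 : ℝ) • (x * u) ∈ multiples R (2 : ℕ) := by
          have := smul_mem_multiples (k := ((2 : ℕ) : ℤ)) (R.mul_mem hx hu)
          exact_mod_cast this
        have h3 : (2 : ℝ) • ((s : ℝ) • (t : ℍ[ℝ]) - (q : ℝ) • x - (t : ℝ) • u) ∈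
            multiples R (2 : ℕ) := by
          have := smul_mem_multiples (k := ((2 : ℕ) : ℤ)) (R.sub_mem
            (R.sub_mem (smul_mem_of_mem s (intCast_mem R t)) (smul_mem_of_mem q hx))
            (smul_mem_of_mem t hu))
          exact_mod_cast this
        have h4 : (r : ℍ[ℝ]) + x = (u * x - x * u) + (2 : ℝ) • (x * u) +
            (2 : ℝ) • ((s : ℝ) • (t : ℍ[ℝ]) - (q : ℝ) • x - (t : ℝ) • u) := by
          have e1 : ((r : ℝ) : ℍ[ℝ]) = x * u + star u * star x := by
            have h5 := mul_eq_tr_sub x u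
            rw [hr] at h5
            exact eq_add_of_sub_eq h5.symm
          have hs' : (s : ℝ) = 2 * q + 1 := by rw [hq]; push_cast; rfl
          rw [← coe_int_eq r, e1, star_eq_tr_sub u, star_eq_tr_sub x, hs, ht, ← coe_int_eq t, hs']
          ext <;> simp <;> ring
        rw [h4]
        exact add_mem (add_mem h1 h2) h3
      obtain ⟨t1, ht1⟩ := h.exists_tr_eq (h.basis_mem 1)
      obtain ⟨t2, ht2⟩ := h.exists_tr_eq (h.basis_mem 2)
      have big : ∃ b c : ℤ, tr ((b : ℝ) • e 1 + (c : ℝ) • e 2) ∈ mult (2 : ℕ) ∧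
          (¬ (2 : ℤ) ∣ b ∨ ¬ (2 : ℤ) ∣ c) := by
        rcases Int.even_or_odd' t1 with ⟨m, hm | hm⟩
        · exact ⟨1, 0, mem_mult.mpr ⟨m, by rw [tr_add, tr_smul, tr_smul, ht1, hm]; push_cast; ring⟩,
            Or.inl (by norm_num)⟩
        rcases Int.even_or_odd' t2 with ⟨m', hm' | hm'⟩
        · exact ⟨0, 1, mem_mult.mpr ⟨m', by rw [tr_add, tr_smul, tr_smul, ht2, hm']; push_cast; ring⟩,
            Or.inr (by norm_num)⟩
        · exact ⟨1, 1, mem_mult.mpr ⟨m + m' + 1, by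
            rw [tr_add, tr_smul, tr_smul, ht1, ht2, hm, hm']; push_cast; ring⟩,
            Or.inr (by norm_num)⟩
      obtain ⟨b, c, hbc, hbc'⟩ := big
      obtain ⟨m, hm⟩ := key _ (R.add_mem (smul_mem_of_mem b (h.basis_mem 1))
        (smul_mem_of_mem c (h.basis_mem 2))) hbc
      rw [← add_assoc] at hm
      have := h.dvd_of_mem m b c hm
      rcases hbc' with h5 | h5
      · exact h5 this.1
      · exact h5 this.2
  · -- the elements `2x - tr x`
    have hδR : ∀ x ∈ R, x - star x ∈ R := fun x hx => R.sub_mem hx (h.star_mem hx)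
    have hδ : ∀ x ∈ R, ∀ z ∈ R, ∃ s : ℤ, tr ((x - star x) * z) = s ∧
        (x - star x) * (z - star z) - s ∈ multiples R p := by
      intro x hx z hz
      obtain ⟨s, hs⟩ := h.exists_tr_eq (R.mul_mem (hδR x hx) hz)
      refine ⟨s, hs, ?_⟩
      have h1 := hc _ (h.star_mem hz) _ (hδR x hx)
      have h2 : (x - star x) * (z - star z) - (s : ℍ[ℝ]) =
          star z * (x - star x) - (x - star x) * star z := by
        rw [← coe_int_eq, ← hs]
        ext <;> simp [tr] <;> ring
      rw [h2]
      exact h1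
    have hp2 : ¬ (p : ℤ) ∣ 2 := by
      intro h2
      have := Int.le_of_dvd (by norm_num) h2
      have h3 := hp.two_le
      have : p = 2 := by omega
      subst this
      exact absurd hodd (by decide)
    -- Write δx = x - x̄. If n(δx) were invertible modulo p, every δz would be a multiple of δx
    -- modulo p, against the independence of `e 1` and `e 2`.
    have hn : ∀ x ∈ R, normSq (x - star x) ∈ mult p := by
      intro x hx
      by_contra hnx
      obtain ⟨n, hn⟩ := h.exists_normSq_eq (hδR x hx)
      rw [hn, intCast_mem_mult] at hnx
      have h1 : ∀ z ∈ R, ∃ s : ℤ, (n : ℝ) • (z - star z) + (s : ℝ) • (x - star x) ∈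
          multiples R p := by
        intro z hz
        obtain ⟨s, -, hs⟩ := hδ x hx z hz
        refine ⟨s, ?_⟩
        have h2 := neg_mem (mul_mem_multiples' (hδR x hx) hs)
        convert h2 using 1
        rw [← hn, ← coe_int_eq]
        simp only [Quaternion.normSq_def']
        ext <;> simp <;> ring
      obtain ⟨s1, h1'⟩ := h1 _ (h.basis_mem 1)
      obtain ⟨s2, h2'⟩ := h1 _ (h.basis_mem 2)
      obtain ⟨t1, ht1⟩ := h.exists_tr_eq (h.basis_mem 1)
      obtain ⟨t2, ht2⟩ := h.exists_tr_eq (h.basis_mem 2)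
      have h3 := sub_mem (zsmul_mem_multiples s2 h1') (zsmul_mem_multiples s1 h2')
      have h4 := h.dvd_of_mem (s1 * n * t2 - s2 * n * t1) (s2 * n * 2) (-(s1 * n * 2)) (by
        convert h3 using 1
        rw [star_eq_tr_sub, star_eq_tr_sub (e 2), ht1, ht2, ← coe_int_eq]
        push_cast
        ext <;> simp <;> ring)
      have h5 : (p : ℤ) ∣ s1 := by
        rcases hpZ.dvd_or_dvd ((dvd_neg).mp h4.2) with h5 | h5
        · exact (hpZ.dvd_or_dvd h5).resolve_right hnx
        · exact absurd h5 hp2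
      have h6 := sub_mem h1' (smul_mem_multiples_of_dvd h5 (hδR x hx))
      have h7 := h.dvd_of_mem (-(n * t1)) (n * 2) 0 (by
        convert h6 using 1
        rw [star_eq_tr_sub (e 1), ht1, ← coe_int_eq]
        push_cast
        ext <;> simp <;> ring)
      rcases hpZ.dvd_or_dvd h7.1 with h8 | h8
      · exact hnx h8
      · exact hp2 h8
    -- Since δx δz is congruent to the integer s = tr(δx z), its square s² is congruent to
    -- n(δx)n(δz), which is 0 modulo p.
    have ht : ∀ x ∈ R, ∀ z ∈ R, tr ((x - star x) * z) ∈ mult p := by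
      intro x hx z hz
      obtain ⟨s, hs, hs'⟩ := hδ x hx z hz
      rw [hs, intCast_mem_mult]
      have h1 := (h.radical_of_multiples hs')
      have h2 : ((s : ℝ)) ^ 2 ∈ mult p := by
        have h3 : (s : ℝ) ^ 2 = normSq ((x - star x) * (z - star z)) +
            normSq ((x - star x) * (z - star z) - (s : ℍ[ℝ])) -
              tr (((x - star x) * (z - star z) - (s : ℍ[ℝ]))
              * star ((x - star x) * (z - star z))) := by
          rw [← coe_int_eq]
          generalize (x - star x) * (z - star z) = w
          simp [Quaternion.normSq_def', tr]
          ring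
        rw [h3, map_mul]
        exact sub_mem (add_mem (mul_mem_mult (hn x hx) (h.normSq_mem (hδR z hz))) h1.2.1)
          (h1.2.2 _ (h.star_mem (R.mul_mem (hδR x hx) (hδR z hz))))
      exact hpZ.dvd_of_dvd_pow (n := 2) (intCast_mem_mult.mp (by push_cast; exact h2))
    -- For p = 2j + 1 the inverse of 2 is j + 1, and x is half the sum of tr(x) and δx.
    obtain ⟨j, hj⟩ := hodd
    obtain ⟨t, htx⟩ := h.exists_tr_eq hx
    refine ⟨(j + 1) * t, ?_⟩
    have h1 : h.radical p (((j + 1 : ℤ) : ℝ) • (x - star x)) :=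
      h.zsmul_radical _ ⟨hδR x hx, hn x hx, ht x hx⟩
    have h2 : h.radical p ((((-p : ℤ)) : ℝ) • x) :=
      h.radical_of_multiples (smul_mem_multiples_of_dvd (by simp) hx)
    have h3 : x - (((j + 1) * t : ℤ) : ℍ[ℝ]) = ((j + 1 : ℤ) : ℝ) • (x - star x) +
        ((-p : ℤ) : ℝ) • x := by
      rw [star_eq_tr_sub, htx, ← coe_int_eq, hj]
      push_cast
      ext <;> simp <;> ring
    rw [h3]
    exact h.radical_add h1 h2

end HasIntegralBasis

/-! ### Norms divisible by a prime of the discriminant, and squarefreeness of the discriminant. -/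

namespace HasIntegralBasis

variable {R : Subring ℍ[ℝ]} {e : Fin 4 → ℍ[ℝ]} {x y z : ℍ[ℝ]} {p : ℕ}

/-- Commutators lie in the radical. If they all vanish modulo p, then `e 1` minus its integer
residue lies in the radical and is not divisible by p. -/
theorem exists_radical (h : HasIntegralBasis R e) (hp : p.Prime) (hd : (p : ℤ) ∣ h.disc) :
    ∃ y, h.radical p y ∧ y ∉ multiples R p := by
  by_cases hc : ∀ x ∈ R, ∀ y ∈ R, x * y - y * x ∈ multiples R p
  · obtain ⟨m, hm⟩ := h.exists_sub_intCast_radical hp hc (h.basis_mem 1)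
    refine ⟨_, hm, fun h1 => ?_⟩
    have h2 := h.dvd_of_mem (-m) 1 0 (by
      convert h1 using 1
      rw [← coe_int_eq, ← coe_int_eq]
      ext <;> simp <;> ring)
    have := hp.one_lt
    have h3 := Int.le_of_dvd (by norm_num) h2.1
    omega
  · push Not at hc
    obtain ⟨x, hx, y, hy, hxy⟩ := hc
    exact ⟨_, h.radical_commutator hd hx hy, hxy⟩

theorem exists_normSq_radical (h : HasIntegralBasis R e) (hM : IsNormMaximal R) (hp : p.Prime)
    (hy : h.radical p y) (hy' : y ∉ multiples R p) :
    ∃ n : ℤ, normSq y = p * n ∧ ¬ (p : ℤ) ∣ n := by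
  obtain ⟨n, hn⟩ := mem_mult.mp hy.2.1
  refine ⟨n, by simpa using hn, fun ⟨m, hm⟩ => hy' (h.mem_multiples_of_radical hM hp.pos hy ?_)⟩
  rw [hn, hm]
  exact mem_mult.mpr ⟨m, by push_cast; ring⟩

/-- The norm of y contains exactly one factor p, so y can be cancelled at the cost of one p. -/
theorem normSq_mem_of_mul_radical (h : HasIntegralBasis R e) (hM : IsNormMaximal R)
    (hp : p.Prime) (hy : h.radical p y) (hy' : y ∉ multiples R p) (hx : x ∈ R) {k : ℤ}
    (hxy : normSq (x * y) ∈ mult (p * k)) (hk : k = p ∨ k = p * p) : normSq x ∈ mult k := by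
  have hpZ : Prime (p : ℤ) := Nat.prime_iff_prime_int.mp hp
  obtain ⟨n, hn, hpn⟩ := h.exists_normSq_radical hM hp hy hy'
  obtain ⟨m, hm⟩ := h.exists_normSq_eq hx
  rw [map_mul, hm, hn] at hxy
  have h1 : (p : ℤ) * k ∣ m * (p * n) := intCast_mem_mult.mp (by push_cast; exact_mod_cast hxy)
  have h2 : k ∣ m * n := by
    rw [mul_left_comm] at h1
    exact Int.dvd_of_mul_dvd_mul_left (by exact_mod_cast hp.ne_zero) h1
  rw [hm, intCast_mem_mult]
  have hco : IsCoprime k n := by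
    have h3 : IsCoprime (p : ℤ) n := (Prime.coprime_iff_not_dvd hpZ).mpr hpn
    rcases hk with rfl | rfl
    · exact h3
    · exact h3.mul_left h3
  exact hco.dvd_of_dvd_mul_right h2

/-- Take y in the radical outside pR. If p divides n(w), then wy and w̄y are in pR, hence so is
tr(w)y; as n(y) has a single factor p, the trace of w is divisible by p. This is applied to w = xz
for all z in R. -/
theorem radical_of_normSq_mem (h : HasIntegralBasis R e) (hM : IsNormMaximal R) (hp : p.Prime)
    (hd : (p : ℤ) ∣ h.disc) (hx : x ∈ R) (hn : normSq x ∈ mult p) : h.radical p x := by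
  obtain ⟨y, hy, hy'⟩ := h.exists_radical hp hd
  have hpZ : Prime (p : ℤ) := Nat.prime_iff_prime_int.mp hp
  have key : ∀ w ∈ R, normSq w ∈ mult p → tr w ∈ mult p := by
    intro w hw hnw
    have h1 := h.mul_mem_multiples_of_radical hM hp.pos hw hnw hy
    have h2 := h.mul_mem_multiples_of_radical hM hp.pos (h.star_mem hw)
      (by rwa [Quaternion.normSq_star]) hy
    obtain ⟨t, ht⟩ := h.exists_tr_eq hw
    have h3 : (t : ℍ[ℝ]) * y ∈ multiples R p := by
      convert add_mem h1 h2 using 1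
      rw [← add_mul, star_eq_tr_sub, ht, ← coe_int_eq]
      simp
    have h4 := h.normSq_mem_of_mul_radical hM hp hy hy' (intCast_mem R t)
      (h.normSq_mem_of_multiples h3) (Or.inl rfl)
    rw [Quaternion.normSq_intCast] at h4
    rw [ht, intCast_mem_mult]
    exact hpZ.dvd_of_dvd_pow (n := 2) (intCast_mem_mult.mp (by push_cast; exact h4))
  refine ⟨hx, hn, fun z hz => key _ (R.mul_mem hx hz) ?_⟩
  rw [map_mul]
  exact mul_mem_mult hn (h.normSq_mem hz)

theorem mem_multiples_of_normSq_mem (h : HasIntegralBasis R e) (hM : IsNormMaximal R)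
    (hp : p.Prime) (hd : (p : ℤ) ∣ h.disc) (hx : x ∈ R) (hn : normSq x ∈ mult (p * p)) :
    x ∈ multiples R p :=
  h.mem_multiples_of_radical hM hp.pos (h.radical_of_normSq_mem hM hp hd hx
    (mult_le_of_dvd (dvd_mul_right _ _) hn)) hn

/-- If p² divided the discriminant, commutators would have norm in p²ℤ, hence lie in pR, and R would
be commutative modulo p. Then `e 1` and `e 2` shifted by integers lie in the radical J and are
independent modulo p. For y in J outside pR, the map f ↦ fy/p sends J to R, and its residue modulo J
is an integer modulo p; the kernel of this residue on J is pR. So J/pR would embed in ℤ/p, which two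
independent elements contradict. -/
theorem not_sq_dvd_disc (h : HasIntegralBasis R e) (hM : IsNormMaximal R) (hp : p.Prime) :
    ¬ ((p : ℤ) * p) ∣ h.disc := by
  intro hd
  have hpp : (p : ℤ) ∣ p * p := dvd_mul_right _ _
  have hdp : (p : ℤ) ∣ h.disc := hpp.trans hd
  have hpZ : Prime (p : ℤ) := Nat.prime_iff_prime_int.mp hp
  have hp0 : (p : ℝ) ≠ 0 := by exact_mod_cast hp.ne_zero
  have hc : ∀ x ∈ R, ∀ y ∈ R, x * y - y * x ∈ multiples R p := fun x hx y hy =>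
    h.mem_multiples_of_radical hM hp.pos (h.radical_commutator hdp hx hy)
      (h.radical_commutator hd hx hy).2.1
  obtain ⟨y, hy, hy'⟩ := h.exists_radical hp hdp
  obtain ⟨n, hn, hpn⟩ := h.exists_normSq_radical hM hp hy hy'
  -- division of `f y` by `p`
  have key : ∀ f, h.radical p f → ∃ (k : ℤ) (j : ℍ[ℝ]), h.radical p j ∧
      f * y = (p : ℝ) • ((k : ℍ[ℝ]) + j) := by
    intro f hf
    obtain ⟨g, hg, hfg⟩ := h.mul_mem_multiples_of_radical hM hp.pos hf.1 hf.2.1 hy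
    obtain ⟨k, hk⟩ := h.exists_sub_intCast_radical hp hc hg
    exact ⟨k, _, hk, by rw [hfg]; simp⟩
  have hdiv : ∀ f, h.radical p f → ∀ j, h.radical p j → f * y = (p : ℝ) • j →
      f ∈ multiples R p := by
    intro f hf j hj hfj
    refine h.mem_multiples_of_radical hM hp.pos hf ?_
    refine h.normSq_mem_of_mul_radical hM hp hy hy' hf.1 ?_ (Or.inr rfl)
    rw [hfj, Quaternion.normSq_smul]
    obtain ⟨m, hm⟩ := mem_mult.mp hj.2.1
    rw [hm]
    exact mem_mult.mpr ⟨m, by push_cast; ring⟩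
  obtain ⟨m₁, hf₁⟩ := h.exists_sub_intCast_radical hp hc (h.basis_mem 1)
  obtain ⟨m₂, hf₂⟩ := h.exists_sub_intCast_radical hp hc (h.basis_mem 2)
  obtain ⟨k₁, j₁, hj₁, hfj₁⟩ := key _ hf₁
  obtain ⟨k₂, j₂, hj₂, hfj₂⟩ := key _ hf₂
  have hneg : ∀ {w}, h.radical p w → h.radical p (-w) := fun {w} hw => by
    have := h.zsmul_radical (-1) hw
    simpa using this
  have h1 : ((k₂ : ℝ) • (e 1 - (m₁ : ℍ[ℝ])) + -((k₁ : ℝ) • (e 2 - (m₂ : ℍ[ℝ])))) ∈ multiples R p := by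
    refine hdiv _ (h.radical_add (h.zsmul_radical k₂ hf₁) (hneg (h.zsmul_radical k₁ hf₂)))
      ((k₂ : ℝ) • j₁ + -((k₁ : ℝ) • j₂))
      (h.radical_add (h.zsmul_radical k₂ hj₁) (hneg (h.zsmul_radical k₁ hj₂))) ?_
    rw [add_mul, neg_mul, smul_mul_assoc, smul_mul_assoc, hfj₁, hfj₂, ← coe_int_eq, ← coe_int_eq]
    ext <;> simp <;> ring
  have h2 := h.dvd_of_mem (k₁ * m₂ - k₂ * m₁) k₂ (-k₁) (by
    convert h1 using 1
    rw [← coe_int_eq, ← coe_int_eq, ← coe_int_eq]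
    push_cast
    ext <;> simp <;> ring)
  have h3 : h.radical p ((k₁ : ℍ[ℝ]) + j₁) :=
    h.radical_add (h.radical_of_multiples (intCast_mem_multiples _ ((dvd_neg).mp h2.2))) hj₁
  have h4 := hdiv _ hf₁ _ h3 hfj₁
  have h5 := h.dvd_of_mem (-m₁) 1 0 (by
    convert h4 using 1
    rw [← coe_int_eq, ← coe_int_eq]
    ext <;> simp <;> ring)
  have := hp.one_lt
  have h6 := Int.le_of_dvd (by norm_num) h5.1
  omega

end HasIntegralBasis

/-! ### The norm form over `p`-adic fields and the reduced discriminant -/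

section NormForm

variable {K L : Type*} [CommRing K] [CommRing L] (g : Fin 4 → Fin 4 → ℤ)

/-- The quaternary quadratic form with integral coefficients `g i j`. -/
def quadForm (t : Fin 4 → K) : K := ∑ i, ∑ j, (g i j : K) * t i * t j

theorem quadForm_map (f : K →+* L) (t : Fin 4 → K) :
    f (quadForm g t) = quadForm g (fun i => f (t i)) := by
  simp [quadForm, map_sum]

theorem quadForm_smul (s : K) (t : Fin 4 → K) :
    quadForm g (fun i => s * t i) = s ^ 2 * quadForm g t := by
  simp only [quadForm, Finset.mul_sum]
  refine Finset.sum_congr rfl fun i _ => Finset.sum_congr rfl fun j _ => by ring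

theorem quadForm_add_smul (s : K) (t u : Fin 4 → K) :
    quadForm g (fun i => t i + s * u i) = quadForm g t +
      s * (quadForm g (fun i => t i + u i) - quadForm g t - quadForm g u)
      + s ^ 2 * quadForm g u := by
  simp only [quadForm, ← Finset.sum_sub_distrib, Finset.mul_sum, ← Finset.sum_add_distrib]
  refine Finset.sum_congr rfl fun i _ => Finset.sum_congr rfl fun j _ => by ring

/-- `g` holds the coefficients of the norm form in the basis `e`. -/
structure IsNormForm (e : Fin 4 → ℍ[ℝ]) : Prop where
  diag : ∀ i, normSq (e i) = g i i
  upper : ∀ i j, i < j → tr (e i * star (e j)) = g i j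
  lower : ∀ i j, j < i → g i j = 0

end NormForm

theorem HasIntegralBasis.exists_isNormForm {R : Subring ℍ[ℝ]} {e : Fin 4 → ℍ[ℝ]}
    (h : HasIntegralBasis R e) : ∃ g, IsNormForm g e := by
  choose N hN using fun i => h.exists_normSq_eq (h.basis_mem i)
  choose T hT using fun i j => h.exists_tr_eq (R.mul_mem (h.basis_mem i)
    (h.star_mem (h.basis_mem j)))
  refine ⟨fun i j => if i = j then N i else if i < j then T i j else 0, ?_, ?_, ?_⟩
  · intro i; simp [hN]
  · intro i j hij; simp [hij, hij.ne, hT]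
  · intro i j hij; simp [hij.not_gt, hij.ne']

namespace IsNormForm

variable {g : Fin 4 → Fin 4 → ℤ} {e : Fin 4 → ℍ[ℝ]}

theorem normSq_sum (hg : IsNormForm g e) (a : Fin 4 → ℝ) :
    normSq (∑ i, a i • e i) = quadForm g a := by
  have hsm : ∀ (s t : ℝ) (x y : ℍ[ℝ]), tr (s • x * star (t • y)) = s * t * tr (x * star y) :=
    fun s t x y => by simp [tr]; ring
  have hadd : ∀ x y z : ℍ[ℝ], tr ((x + y) * star z) = tr (x * star z) + tr (y * star z) :=
    fun x y z => by rw [add_mul, tr_add]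
  simp only [quadForm, Fin.sum_univ_four, normSq_add_eq, hadd, hsm, Quaternion.normSq_smul,
    hg.diag, hg.upper 0 1 (by decide), hg.upper 0 2 (by decide), hg.upper 0 3 (by decide),
    hg.upper 1 2 (by decide), hg.upper 1 3 (by decide), hg.upper 2 3 (by decide),
    hg.lower 1 0 (by decide), hg.lower 2 0 (by decide), hg.lower 3 0 (by decide),
    hg.lower 2 1 (by decide), hg.lower 3 1 (by decide), hg.lower 3 2 (by decide)]
  push_cast
  ring

theorem normSq_sum_int (hg : IsNormForm g e) (a : Fin 4 → ℤ) :
    normSq (∑ i, (a i : ℝ) • e i) = (quadForm g a : ℤ) := by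
  rw [hg.normSq_sum]
  exact (quadForm_map g (Int.castRingHom ℝ) a).symm

variable {A : Subalgebra ℚ ℍ[ℝ]} {c : Module.Basis (Fin 4) ℚ A}

theorem one_tmul_intCast {K : Type*} [Field K] [Algebra ℚ K] (k : ℤ) :
    (1 : K) ⊗ₜ[ℚ] (k : A) = (k : K) • (1 : K ⊗[ℚ] A) := by
  have h1 : (k : A) = (k : ℚ) • (1 : A) := by rw [Algebra.smul_def, mul_one, map_intCast]
  have h2 : (k : ℚ) • (1 : K) = (k : K) := by rw [Algebra.smul_def, mul_one, map_intCast]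
  rw [h1, ← TensorProduct.smul_tmul, h2, Algebra.TensorProduct.one_def, TensorProduct.smul_tmul',
    smul_eq_mul, mul_one]

theorem mul_conj_eq {K : Type*} [Field K] [Algebra ℚ K] (hg : IsNormForm g e)
    (hc : ∀ i, (c i : ℍ[ℝ]) = e i) (d : Fin 4 → A) (hd : ∀ i, (d i : ℍ[ℝ]) = star (e i))
    (t : Fin 4 → K) :
    (∑ i, t i • ((1 : K) ⊗ₜ[ℚ] c i)) * (∑ i, t i • ((1 : K) ⊗ₜ[ℚ] d i)) =
        quadForm g t • (1 : K ⊗[ℚ] A) ∧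
    (∑ i, t i • ((1 : K) ⊗ₜ[ℚ] d i)) * (∑ i, t i • ((1 : K) ⊗ₜ[ℚ] c i)) =
        quadForm g t • (1 : K ⊗[ℚ] A) := by
  have hint : ∀ k : ℤ, (1 : K) ⊗ₜ[ℚ] (k : A) = (k : K) • (1 : K ⊗[ℚ] A) := one_tmul_intCast
  have hnorm : ∀ i, c i * d i = ((g i i : ℤ) : A) ∧ d i * c i = ((g i i : ℤ) : A) := fun i => by
    constructor <;> apply Subtype.ext <;> push_cast
    · rw [hc, hd, Quaternion.self_mul_star, hg.diag, Quaternion.coe_intCast]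
    · rw [hc, hd, Quaternion.star_mul_self, hg.diag, Quaternion.coe_intCast]
  have htr : ∀ i j, i < j → c j * d i = ((g i j : ℤ) : A) - c i * d j ∧
      d j * c i = ((g i j : ℤ) : A) - d i * c j := fun i j hij => by
    constructor <;> apply Subtype.ext <;> push_cast <;>
      rw [hc, hc, hd, hd, ← Quaternion.coe_intCast, ← hg.upper i j hij] <;>
      ext <;> simp [tr] <;> ring
  have e1 : ∀ i j, ((1 : K) ⊗ₜ[ℚ] c i) * ((1 : K) ⊗ₜ[ℚ] d j) = (1 : K) ⊗ₜ[ℚ] (c i * d j) :=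
    fun i j => by rw [Algebra.TensorProduct.tmul_mul_tmul, one_mul]
  have e2 : ∀ i j, ((1 : K) ⊗ₜ[ℚ] d i) * ((1 : K) ⊗ₜ[ℚ] c j) = (1 : K) ⊗ₜ[ℚ] (d i * c j) :=
    fun i j => by rw [Algebra.TensorProduct.tmul_mul_tmul, one_mul]
  constructor
  · simp only [Fin.sum_univ_four, quadForm, add_mul, mul_add, smul_mul_assoc, mul_smul_comm, e1,
      (hnorm _).1, (htr 0 1 (by decide)).1, (htr 0 2 (by decide)).1, (htr 0 3 (by decide)).1,
      (htr 1 2 (by decide)).1, (htr 1 3 (by decide)).1, (htr 2 3 (by decide)).1,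
      TensorProduct.tmul_sub, hint,
      hg.lower 1 0 (by decide), hg.lower 2 0 (by decide), hg.lower 3 0 (by decide),
      hg.lower 2 1 (by decide), hg.lower 3 1 (by decide), hg.lower 3 2 (by decide), Int.cast_zero]
    module
  · simp only [Fin.sum_univ_four, quadForm, add_mul, mul_add, smul_mul_assoc, mul_smul_comm, e2,
      (hnorm _).2, (htr 0 1 (by decide)).2, (htr 0 2 (by decide)).2, (htr 0 3 (by decide)).2,
      (htr 1 2 (by decide)).2, (htr 1 3 (by decide)).2, (htr 2 3 (by decide)).2,
      TensorProduct.tmul_sub, hint,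
      hg.lower 1 0 (by decide), hg.lower 2 0 (by decide), hg.lower 3 0 (by decide),
      hg.lower 2 1 (by decide), hg.lower 3 1 (by decide), hg.lower 3 2 (by decide), Int.cast_zero]
    module

/-- Over a field `K` the algebra `K ⊗ A` is a division algebra if and only if the norm form is
anisotropic. -/
theorem forall_isUnit_iff {K : Type*} [Field K] [Algebra ℚ K] {R : Subring ℍ[ℝ]}
    (h : HasIntegralBasis R e) (hg : IsNormForm g e) (hc : ∀ i, (c i : ℍ[ℝ]) = e i) :
    (∀ x : K ⊗[ℚ] A, x ≠ 0 → IsUnit x) ↔ ∀ t : Fin 4 → K, quadForm g t = 0 → t = 0 := by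
  have hstar : ∀ i, ∃ T : ℤ, star (e i) = (((T : ℤ) : A) - c i : A) := fun i => by
    obtain ⟨T, hT⟩ := h.exists_tr_eq (h.basis_mem i)
    exact ⟨T, by
      rw [star_eq_tr_sub, hT, Quaternion.coe_intCast]; push_cast; rw [hc]⟩
  choose T hT using hstar
  set B := Algebra.TensorProduct.basis K c with hB
  have hBs : ∀ t : Fin 4 → K, ∑ i, t i • ((1 : K) ⊗ₜ[ℚ] c i) = ∑ i, t i • B i := fun t => by
    simp [hB, Algebra.TensorProduct.basis_apply]
  have hmul := fun t : Fin 4 → K => hg.mul_conj_eq hc (fun i => ((T i : ℤ) : A) - c i)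
    (fun i => (hT i).symm) t
  constructor
  · intro hu t ht
    by_contra ht0
    have hX : ∑ i, t i • B i ≠ 0 := fun h0 => ht0 (funext fun i =>
      Fintype.linearIndependent_iff.mp B.linearIndependent t h0 i)
    -- A unit X with X X̄ = q(t) = 0 has X̄ = 0. The coordinates of X̄ other than the first are the
    -- -t_i, and the first one then reduces to t_0 because `T 0` is 2.
    have hXY := (hmul t).1
    rw [ht, zero_smul, hBs, (hu _ hX).mul_right_eq_zero] at hXY
    have hc0 : c 0 = 1 := Subtype.ext (by rw [hc, h.one]; rfl)
    have hT0 : T 0 = 2 := by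
      have h2 := hT 0
      rw [← hc, hc0] at h2
      have h3 := congrArg (fun q : ℍ[ℝ] => q.re) h2
      simp at h3
      have h4 : (T 0 : ℝ) = 2 := by linarith
      exact_mod_cast h4
    have hint : ∀ k : ℤ, (1 : K) ⊗ₜ[ℚ] (k : A) = (k : K) • B 0 := fun k => by
      rw [hB, Algebra.TensorProduct.basis_apply, hc0, ← Algebra.TensorProduct.one_def,
        one_tmul_intCast]
    have hXY2 : ∑ i, (if i = 0 then (∑ j, t j * T j) - t 0 else - t i) • B i = 0 := by
      rw [← hXY]
      have hB' : ∀ i, (1 : K) ⊗ₜ[ℚ] c i = B i := fun i =>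
        (Algebra.TensorProduct.basis_apply c i).symm
      simp only [TensorProduct.tmul_sub, hint, hB', Fin.sum_univ_four]
      simp
      module
    have h3 := Fintype.linearIndependent_iff.mp B.linearIndependent _ hXY2
    have t1 : t 1 = 0 := by simpa using h3 1
    have t2 : t 2 = 0 := by simpa using h3 2
    have t3 : t 3 = 0 := by simpa using h3 3
    have t0 : t 0 = 0 := by
      have h4 := h3 0
      simp [Fin.sum_univ_four, t1, t2, t3, hT0] at h4
      linear_combination h4
    exact ht0 (funext fun i => by fin_cases i <;> assumption)
  · intro ha x hx
    have hx2 : x = ∑ i, (B.repr x i) • ((1 : K) ⊗ₜ[ℚ] c i) := by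
      rw [hBs]; exact (B.sum_repr x).symm
    obtain ⟨h1, h2⟩ := hmul (B.repr x)
    rw [← hx2] at h1 h2
    have hq : quadForm g (B.repr x) ≠ 0 := fun h0 => hx (by
      rw [hx2, ha _ h0]; simp)
    refine isUnit_iff_exists.mpr ⟨(quadForm g (B.repr x))⁻¹ •
      ∑ i, B.repr x i • ((1 : K) ⊗ₜ[ℚ] (((T i : ℤ) : A) - c i)), ?_, ?_⟩
    · rw [mul_smul_comm, h1, smul_smul, inv_mul_cancel₀ hq, one_smul]
    · rw [smul_mul_assoc, h2, smul_smul, inv_mul_cancel₀ hq, one_smul]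

end IsNormForm

/-- A nontrivial zero can be divided by its coordinate of largest absolute value; it then has
integral entries, one of them equal to 1. Reducing it modulo p² gives integers on which the form is
divisible by p² although one of them is 1. -/
theorem anisotropic_of_forall_dvd {p : ℕ} [hp : Fact p.Prime] {g : Fin 4 → Fin 4 → ℤ}
    (h : ∀ a : Fin 4 → ℤ, (p : ℤ) * p ∣ quadForm g a → ∀ i, (p : ℤ) ∣ a i)
    (t : Fin 4 → ℚ_[p]) (ht : quadForm g t = 0) : t = 0 := by
  by_contra ht0
  obtain ⟨k, -, hk⟩ := Finset.exists_max_image Finset.univ (fun i => ‖t i‖) ⟨0, Finset.mem_univ 0⟩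
  have htk : t k ≠ 0 := fun h0 => ht0 (funext fun i => by
    have := hk i (Finset.mem_univ i)
    rw [h0, norm_zero] at this
    exact norm_le_zero_iff.mp this)
  let u : Fin 4 → ℤ_[p] := fun i => ⟨(t k)⁻¹ * t i, by
    rw [norm_mul, norm_inv, inv_mul_le_one₀ (norm_pos_iff.mpr htk)]
    exact hk i (Finset.mem_univ i)⟩
  have hu : quadForm g u = 0 := by
    refine Subtype.val_injective (?_ : PadicInt.Coe.ringHom (quadForm g u) = 0)
    rw [quadForm_map]
    have : quadForm g (fun i => (t k)⁻¹ * t i) = 0 := by rw [quadForm_smul, ht, mul_zero]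
    exact this
  have huk : u k = 1 := Subtype.ext (inv_mul_cancel₀ htk)
  have hp2 : 1 < p ^ 2 := Nat.one_lt_pow two_ne_zero hp.out.one_lt
  have : NeZero (p ^ 2) := ⟨by omega⟩
  have : Fact (1 < p ^ 2) := ⟨hp2⟩
  have hz := congrArg (PadicInt.toZModPow (p := p) 2) hu
  rw [quadForm_map, map_zero] at hz
  let a : Fin 4 → ℤ := fun i => ((PadicInt.toZModPow (p := p) 2 (u i)).val : ℤ)
  have ha : ((quadForm g a : ℤ) : ZMod (p ^ 2)) = 0 := by
    rw [← hz]
    refine (quadForm_map g (Int.castRingHom (ZMod (p ^ 2))) a).trans ?_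
    simp [a]
  have h1 := (ZMod.intCast_zmod_eq_zero_iff_dvd _ _).mp ha
  have h2 := h a (by push_cast at h1; rwa [sq] at h1) k
  simp only [a, huk, map_one, ZMod.val_one, Nat.cast_one] at h2
  have := Int.eq_one_of_dvd_one (by positivity) h2
  have := hp.out.one_lt
  omega

/-- By the Chevalley-Warning theorem, as the degree 2 is less than the number 4 of variables, p
divides the number of zeros, so the trivial one is not alone. -/
theorem exists_zero_quadForm_zmod (p : ℕ) [hp : Fact p.Prime] (g : Fin 4 → Fin 4 → ℤ) :
    ∃ t : Fin 4 → ZMod p, t ≠ 0 ∧ quadForm g t = 0 := by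
  classical
  let f : MvPolynomial (Fin 4) (ZMod p) := ∑ i, ∑ j,
    MvPolynomial.C (g i j : ZMod p) * MvPolynomial.X i * MvPolynomial.X j
  have hf : ∀ t, MvPolynomial.eval t f = quadForm g t := fun t => by simp [f, quadForm]
  have hdeg : f.totalDegree < Fintype.card (Fin 4) := by
    refine lt_of_le_of_lt (MvPolynomial.totalDegree_finsetSum_le (d := 2) fun i _ =>
      MvPolynomial.totalDegree_finsetSum_le fun j _ => ?_) (by decide)
    refine (MvPolynomial.totalDegree_mul _ _).trans ?_
    have h1 := MvPolynomial.totalDegree_mul (MvPolynomial.C (g i j : ZMod p))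
      (MvPolynomial.X i : MvPolynomial (Fin 4) (ZMod p))
    rw [MvPolynomial.totalDegree_C, MvPolynomial.totalDegree_X] at h1
    rw [MvPolynomial.totalDegree_X]
    omega
  have h := char_dvd_card_solutions p hdeg
  have h0 : MvPolynomial.eval (0 : Fin 4 → ZMod p) f = 0 := by rw [hf]; simp [quadForm]
  have hpos : 0 < Fintype.card {t // MvPolynomial.eval t f = 0} :=
    Fintype.card_pos_iff.mpr ⟨⟨0, h0⟩⟩
  have h1 := (hp.out.one_lt).trans_le (Nat.le_of_dvd hpos h)
  obtain ⟨⟨t, ht⟩, hne⟩ := Fintype.exists_ne_of_one_lt_card h1 ⟨0, h0⟩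
  exact ⟨t, fun h2 => hne (Subtype.ext h2), by rw [← hf, ht]⟩

/-- Hensel's lemma for the polynomial T ↦ q(a + Tb) at 0: its derivative there is the polar form of
a and b, a p-adic unit. The root is divisible by p, so coordinate k remains a unit and the zero is
not trivial. -/
theorem exists_zero_padic {p : ℕ} [hp : Fact p.Prime] {g : Fin 4 → Fin 4 → ℤ}
    {a b : Fin 4 → ℤ} (ha : (p : ℤ) ∣ quadForm g a) {k : Fin 4} (hk : ¬ (p : ℤ) ∣ a k)
    (hab : ¬ (p : ℤ) ∣ quadForm g (fun i => a i + b i) - quadForm g a - quadForm g b) :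
    ∃ t : Fin 4 → ℚ_[p], t ≠ 0 ∧ quadForm g t = 0 := by
  set B := quadForm g (fun i => a i + b i) - quadForm g a - quadForm g b with hB
  let F : Polynomial ℤ := Polynomial.C (quadForm g a) + Polynomial.C B * Polynomial.X
    + Polynomial.C (quadForm g b) * Polynomial.X ^ 2
  have hF0 : F.aeval (0 : ℤ_[p]) = (quadForm g a : ℤ) := by simp [F]
  have hF1 : F.derivative.aeval (0 : ℤ_[p]) = (B : ℤ) := by simp [F]
  have hnB : ‖((B : ℤ) : ℤ_[p])‖ = 1 := by
    have := mt (PadicInt.norm_int_lt_one_iff_dvd B).mp hab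
    exact le_antisymm (PadicInt.norm_le_one _) (not_lt.mp this)
  obtain ⟨z, hz, hz1, -⟩ := hensels_lemma (p := p) (F := F) (a := (0 : ℤ_[p])) (by
    rw [hF0, hF1, hnB, one_pow]
    exact (PadicInt.norm_int_lt_one_iff_dvd _).mpr ha)
  rw [hF1, hnB, sub_zero] at hz1
  have hq : quadForm g (fun i => (a i : ℤ_[p]) + z * b i) = 0 := by
    rw [quadForm_add_smul, ← hz]
    have e1 : quadForm g (fun i => (a i : ℤ_[p])) = (quadForm g a : ℤ) :=
      (quadForm_map g (Int.castRingHom ℤ_[p]) a).symm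
    have e2 : quadForm g (fun i => (b i : ℤ_[p])) = (quadForm g b : ℤ) :=
      (quadForm_map g (Int.castRingHom ℤ_[p]) b).symm
    have e3 : quadForm g (fun i => (a i : ℤ_[p]) + b i) = (quadForm g (fun i => a i + b i) : ℤ) := by
      rw [← eq_intCast (Int.castRingHom ℤ_[p]), quadForm_map]; simp
    rw [e1, e2, e3]
    simp [F, hB]
    ring
  refine ⟨fun i => (((a i : ℤ_[p]) + z * b i : ℤ_[p]) : ℚ_[p]), fun h0 => ?_, ?_⟩
  · have h1 : (a k : ℤ_[p]) + z * b k = 0 := Subtype.ext (congrFun h0 k)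
    have h2 : (a k : ℤ_[p]) = - (z * b k) := by linear_combination h1
    refine hk ((PadicInt.norm_int_lt_one_iff_dvd (p := p) _).mp ?_)
    rw [h2, norm_neg, norm_mul]
    exact lt_of_le_of_lt (mul_le_of_le_one_right (norm_nonneg _) (PadicInt.norm_le_one _)) hz1
  · have := quadForm_map g (PadicInt.Coe.ringHom (p := p)) (fun i => (a i : ℤ_[p]) + z * b i)
    rw [hq, map_zero] at this
    exact this.symm

section

variable {A : Subalgebra ℚ ℍ[ℝ]} {R : Subring ℍ[ℝ]} {e : Fin 4 → ℍ[ℝ]}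
  {c : Module.Basis (Fin 4) ℚ A}

/-- If p does not divide the discriminant, a Chevalley-Warning zero modulo p is not in the radical,
so some b pairs with it to a unit and the zero lifts to ℚ_p. If p divides it, a norm divisible by p²
forces divisibility of the element by p, which excludes p-adic zeros. -/
theorem isRamifiedAt_iff (h : HasIntegralBasis R e) (hM : IsNormMaximal R)
    (hc : ∀ i, (c i : ℍ[ℝ]) = e i) (p : Nat.Primes) :
    IsRamifiedAt A p ↔ ((p : ℕ) : ℤ) ∣ h.disc := by
  have hp : Fact (p : ℕ).Prime := ⟨p.2⟩
  obtain ⟨g, hg⟩ := h.exists_isNormForm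
  have hiff : IsRamifiedAt A p ↔ ∀ t : Fin 4 → ℚ_[(p : ℕ)], quadForm g t = 0 → t = 0 :=
    hg.forall_isUnit_iff h hc
  rw [hiff]
  constructor
  · intro han
    by_contra hd
    obtain ⟨t, ht0, ht⟩ := exists_zero_quadForm_zmod p g
    obtain ⟨k, hk⟩ := Function.ne_iff.mp ht0
    let a : Fin 4 → ℤ := fun i => ((t i).val : ℤ)
    have hcast : ∀ i, ((a i : ℤ) : ZMod p) = t i := fun i => by simp [a]
    have ha : ((p : ℕ) : ℤ) ∣ quadForm g a := by
      rw [← ZMod.intCast_zmod_eq_zero_iff_dvd, ← ht]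
      refine (quadForm_map g (Int.castRingHom (ZMod p)) a).trans ?_
      simp [a]
    have hak : ¬ ((p : ℕ) : ℤ) ∣ a k := by
      rw [← ZMod.intCast_zmod_eq_zero_iff_dvd, hcast]
      exact hk
    have hx : ∑ i, (a i : ℝ) • e i ∈ R := (h.mem _).mpr ⟨a, rfl⟩
    have hnr : ¬ h.radical p (∑ i, (a i : ℝ) • e i) := fun hr =>
      hak ((h.smul_sum_mem_iff a).mp (h.mem_multiples_of_radical_of_not_dvd p.2 hd hr) k)
    have : ∃ y ∈ R, tr ((∑ i, (a i : ℝ) • e i) * y) ∉ mult ((p : ℕ) : ℤ) := by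
      by_contra! hcon
      exact hnr ⟨hx, by rw [hg.normSq_sum_int]; exact intCast_mem_mult.mpr ha, hcon⟩
    obtain ⟨y, hy, hty⟩ := this
    obtain ⟨b, hb⟩ := (h.mem _).mp (h.star_mem hy)
    obtain ⟨s, hs0, hs⟩ := exists_zero_padic (b := b) ha hak (by
      rw [← intCast_mem_mult]
      push_cast
      rw [← hg.normSq_sum_int, ← hg.normSq_sum_int, ← hg.normSq_sum_int]
      convert hty using 1
      have h1 : ∑ i, ((a i + b i : ℤ) : ℝ) • e i =
          ∑ i, (a i : ℝ) • e i + ∑ i, (b i : ℝ) • e i := by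
        rw [← Finset.sum_add_distrib]
        exact Finset.sum_congr rfl fun i _ => by push_cast; rw [add_smul]
      rw [h1, normSq_add_eq, ← hb, star_star]
      ring_nf)
    exact hs0 (han s hs)
  · intro hd t ht
    refine anisotropic_of_forall_dvd (g := g) (fun a ha => ?_) t ht
    have hx : ∑ i, (a i : ℝ) • e i ∈ R := (h.mem _).mpr ⟨a, rfl⟩
    refine (h.smul_sum_mem_iff a).mp (h.mem_multiples_of_normSq_mem hM p.2 hd hx ?_)
    rw [hg.normSq_sum_int]
    exact intCast_mem_mult.mpr ha

theorem reducedDiscriminant_eq (h : HasIntegralBasis R e) (hM : IsNormMaximal R)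
    (hc : ∀ i, (c i : ℍ[ℝ]) = e i) : reducedDiscriminant A = h.disc.natAbs := by
  have hsq : Squarefree h.disc.natAbs := by
    rw [Nat.squarefree_iff_prime_squarefree]
    intro p hp hd
    exact h.not_sq_dvd_disc hM hp (by
      have := Int.natCast_dvd.mpr hd
      push_cast at this
      exact this)
  have hd0 : h.disc.natAbs ≠ 0 := Int.natAbs_ne_zero.mpr h.disc_ne_zero
  rw [← Nat.prod_primeFactors_of_squarefree hsq, reducedDiscriminant]
  simp only [isRamifiedAt_iff h hM hc, Int.natCast_dvd]
  have h1 : (∏ᶠ (p : Nat.Primes) (_ : (p : ℕ) ∣ h.disc.natAbs), (p : ℕ)) =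
      ∏ᶠ (n : ℕ) (_ : n ∈ (h.disc.natAbs.primeFactors : Set ℕ)), n := by
    have := finprod_mem_range' (M := ℕ) (f := fun n : ℕ => ∏ᶠ (_ : n ∣ h.disc.natAbs), n)
      (g := fun p : Nat.Primes => (p : ℕ)) (by
        exact (Subtype.val_injective).injOn)
    rw [← this]
    refine finprod_congr fun n => ?_
    by_cases hn : n ∣ h.disc.natAbs <;> by_cases hp : n.Prime <;>
      simp [hn, hp, hd0, Nat.Primes]
  rw [h1, finprod_mem_coe_finset]

end

/-! ### Elements of small norm -/

theorem exists_min_of_natCast {α : Type*} {S : Set α} (hS : S.Nonempty) (F : α → ℝ)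
    (hF : ∀ x ∈ S, ∃ k : ℤ, F x = k) (h0 : ∀ x ∈ S, 0 ≤ F x) : ∃ x ∈ S, ∀ y ∈ S, F x ≤ F y := by
  have hN : ∀ x ∈ S, F x = (⌊F x⌋₊ : ℝ) := fun x hx => by
    obtain ⟨k, hk⟩ := hF x hx
    have hk0 : (0 : ℝ) ≤ k := hk ▸ h0 x hx
    lift k to ℕ using by exact_mod_cast hk0
    rw [hk]; simp
  obtain ⟨x, hx, hmin⟩ := (InvImage.wf (fun x => ⌊F x⌋₊) wellFounded_lt).has_min S hS
  refine ⟨x, hx, fun y hy => ?_⟩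
  rw [hN x hx, hN y hy]
  exact_mod_cast not_lt.mp (hmin y hy)

/-- One step of Gauss reduction: for k the integer nearest to -c/G the cross coefficient becomes at
most G/2 in absolute value, while GH - c² does not change. -/
theorem three_mul_sq_le_of_forall_int {G c H : ℝ} (hG : 0 < G)
    (h : ∀ k : ℤ, G ≤ H + 2 * k * c + k ^ 2 * G) : 3 * G ^ 2 ≤ 4 * (G * H - c ^ 2) := by
  have hk := h (round (-c / G))
  set k : ℝ := ((round (-c / G) : ℤ) : ℝ) with hkdef
  have h1 : |(-c / G) - k| ≤ 1 / 2 := abs_sub_round _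
  have h2 : (c + k * G) ^ 2 ≤ G ^ 2 / 4 := by
    have h3 : c + k * G = -((-c / G - k) * G) := by field_simp; ring
    have h4 : (-c / G - k) ^ 2 ≤ 1 / 4 := by
      have := sq_le_sq' (abs_le.mp h1).1 (abs_le.mp h1).2
      linarith
    rw [h3, neg_sq, mul_pow]
    nlinarith [sq_nonneg G]
  nlinarith

/-- Four times the inner product of the imaginary parts. -/
def imInner (x y : ℍ[ℝ]) : ℝ := 4 * (x.imI * y.imI + x.imJ * y.imJ + x.imK * y.imK)

theorem imInner_self (x : ℍ[ℝ]) : imInner x x = 4 * normSq x - tr x ^ 2 := by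
  rw [imInner, Quaternion.normSq_def', tr]; ring

theorem imInner_self_nonneg (x : ℍ[ℝ]) : 0 ≤ imInner x x := by
  rw [imInner]; nlinarith [sq_nonneg x.imI, sq_nonneg x.imJ, sq_nonneg x.imK]

theorem four_mul_normSq_commutator (x y : ℍ[ℝ]) :
    4 * normSq (x * y - y * x) = imInner x x * imInner y y - imInner x y ^ 2 := by
  simp [imInner, Quaternion.normSq_def']; ring

/-- Jacobi's identity for minors of the Gram matrix: the determinant of the 2×2 minors bordering x
is `imInner x x` times the full Gram determinant, which is 4 times the square of the trilinear form.
-/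
theorem imInner_gram (x y z : ℍ[ℝ]) :
    (imInner x x * imInner y y - imInner x y ^ 2) * (imInner x x * imInner z z - imInner x z ^ 2)
      - (imInner x x * imInner y z - imInner x y * imInner x z) ^ 2 =
      4 * imInner x x * tripleTrace x y z ^ 2 := by
  simp only [tripleTrace_eq, imInner]; ring

theorem imInner_add_smul (x y : ℍ[ℝ]) (k : ℝ) :
    imInner (y + k • x) (y + k • x) = imInner y y + 2 * k * imInner x y + k ^ 2 * imInner x x := by
  simp [imInner]; ring

namespace HasIntegralBasis

variable {R : Subring ℍ[ℝ]} {e : Fin 4 → ℍ[ℝ]} {x y z : ℍ[ℝ]}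

theorem exists_imInner_self (h : HasIntegralBasis R e) (hx : x ∈ R) :
    ∃ k : ℤ, imInner x x = k := by
  obtain ⟨n, hn⟩ := h.exists_normSq_eq hx
  obtain ⟨t, ht⟩ := h.exists_tr_eq hx
  exact ⟨4 * n - t ^ 2, by rw [imInner_self, hn, ht]; push_cast; ring⟩

/-- Hermite's bound for the ternary form `4 n - tr²`. -/
theorem exists_imInner_le (h : HasIntegralBasis R e) :
    ∃ x ∈ R, 0 < imInner x x ∧ 27 * imInner x x ^ 3 ≤ 256 * (h.disc : ℝ) ^ 2 := by
  have hd : (h.disc : ℝ) ≠ 0 := by exact_mod_cast h.disc_ne_zero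
  set T : ℍ[ℝ] → ℍ[ℝ] → ℍ[ℝ] → Prop := fun x y z =>
    x ∈ R ∧ y ∈ R ∧ z ∈ R ∧ tripleTrace x y z ^ 2 = (h.disc : ℝ) ^ 2 with hT
  -- Hermite reduction over triples of determinant ±disc: x has the least value of the form, then y
  -- the least commutator norm with x. Replacing y by y + kx or z by z + ky keeps the determinant up
  -- to sign.
  obtain ⟨x, ⟨y₀, z₀, hx⟩, hxmin⟩ := exists_min_of_natCast (S := {x | ∃ y z, T x y z})
    ⟨e 1, e 2, e 3, h.basis_mem 1, h.basis_mem 2, h.basis_mem 3, by rw [h.tripleTrace_basis]⟩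
    (fun x => imInner x x) (fun x ⟨y, z, hx, _⟩ => h.exists_imInner_self hx)
    (fun x _ => imInner_self_nonneg x)
  obtain ⟨y, ⟨z, hy⟩, hymin⟩ := exists_min_of_natCast (S := {y | ∃ z, T x y z})
    ⟨y₀, z₀, hx⟩ (fun y => normSq (x * y - y * x))
    (fun y ⟨z, hx, hy, _⟩ => h.exists_normSq_eq (R.sub_mem (R.mul_mem hx hy) (R.mul_mem hy hx)))
    (fun y _ => Quaternion.normSq_nonneg)
  obtain ⟨hxR, hyR, hzR, hdisc⟩ := hy
  have hgram := imInner_gram x y z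
  have hpos : 0 < imInner x x ∧ 0 < imInner x x * imInner y y - imInner x y ^ 2 := by
    have h1 := imInner_self_nonneg x
    have h2 : 0 < 4 * imInner x x * tripleTrace x y z ^ 2 ∨ imInner x x = 0 := by
      rcases h1.eq_or_lt with h1 | h1
      · exact Or.inr h1.symm
      · left; rw [hdisc]; positivity
    have hx0 : imInner x x ≠ 0 := by
      intro h0
      have h3 : x.imI = 0 ∧ x.imJ = 0 ∧ x.imK = 0 := by
        rw [imInner] at h0
        refine ⟨?_, ?_, ?_⟩ <;>
          nlinarith [sq_nonneg x.imI, sq_nonneg x.imJ, sq_nonneg x.imK]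
      have h4 : tripleTrace x y z = 0 := by
        rw [tripleTrace_eq, h3.1, h3.2.1, h3.2.2]; ring
      rw [h4] at hdisc
      exact hd (by simpa using hdisc.symm)
    have h2 := h2.resolve_right hx0
    refine ⟨h1.lt_of_ne' hx0, ?_⟩
    have h5 : 0 ≤ imInner x x * imInner y y - imInner x y ^ 2 := by
      rw [← four_mul_normSq_commutator]
      exact mul_nonneg (by norm_num) Quaternion.normSq_nonneg
    refine h5.lt_of_ne' fun h0 => ?_
    rw [h0] at hgram
    nlinarith [sq_nonneg (imInner x x * imInner y z - imInner x y * imInner x z)]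
  refine ⟨x, hxR, hpos.1, ?_⟩
  have hk1 := three_mul_sq_le_of_forall_int (G := imInner x x) (c := imInner x y)
    (H := imInner y y) hpos.1 fun k => by
      rw [← imInner_add_smul]
      refine hxmin _ ⟨x, z, R.add_mem hyR (smul_mem_of_mem k hxR), hxR, hzR, ?_⟩
      rw [← hdisc]
      simp only [tripleTrace_eq, Quaternion.imI_add, Quaternion.imJ_add, Quaternion.imK_add,
        Quaternion.imI_smul, Quaternion.imJ_smul, Quaternion.imK_smul, smul_eq_mul]
      ring
  have hk2 := three_mul_sq_le_of_forall_int
    (G := imInner x x * imInner y y - imInner x y ^ 2)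
    (c := imInner x x * imInner y z - imInner x y * imInner x z)
    (H := imInner x x * imInner z z - imInner x z ^ 2) hpos.2 fun k => by
      have h1 := hymin (z + (k : ℝ) • y) ⟨y, hxR, R.add_mem hzR (smul_mem_of_mem k hyR), hyR, by
        rw [← hdisc]
        simp only [tripleTrace_eq, Quaternion.imI_add, Quaternion.imJ_add, Quaternion.imK_add,
          Quaternion.imI_smul, Quaternion.imJ_smul, Quaternion.imK_smul, smul_eq_mul]
        ring⟩
      have h2 := four_mul_normSq_commutator x y
      have h3 := four_mul_normSq_commutator x (z + (k : ℝ) • y)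
      have h4 : imInner x (z + (k : ℝ) • y) = imInner x z + k * imInner x y := by
        simp [imInner]; ring
      rw [imInner_add_smul, h4] at h3
      linarith
  rw [hgram, hdisc] at hk2
  have h6 := hpos.1
  set a := imInner x x
  set G := a * imInner y y - imInner x y ^ 2
  -- The two reduction steps give 3a² ≤ 4G and 3G² ≤ 16 a disc². Eliminating G yields the bound.
  have h7 : (3 * a ^ 2) ^ 2 ≤ (4 * G) ^ 2 := by
    apply pow_le_pow_left₀ (by positivity); linarith
  have h8 : a * (27 * a ^ 3) ≤ a * (256 * (h.disc : ℝ) ^ 2) := by nlinarith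
  exact le_of_mul_le_mul_left h8 h6

/-- Hermite's bound gives 27a³ ≤ 256·25 for a = 4n - t², so a ≤ 6. Being 0 or 3 modulo 4, a is 3 or
4, and subtracting an integer from x brings its trace to -1 or 0 and its norm to 1. -/
theorem exists_unit_of_disc_le (h : HasIntegralBasis R e) (hd : h.disc.natAbs ≤ 5) :
    ∃ u ∈ R, normSq u = 1 ∧ (tr u = 0 ∨ tr u = -1) := by
  obtain ⟨x, hx, hpos, hle⟩ := h.exists_imInner_le
  obtain ⟨n, hn⟩ := h.exists_normSq_eq hx
  obtain ⟨t, ht⟩ := h.exists_tr_eq hx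
  have hI : imInner x x = ((4 * n - t ^ 2 : ℤ) : ℝ) := by
    rw [imInner_self, hn, ht]; push_cast; ring
  have hd2 : h.disc ^ 2 ≤ 25 := by
    rw [← Int.natAbs_sq]
    have : (h.disc.natAbs : ℤ) ≤ 5 := by exact_mod_cast hd
    nlinarith [Int.natCast_nonneg h.disc.natAbs]
  rw [hI] at hpos hle
  have hpos' : 0 < 4 * n - t ^ 2 := by exact_mod_cast hpos
  have hle' : 27 * (4 * n - t ^ 2) ^ 3 ≤ 256 * h.disc ^ 2 := by exact_mod_cast hle
  have hlt : 4 * n - t ^ 2 < 7 := by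
    by_contra! hcon
    have : 7 ^ 3 ≤ (4 * n - t ^ 2) ^ 3 := pow_le_pow_left₀ (by norm_num) hcon 3
    linarith
  rcases Int.even_or_odd' t with ⟨s, rfl | rfl⟩
  · have h1 : n - s ^ 2 = 1 := by
      have : 4 * n - (2 * s) ^ 2 = 4 * (n - s ^ 2) := by ring
      omega
    have hs : x - ((s : ℝ) : ℍ[ℝ]) ∈ R := R.sub_mem hx (by
      rw [Quaternion.coe_intCast]; exact intCast_mem R s)
    have ht' : tr (x - ((s : ℝ) : ℍ[ℝ])) = 0 := by
      rw [tr_sub, ht]; simp [tr]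
    refine ⟨_, hs, ?_, Or.inl ht'⟩
    have h2 := imInner_self (x - ((s : ℝ) : ℍ[ℝ]))
    have h3 : imInner (x - ((s : ℝ) : ℍ[ℝ])) (x - ((s : ℝ) : ℍ[ℝ])) = imInner x x := by
      simp [imInner]
    rw [h3, hI, ht'] at h2
    have h4 : 4 * n - (2 * s) ^ 2 = 4 := by linear_combination 4 * h1
    rw [h4] at h2
    push_cast at h2 ⊢
    linarith
  · have h1 : n - s ^ 2 - s = 1 := by
      have : 4 * n - (2 * s + 1) ^ 2 = 4 * (n - s ^ 2 - s) - 1 := by ring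
      omega
    have hs : x - (((s + 1 : ℤ) : ℝ) : ℍ[ℝ]) ∈ R := R.sub_mem hx (by
      rw [Quaternion.coe_intCast]; exact intCast_mem R _)
    have ht' : tr (x - (((s + 1 : ℤ) : ℝ) : ℍ[ℝ])) = -1 := by
      rw [tr_sub, ht]; simp [tr]; ring
    refine ⟨_, hs, ?_, Or.inr ht'⟩
    have h2 := imInner_self (x - (((s + 1 : ℤ) : ℝ) : ℍ[ℝ]))
    have h3 : imInner (x - (((s + 1 : ℤ) : ℝ) : ℍ[ℝ])) (x - (((s + 1 : ℤ) : ℝ) : ℍ[ℝ])) =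
        imInner x x := by
      simp [imInner]
    rw [h3, hI, ht'] at h2
    have h4 : 4 * n - (2 * s + 1) ^ 2 = 3 := by linear_combination 4 * h1
    rw [h4] at h2
    push_cast at h2 ⊢
    linarith

end HasIntegralBasis

/-! ### Orders containing a root of unity -/

/-- `u` is a primitive fourth or third root of unity. -/
def IsRootUnit (u : ℍ[ℝ]) : Prop := normSq u = 1 ∧ (tr u = 0 ∨ tr u = -1)

theorem IsRootUnit.imInner_pos {u : ℍ[ℝ]} (hu : IsRootUnit u) : 0 < imInner u u := by
  rw [imInner_self, hu.1]
  rcases hu.2 with h | h <;> rw [h] <;> norm_num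

theorem exists_eq_add_smul_of_commute {u s : ℍ[ℝ]} (hu : 0 < imInner u u) (h : u * s = s * u) :
    ∃ a b : ℝ, s = (a : ℍ[ℝ]) + b • u := by
  have h1 := congrArg (fun q : ℍ[ℝ] => q.imI) h
  have h2 := congrArg (fun q : ℍ[ℝ] => q.imJ) h
  have h3 := congrArg (fun q : ℍ[ℝ] => q.imK) h
  simp at h1 h2 h3
  obtain ⟨r, hr⟩ : ∃ r, r * imInner u u = imInner s u :=
    ⟨imInner s u / imInner u u, div_mul_cancel₀ _ hu.ne'⟩
  refine ⟨s.re - r * u.re, r, ?_⟩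
  have hI : s.imI = r * u.imI := by
    apply mul_right_cancel₀ hu.ne'
    rw [mul_right_comm, hr]
    simp only [imInner]
    linear_combination (2 * u.imK) * h2 - (2 * u.imJ) * h3
  have hJ : s.imJ = r * u.imJ := by
    apply mul_right_cancel₀ hu.ne'
    rw [mul_right_comm, hr]
    simp only [imInner]
    linear_combination (2 * u.imI) * h3 - (2 * u.imK) * h1
  have hK : s.imK = r * u.imK := by
    apply mul_right_cancel₀ hu.ne'
    rw [mul_right_comm, hr]
    simp only [imInner]
    linear_combination (2 * u.imJ) * h1 - (2 * u.imI) * h2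
  ext <;> simp [hI, hJ, hK]

theorem IsRootUnit.normSq_add_smul {u : ℍ[ℝ]} (hu : IsRootUnit u) (a b : ℝ) :
    normSq ((a : ℍ[ℝ]) + b • u) = a ^ 2 + tr u * a * b + b ^ 2 := by
  have h := hu.1
  rw [Quaternion.normSq_def'] at h
  simp [Quaternion.normSq_def', tr]
  linear_combination b ^ 2 * h

/-- Commutators with u intertwine u and ū, so the quotient of two of them commutes with u. -/
theorem mul_commutator (u x : ℍ[ℝ]) : u * (u * x - x * u) = (u * x - x * u) * star u := by
  have h : u * u = ((tr u : ℝ) : ℍ[ℝ]) * u - ((normSq u : ℝ) : ℍ[ℝ]) := by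
    rw [← Quaternion.star_mul_self, star_eq_tr_sub, sub_mul]; simp
  rw [star_eq_tr_sub, mul_sub, mul_sub, sub_mul _ _ u, ← mul_assoc, ← mul_assoc, mul_assoc x u u,
    h, ← Quaternion.coe_commutes]
  simp only [sub_mul, mul_sub, ← mul_assoc, ← Quaternion.coe_commutes]
  abel

/-- `j` generates the order over `ℤ[u]`. -/
structure IsGenerator (R : Subring ℍ[ℝ]) (u j : ℍ[ℝ]) : Prop where
  mem : j ∈ R
  ne : u * j - j * u ≠ 0
  min : ∀ x ∈ R, u * x - x * u ≠ 0 → normSq (u * j - j * u) ≤ normSq (u * x - x * u)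

namespace HasIntegralBasis

variable {R : Subring ℍ[ℝ]} {e : Fin 4 → ℍ[ℝ]} {u j x : ℍ[ℝ]}

theorem exists_isGenerator (h : HasIntegralBasis R e) (hu : u ∈ R) (hu' : IsRootUnit u) :
    ∃ j, IsGenerator R u j := by
  have hne : {x | x ∈ R ∧ u * x - x * u ≠ 0}.Nonempty := by
    by_contra hcon
    have hc : ∀ x ∈ R, u * x - x * u = 0 := fun x hx => by
      by_contra h0
      exact hcon ⟨x, hx, h0⟩
    obtain ⟨a, ha⟩ := (h.mem _).mp hu
    have hz : ∀ i k, tripleTrace u (e i) (e k) = 0 := fun i k => by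
      rw [tripleTrace, hc _ (h.basis_mem i), zero_mul]; simp [tr]
    have hd : (h.disc : ℝ) ≠ 0 := by exact_mod_cast h.disc_ne_zero
    have hsingle : ∀ i, e i = ∑ j, ((Pi.single i 1 : Fin 4 → ℝ) j) • e j := fun i => by
      simp [Pi.single_apply]
    have h1 := hz 2 3
    have h2 := hz 3 1
    have h3 := hz 1 2
    rw [ha, hsingle 2, hsingle 3, tripleTrace_sum h.one, h.tripleTrace_basis] at h1
    rw [ha, hsingle 3, hsingle 1, tripleTrace_sum h.one, h.tripleTrace_basis] at h2
    rw [ha, hsingle 1, hsingle 2, tripleTrace_sum h.one, h.tripleTrace_basis] at h3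
    simp [hd] at h1 h2 h3
    have h4 : u = ((a 0 : ℝ) : ℍ[ℝ]) := by
      rw [ha, Fin.sum_univ_four, h.one, h1, h2, h3]
      ext <;> simp
    have := hu'.imInner_pos
    rw [h4] at this
    simp [imInner] at this
  obtain ⟨j, ⟨hj, hj0⟩, hmin⟩ := exists_min_of_natCast hne (fun x => normSq (u * x - x * u))
    (fun x hx => h.exists_normSq_eq (R.sub_mem (R.mul_mem hu hx.1) (R.mul_mem hx.1 hu)))
    (fun x _ => Quaternion.normSq_nonneg)
  exact ⟨j, hj, hj0, fun x hx hx0 => hmin x ⟨hx, hx0⟩⟩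

/-- The ring ℤ[u] is integrally closed: integrality of the traces of x and xū bounds the
denominators by 2 or 3, according to tr(u), and integrality of the norm removes them. -/
theorem exists_int_of_commute (h : HasIntegralBasis R e) (hu : u ∈ R) (hu' : IsRootUnit u)
    (hx : x ∈ R) (hc : u * x - x * u = 0) :
    ∃ a b : ℤ, x = ((a : ℝ) : ℍ[ℝ]) + (b : ℝ) • u := by
  obtain ⟨a, b, rfl⟩ := exists_eq_add_smul_of_commute hu'.imInner_pos (sub_eq_zero.mp hc)
  obtain ⟨t, ht⟩ := h.exists_tr_eq hx
  obtain ⟨s, hs⟩ := h.exists_tr_eq (R.mul_mem hx (h.star_mem hu))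
  obtain ⟨n, hn⟩ := h.exists_normSq_eq hx
  rw [hu'.normSq_add_smul] at hn
  have ht2 : 2 * a + tr u * b = t := by rw [← ht]; simp [tr]; ring
  have hs2 : tr u * a + 2 * b = s := by
    rw [← hs]
    have h1 := hu'.1
    rw [Quaternion.normSq_def'] at h1
    simp [tr]
    linear_combination (-2 * b) * h1
  rcases hu'.2 with h0 | h0 <;> rw [h0] at hn ht2 hs2
  · have h1 : t ^ 2 + s ^ 2 = 4 * n := by
      have : ((t : ℝ)) ^ 2 + s ^ 2 = 4 * n := by rw [← ht2, ← hs2, ← hn]; ring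
      exact_mod_cast this
    have ht3 : Even t := by
      by_contra hodd
      obtain ⟨k, rfl⟩ := Int.not_even_iff_odd.mp hodd
      rcases Int.even_or_odd' s with ⟨l, rfl | rfl⟩ <;> ring_nf at h1 <;> omega
    have hs3 : Even s := by
      by_contra hodd
      obtain ⟨k, rfl⟩ := Int.not_even_iff_odd.mp hodd
      obtain ⟨l, rfl⟩ := even_iff_two_dvd.mp ht3
      ring_nf at h1; omega
    obtain ⟨k, rfl⟩ := even_iff_two_dvd.mp ht3
    obtain ⟨l, rfl⟩ := even_iff_two_dvd.mp hs3
    refine ⟨k, l, ?_⟩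
    push_cast at ht2 hs2
    rw [show a = k by linarith, show b = l by linarith]
  · have ha : 3 * a = 2 * t + s := by linarith
    have hb : 3 * b = t + 2 * s := by linarith
    have h1 : t ^ 2 + t * s + s ^ 2 = 3 * n := by
      have : ((t : ℝ)) ^ 2 + t * s + s ^ 2 = 3 * n := by rw [← ht2, ← hs2, ← hn]; ring
      exact_mod_cast this
    have h2 : (3 : ℤ) ∣ t - s := by
      have h3 : (3 : ℤ) ∣ (t - s) ^ 2 := ⟨n - t * s, by linarith⟩
      exact Int.prime_three.dvd_of_dvd_pow h3
    obtain ⟨k, hk⟩ := h2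
    have hk' : (t : ℝ) = s + 3 * k := by exact_mod_cast (by linarith : t = s + 3 * k)
    refine ⟨s + 2 * k, s + k, ?_⟩
    rw [show a = ((s + 2 * k : ℤ) : ℝ) by push_cast; linarith,
      show b = ((s + k : ℤ) : ℝ) by push_cast; linarith]

/-- The map x ↦ [u,x] divided by [u,j] takes values in ℝ + ℝu. Rounding both coordinates leaves an
error of norm at most 3/4, so minimality of j forces the corrected element to commute with u, and it
then lies in ℤ[u]. In effect ℤ[u] is Euclidean and R is ℤ[u] ⊕ ℤ[u]j. -/
theorem of_isGenerator (h : HasIntegralBasis R e) (hu : u ∈ R) (hu' : IsRootUnit u)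
    (hj : IsGenerator R u j) : HasIntegralBasis R ![1, u, j, u * j] := by
  have hcomm : ∀ (a b : ℝ) (y : ℍ[ℝ]), u * (((a : ℍ[ℝ]) + b • u) * y) -
      (((a : ℍ[ℝ]) + b • u) * y) * u = ((a : ℍ[ℝ]) + b • u) * (u * y - y * u) := fun a b y => by
    rw [mul_sub, ← mul_assoc, ← mul_assoc, ← mul_assoc, mul_add, add_mul _ _ u,
      Quaternion.coe_commutes, mul_smul_comm, smul_mul_assoc]
  refine ⟨rfl, ?_, fun x => ⟨fun hx => ?_, ?_⟩⟩
  · rw [Fintype.linearIndependent_iff]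
    intro g hg
    simp only [Fin.sum_univ_four] at hg
    have hg' : ((g 0 : ℍ[ℝ]) + g 1 • u) + ((g 2 : ℍ[ℝ]) + g 3 • u) * j = 0 := by
      rw [← hg]
      simp only [Matrix.cons_val, add_mul, smul_mul_assoc, Quaternion.coe_mul_eq_smul]
      rw [show (g 0 : ℍ[ℝ]) = g 0 • (1 : ℍ[ℝ]) by rw [← Quaternion.coe_mul_eq_smul, mul_one]]
      abel
    have hzero : ∀ a b : ℝ, (a : ℍ[ℝ]) + b • u = 0 → a = 0 ∧ b = 0 := fun a b hab => by
      have h1 : imInner ((a : ℍ[ℝ]) + b • u) ((a : ℍ[ℝ]) + b • u) = b ^ 2 * imInner u u := by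
        simp [imInner]; ring
      rw [hab] at h1
      have hb : b = 0 := by
        have h2 : b ^ 2 * imInner u u = 0 := by rw [← h1]; simp [imInner]
        simpa [hu'.imInner_pos.ne'] using h2
      rw [hb] at hab
      refine ⟨?_, hb⟩
      have h3 := congrArg (fun q : ℍ[ℝ] => q.re) hab
      simpa using h3
    have h1 : ((g 2 : ℍ[ℝ]) + g 3 • u) * (u * j - j * u) = 0 := by
      rw [← hcomm]
      have h2 : ((g 2 : ℍ[ℝ]) + g 3 • u) * j = - ((g 0 : ℍ[ℝ]) + g 1 • u) :=
        eq_neg_of_add_eq_zero_right hg'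
      rw [h2, mul_neg, neg_mul, mul_add, add_mul, Quaternion.coe_commutes, mul_smul_comm,
        smul_mul_assoc]
      abel
    obtain ⟨h2, h3⟩ := hzero _ _ ((mul_eq_zero.mp h1).resolve_right hj.ne)
    rw [h2, h3] at hg'
    obtain ⟨h0, h1'⟩ := hzero (g 0) (g 1) (by simpa using hg')
    intro i
    fin_cases i <;> assumption
  · obtain ⟨s, hs⟩ : ∃ s, s = (u * x - x * u) * (u * j - j * u)⁻¹ := ⟨_, rfl⟩
    have hsw : s * (u * j - j * u) = u * x - x * u := by
      rw [hs, mul_assoc, inv_mul_cancel₀ hj.ne, mul_one]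
    have hsu : u * s = s * u := by
      have h1 := mul_commutator u x
      have h2 := mul_commutator u j
      rw [← hsw, ← mul_assoc, mul_assoc s, ← h2, ← mul_assoc s] at h1
      exact mul_right_cancel₀ hj.ne h1
    obtain ⟨s₀, s₁, hs'⟩ := exists_eq_add_smul_of_commute hu'.imInner_pos hsu
    set t₀ := round s₀
    set t₁ := round s₁
    have hr0 := abs_le.mp (abs_sub_round s₀)
    have hr1 := abs_le.mp (abs_sub_round s₁)
    set y := x - (((t₀ : ℝ) : ℍ[ℝ]) + (t₁ : ℝ) • u) * j with hy
    have hyR : y ∈ R := R.sub_mem hx (R.mul_mem (R.add_mem (by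
      rw [Quaternion.coe_intCast]; exact intCast_mem R _) (smul_mem_of_mem _ hu)) hj.mem)
    have hyc : u * y - y * u =
        (((s₀ - t₀ : ℝ) : ℍ[ℝ]) + (s₁ - t₁) • u) * (u * j - j * u) := by
      have h1 : u * y - y * u = (u * x - x * u) -
          (((t₀ : ℝ) : ℍ[ℝ]) + (t₁ : ℝ) • u) * (u * j - j * u) := by
        rw [← hcomm, hy, mul_sub, sub_mul]; abel
      rw [h1, ← hsw, hs', ← sub_mul]
      congr 1
      rw [sub_smul, Quaternion.coe_sub]; abel
    have hy0 : u * y - y * u = 0 := by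
      by_contra hne
      have h1 := hj.min y hyR hne
      rw [hyc, map_mul, hu'.normSq_add_smul] at h1
      have h2 : 0 < normSq (u * j - j * u) :=
        lt_of_le_of_ne Quaternion.normSq_nonneg (Ne.symm (Quaternion.normSq_ne_zero.mpr hj.ne))
      have h3 : (s₀ - t₀) ^ 2 + tr u * (s₀ - t₀) * (s₁ - t₁) + (s₁ - t₁) ^ 2 < 1 := by
        rcases hu'.2 with h0 | h0 <;> rw [h0] <;> nlinarith
      nlinarith
    obtain ⟨a, b, hab⟩ := h.exists_int_of_commute hu hu' hyR hy0
    refine ⟨![a, b, t₀, t₁], ?_⟩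
    have hx2 : x = y + (((t₀ : ℝ) : ℍ[ℝ]) + (t₁ : ℝ) • u) * j := by rw [hy]; abel
    rw [hx2, hab]
    simp only [Fin.sum_univ_four, Matrix.cons_val, add_mul, smul_mul_assoc,
      Quaternion.coe_mul_eq_smul]
    rw [show ((a : ℝ) : ℍ[ℝ]) = (a : ℝ) • (1 : ℍ[ℝ]) by rw [← Quaternion.coe_mul_eq_smul, mul_one]]
    abel
  · rintro ⟨c, rfl⟩
    refine R.sum_mem fun i _ => smul_mem_of_mem _ ?_
    fin_cases i
    exacts [R.one_mem, hu, hj.mem, R.mul_mem hu hj.mem]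

/-- Each discriminant is a value on R of the trilinear form, all of whose values are multiples of
the other discriminant. -/
theorem natAbs_disc_eq (h : HasIntegralBasis R e) {e' : Fin 4 → ℍ[ℝ]}
    (h' : HasIntegralBasis R e') : h.disc.natAbs = h'.disc.natAbs := by
  refine Nat.dvd_antisymm ?_ ?_ <;> rw [Int.natAbs_dvd_natAbs, ← intCast_mem_mult]
  · rw [← h'.tripleTrace_basis]
    exact h.tripleTrace_mem (h'.basis_mem 1) (h'.basis_mem 2) (h'.basis_mem 3)
  · rw [← h.tripleTrace_basis]
    exact h'.tripleTrace_mem (h.basis_mem 1) (h.basis_mem 2) (h.basis_mem 3)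

end HasIntegralBasis

/-! ### Normal forms of orders containing a root of unity -/

theorem normSq_pair (u j : ℍ[ℝ]) (a₀ a₁ b₀ b₁ : ℝ) :
    normSq ((a₀ : ℍ[ℝ]) + a₁ • u + b₀ • j + b₁ • (u * j)) =
      a₀ ^ 2 + tr u * a₀ * a₁ + normSq u * a₁ ^ 2
        + normSq j * (b₀ ^ 2 + tr u * b₀ * b₁ + normSq u * b₁ ^ 2)
        + b₀ * (a₀ * tr j + a₁ * tr (u * star j))
        + b₁ * (a₀ * (tr u * tr j - tr (u * star j)) + a₁ * normSq u * tr j) := by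
  simp [Quaternion.normSq_def', tr]
  ring

theorem tripleTrace_pair (u j : ℍ[ℝ]) : tripleTrace u j (u * j) =
    (tr u * tr j - tr (u * star j)) ^ 2 - 4 * normSq u * normSq j
      - tr u * tr j * (tr u * tr j - tr (u * star j)) + tr u ^ 2 * normSq j
      + normSq u * tr j ^ 2 := by
  simp [Quaternion.normSq_def', tr, tripleTrace_eq]
  ring

theorem add_smul_mem {R : Subring ℍ[ℝ]} {u : ℍ[ℝ]} (hu : u ∈ R) (a b : ℤ) :
    ((a : ℝ) : ℍ[ℝ]) + (b : ℝ) • u ∈ R :=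
  R.add_mem (by rw [Quaternion.coe_intCast]; exact intCast_mem R _) (smul_mem_of_mem _ hu)

namespace IsGenerator

variable {R : Subring ℍ[ℝ]} {u j : ℍ[ℝ]}

theorem sub (hj : IsGenerator R u j) (hu : u ∈ R) (a b : ℤ) :
    IsGenerator R u (j - (((a : ℝ) : ℍ[ℝ]) + (b : ℝ) • u)) := by
  have h : u * (j - (((a : ℝ) : ℍ[ℝ]) + (b : ℝ) • u)) - (j - (((a : ℝ) : ℍ[ℝ]) + (b : ℝ) • u)) * u
      = u * j - j * u := by
    rw [mul_sub, sub_mul, mul_add, add_mul, Quaternion.coe_commutes, mul_smul_comm, smul_mul_assoc]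
    abel
  exact ⟨R.sub_mem hj.mem (add_smul_mem hu a b), by rw [h]; exact hj.ne, by rw [h]; exact hj.min⟩

theorem neg (hj : IsGenerator R u j) : IsGenerator R u (-j) := by
  have h : u * (-j) - (-j) * u = -(u * j - j * u) := by
    rw [mul_neg, neg_mul]; abel
  refine ⟨R.neg_mem hj.mem, by rw [h]; exact neg_ne_zero.mpr hj.ne, ?_⟩
  rw [h, Quaternion.normSq_neg]
  exact hj.min

theorem mul_left (hj : IsGenerator R u j) (hu : u ∈ R) (h1 : normSq u = 1) :
    IsGenerator R u (u * j) := by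
  have h : u * (u * j) - (u * j) * u = u * (u * j - j * u) := by
    rw [mul_sub, mul_assoc u j]
  have hu0 : u ≠ 0 := by rintro rfl; simp at h1
  refine ⟨R.mul_mem hu hj.mem, by rw [h]; exact mul_ne_zero hu0 hj.ne, ?_⟩
  rw [h, map_mul, h1, one_mul]
  exact hj.min

end IsGenerator

theorem tr_sub_pair (u j : ℍ[ℝ]) (a b : ℝ) :
    tr (j - ((a : ℍ[ℝ]) + b • u)) = tr j - (2 * a + tr u * b) := by
  simp [tr]; ring

theorem tr_mul_star_sub_pair (u j : ℍ[ℝ]) (a b : ℝ) :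
    tr (u * star (j - ((a : ℍ[ℝ]) + b • u))) =
      tr (u * star j) - (tr u * a + 2 * normSq u * b) := by
  simp [tr, Quaternion.normSq_def']; ring

namespace HasIntegralBasis

variable {R : Subring ℍ[ℝ]} {e : Fin 4 → ℍ[ℝ]} {u j x : ℍ[ℝ]}

theorem natAbs_disc_pair (h : HasIntegralBasis R e) (h' : HasIntegralBasis R ![1, u, j, u * j])
    {D : ℤ} (hD : 0 ≤ D) (hD' : tripleTrace u j (u * j) = -D) : (h.disc.natAbs : ℤ) = D := by
  have h1 := h'.tripleTrace_basis
  simp only [Matrix.cons_val] at h1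
  rw [h.natAbs_disc_eq h']
  have : h'.disc = -D := by
    have h2 : (h'.disc : ℝ) = -D := by rw [← h1, hD']
    exact_mod_cast h2
  rw [this, Int.natAbs_neg, Int.natAbs_of_nonneg hD]

theorem one_le_of_normSq_eq {m : ℤ} (hx0 : x ≠ 0) (hm : normSq x = m) : 1 ≤ m := by
  have h1 : 0 < normSq x :=
    lt_of_le_of_ne Quaternion.normSq_nonneg (Ne.symm (Quaternion.normSq_ne_zero.mpr hx0))
  rw [hm] at h1
  exact_mod_cast h1

theorem ne_zero_of_isGenerator (hj : IsGenerator R u j) : j ≠ 0 := by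
  rintro rfl
  exact hj.ne (by simp)

/-- Normal form of an order containing a third root of unity. -/
theorem exists_normalForm_three (h : HasIntegralBasis R e) (hu : u ∈ R) (hn : normSq u = 1)
    (ht : tr u = -1) : ∃ (j : ℍ[ℝ]) (m δ : ℤ), IsGenerator R u j ∧ normSq j = m ∧ 1 ≤ m ∧
      tr j = 0 ∧ tr (u * star j) = -δ ∧ (δ = 0 ∨ δ = 1) ∧ (h.disc.natAbs : ℤ) = 3 * m - δ := by
  have hu' : IsRootUnit u := ⟨hn, Or.inr ht⟩
  have key : ∃ (j : ℍ[ℝ]) (δ : ℤ), IsGenerator R u j ∧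
      tr j = 0 ∧ tr (u * star j) = -δ ∧ (δ = 0 ∨ δ = 1) := by
    -- Subtracting a + bu from j subtracts (2a - b, 2b - a) from (tr j, tr(u j̄)). Only the
    -- difference of the two traces modulo 3 is invariant, and j ↦ -j exchanges the classes 1 and 2.
    have aux : ∀ j, IsGenerator R u j → ∀ (δ s k : ℤ), tr (u * star j) = s - δ →
        tr j = s + 3 * k → (δ = 0 ∨ δ = 1) → ∃ (j : ℍ[ℝ]) (δ : ℤ), IsGenerator R u j ∧
          tr j = 0 ∧ tr (u * star j) = -δ ∧ (δ = 0 ∨ δ = 1) := fun j hj δ s k h1 h2 h3 => by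
      refine ⟨_, δ, hj.sub hu (s + 2 * k) (s + k), ?_, ?_, h3⟩
      · rw [tr_sub_pair, h2, ht]; push_cast; ring
      · rw [tr_mul_star_sub_pair, h1, ht, hn]; push_cast; ring
    obtain ⟨j, hj⟩ := h.exists_isGenerator hu hu'
    obtain ⟨t, ht₀⟩ := h.exists_tr_eq hj.mem
    obtain ⟨s, hs₀⟩ := h.exists_tr_eq (R.mul_mem hu (h.star_mem hj.mem))
    have h3 : (t - s) % 3 = 0 ∨ (t - s) % 3 = 1 ∨ (t - s) % 3 = 2 := by omega
    have h4 := Int.emod_add_mul_ediv (t - s) 3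
    set k := (t - s) / 3
    rcases h3 with h3 | h3 | h3 <;> rw [h3] at h4
    · refine aux j hj 0 s k (by simp [hs₀]) ?_ (Or.inl rfl)
      rw [ht₀]; exact_mod_cast (by linarith : t = s + 3 * k)
    · refine aux j hj 1 (s + 1) k (by simp [hs₀]) ?_ (Or.inr rfl)
      rw [ht₀]; exact_mod_cast (by linarith : t = s + 1 + 3 * k)
    · refine aux (-j) hj.neg 1 (-s + 1) (-k - 1) (by
        push_cast; rw [← hs₀]; simp [tr]; ring) ?_ (Or.inr rfl)
      have h5 : tr (-j) = -t := by rw [← ht₀]; simp [tr]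
      rw [h5]; exact_mod_cast (by linarith : -t = -s + 1 + 3 * (-k - 1))
  obtain ⟨j, δ, hj, h1, h2, h3⟩ := key
  obtain ⟨m, hm⟩ := h.exists_normSq_eq hj.mem
  have hm1 := one_le_of_normSq_eq (ne_zero_of_isGenerator hj) hm
  refine ⟨j, m, δ, hj, hm, hm1, h1, h2, h3, ?_⟩
  refine h.natAbs_disc_pair (h.of_isGenerator hu hu' hj) (by omega) ?_
  rw [tripleTrace_pair, h1, h2, hm, hn, ht]
  rcases h3 with rfl | rfl <;> push_cast <;> ring

/-- Normal form of an order containing a fourth root of unity. -/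
theorem exists_normalForm_four (h : HasIntegralBasis R e) (hu : u ∈ R) (hn : normSq u = 1)
    (ht : tr u = 0) : ∃ (j : ℍ[ℝ]) (m δ ε : ℤ), IsGenerator R u j ∧ normSq j = m ∧ 1 ≤ m ∧
      tr j = δ ∧ tr (u * star j) = ε ∧
      ((δ = 0 ∧ ε = 0) ∨ (δ = 1 ∧ ε = 0) ∨ (δ = 1 ∧ ε = 1)) ∧
      (h.disc.natAbs : ℤ) = 4 * m - δ - ε := by
  have hu' : IsRootUnit u := ⟨hn, Or.inl ht⟩
  have key : ∃ (j : ℍ[ℝ]) (δ ε : ℤ), IsGenerator R u j ∧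
      tr j = δ ∧ tr (u * star j) = ε ∧
      ((δ = 0 ∧ ε = 0) ∨ (δ = 1 ∧ ε = 0) ∨ (δ = 1 ∧ ε = 1)) := by
    obtain ⟨j, hj⟩ := h.exists_isGenerator hu hu'
    obtain ⟨t, ht₀⟩ := h.exists_tr_eq hj.mem
    obtain ⟨s, hs₀⟩ := h.exists_tr_eq (R.mul_mem hu (h.star_mem hj.mem))
    -- Subtracting a + bu from j subtracts 2a and 2b from the two traces, so only their parities
    -- count. Multiplying j by u turns the class (even, odd) into (odd, even).
    rcases Int.even_or_odd' t with ⟨k, hk | hk⟩ <;> rcases Int.even_or_odd' s with ⟨l, hl | hl⟩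
    · refine ⟨_, 0, 0, hj.sub hu k l, ?_, ?_, Or.inl ⟨rfl, rfl⟩⟩
      · rw [tr_sub_pair, ht₀, ht, hk]; push_cast; ring
      · rw [tr_mul_star_sub_pair, hs₀, ht, hn, hl]; push_cast; ring
    · refine ⟨_, 1, 0, (hj.mul_left hu hn).sub hu (-l - 1) k, ?_, ?_, Or.inr (Or.inl ⟨rfl, rfl⟩)⟩
      · have h5 : tr (u * j) = tr u * tr j - tr (u * star j) := by simp [tr]; ring
        rw [tr_sub_pair, h5, hs₀, ht, hl]; push_cast; ring
      · have h5 : tr (u * star (u * j)) = normSq u * tr j := by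
          simp [tr, Quaternion.normSq_def']; ring
        rw [tr_mul_star_sub_pair, h5, ht₀, ht, hn, hk]; push_cast; ring
    · refine ⟨_, 1, 0, hj.sub hu k l, ?_, ?_, Or.inr (Or.inl ⟨rfl, rfl⟩)⟩
      · rw [tr_sub_pair, ht₀, ht, hk]; push_cast; ring
      · rw [tr_mul_star_sub_pair, hs₀, ht, hn, hl]; push_cast; ring
    · refine ⟨_, 1, 1, hj.sub hu k l, ?_, ?_, Or.inr (Or.inr ⟨rfl, rfl⟩)⟩
      · rw [tr_sub_pair, ht₀, ht, hk]; push_cast; ring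
      · rw [tr_mul_star_sub_pair, hs₀, ht, hn, hl]; push_cast; ring
  obtain ⟨j, δ, ε, hj, h1, h2, h3⟩ := key
  obtain ⟨m, hm⟩ := h.exists_normSq_eq hj.mem
  have hm1 := one_le_of_normSq_eq (ne_zero_of_isGenerator hj) hm
  refine ⟨j, m, δ, ε, hj, hm, hm1, h1, h2, h3, ?_⟩
  refine h.natAbs_disc_pair (h.of_isGenerator hu hu' hj) (by omega) ?_
  rw [tripleTrace_pair, h1, h2, hm, hn, ht]
  rcases h3 with ⟨rfl, rfl⟩ | ⟨rfl, rfl⟩ | ⟨rfl, rfl⟩ <;> push_cast <;> ring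

/-- An order of reduced discriminant 2, 3 or 5 contains a third root of unity. -/
theorem exists_third_root (h : HasIntegralBasis R e)
    (hd : h.disc.natAbs ∈ ({2, 3, 5} : Set ℕ)) : ∃ u ∈ R, normSq u = 1 ∧ tr u = -1 := by
  simp only [Set.mem_insert_iff, Set.mem_singleton_iff] at hd
  obtain ⟨u, hu, hn, ht | ht⟩ := h.exists_unit_of_disc_le (by omega)
  · obtain ⟨j, m, δ, ε, hj, hm, hm1, h1, h2, h3, h4⟩ := h.exists_normalForm_four hu hn ht
    -- The number 4m - δ - ε is never 5, and it is 2 or 3 only for m = δ = 1.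
    have h5 : m = 1 ∧ δ = 1 := by omega
    refine ⟨-j, R.neg_mem hj.mem, ?_, ?_⟩
    · rw [Quaternion.normSq_neg, hm, h5.1]; simp
    · have : tr (-j) = -tr j := by simp [tr]
      rw [this, h1, h5.2]; simp
  · exact ⟨u, hu, hn, ht⟩

end HasIntegralBasis

/-! ### Euclidean orders -/

/-- Left Euclidean division in a subring of Hamilton's quaternions. -/
def IsEuclid (R : Subring ℍ[ℝ]) : Prop :=
  ∀ a ∈ R, ∀ b ∈ R, b ≠ 0 → ∃ c ∈ R, normSq (a - c * b) < normSq b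

theorem isLeftEuclidean_iff {A : Subalgebra ℚ ℍ[ℝ]} {O : Subring A} :
    IsLeftEuclidean O ↔ IsEuclid (image O) := by
  constructor
  · intro h a ha b hb hb0
    obtain ⟨a, ha, rfl⟩ := mem_image.mp ha
    obtain ⟨b, hb, rfl⟩ := mem_image.mp hb
    rw [coe_mem_image] at ha hb
    obtain ⟨c, hc, d, hd, rfl, hlt⟩ := h a ha b hb (fun h0 => hb0 (by rw [h0]; rfl))
    refine ⟨c, coe_mem_image.mpr hc, ?_⟩
    push_cast
    rwa [add_sub_cancel_left]
  · intro h a ha b hb hb0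
    obtain ⟨c, hc, hlt⟩ := h a (coe_mem_image.mpr ha) b (coe_mem_image.mpr hb)
      (fun h0 => hb0 (Subtype.ext h0))
    obtain ⟨c, hc, rfl⟩ := mem_image.mp hc
    rw [coe_mem_image] at hc
    refine ⟨c, hc, a - c * b, O.sub_mem ha (O.mul_mem hc hb), by abel, ?_⟩
    push_cast
    exact hlt

namespace HasIntegralBasis

variable {R : Subring ℍ[ℝ]} {e : Fin 4 → ℍ[ℝ]} {u j x : ℍ[ℝ]}

theorem sum_intCast_eq (h : HasIntegralBasis R ![1, u, j, u * j]) (hx : x ∈ R) :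
    ∃ a₀ a₁ b₀ b₁ : ℤ,
      x = ((a₀ : ℝ) : ℍ[ℝ]) + (a₁ : ℝ) • u + (b₀ : ℝ) • j + (b₁ : ℝ) • (u * j) := by
  obtain ⟨c, rfl⟩ := (h.mem _).mp hx
  refine ⟨c 0, c 1, c 2, c 3, ?_⟩
  simp only [Fin.sum_univ_four, Matrix.cons_val]
  rw [show ((c 0 : ℝ) : ℍ[ℝ]) = (c 0 : ℝ) • (1 : ℍ[ℝ]) by
    rw [← Quaternion.coe_mul_eq_smul, mul_one]]

theorem exists_normSq_lt_of_isEuclid (h : HasIntegralBasis R ![1, u, j, u * j]) (hE : IsEuclid R)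
    (k : ℤ) (hk : k ≠ 0) (a₀ a₁ b₀ b₁ : ℤ) : ∃ c₀ c₁ d₀ d₁ : ℤ,
      normSq ((((a₀ - k * c₀ : ℤ) : ℝ) : ℍ[ℝ]) + ((a₁ - k * c₁ : ℤ) : ℝ) • u
        + ((b₀ - k * d₀ : ℤ) : ℝ) • j + ((b₁ - k * d₁ : ℤ) : ℝ) • (u * j)) < k ^ 2 := by
  have hx : ((a₀ : ℝ) : ℍ[ℝ]) + (a₁ : ℝ) • u + (b₀ : ℝ) • j + (b₁ : ℝ) • (u * j) ∈ R :=
    R.add_mem (R.add_mem (add_smul_mem (h.basis_mem 1) _ _) (smul_mem_of_mem _ (h.basis_mem 2)))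
      (smul_mem_of_mem _ (h.basis_mem 3))
  obtain ⟨c, hc, hlt⟩ := hE _ hx (((k : ℝ) : ℍ[ℝ])) (by
    rw [Quaternion.coe_intCast]; exact intCast_mem R k) (by
    intro h0
    have := congrArg (fun q : ℍ[ℝ] => q.re) h0
    simp at this
    exact hk this)
  obtain ⟨c₀, c₁, d₀, d₁, rfl⟩ := h.sum_intCast_eq hc
  refine ⟨c₀, c₁, d₀, d₁, ?_⟩
  rw [Quaternion.normSq_coe] at hlt
  convert hlt using 2
  rw [← Quaternion.coe_commutes, Quaternion.coe_mul_eq_smul]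
  ext <;> simp <;> ring

/-- The point (2/3, 1/3) is a deep hole of the hexagonal lattice, at squared distance 1/3; the
inequality is scaled by 9. -/
theorem three_le_hex (c d : ℤ) :
    3 ≤ (2 - 3 * c) ^ 2 - (2 - 3 * c) * (1 - 3 * d) + (1 - 3 * d) ^ 2 := by
  have h1 : 0 ≤ c ^ 2 - c * d + d ^ 2 - c := by
    by_contra! hcon
    have : c ^ 2 - c * d + d ^ 2 - c ≤ -1 := by omega
    nlinarith [sq_nonneg (3 * c - 2), sq_nonneg (2 * d - c)]
  nlinarith

theorem two_le_odd_sq (c d : ℤ) : 2 ≤ (1 - 2 * c) ^ 2 + (1 - 2 * d) ^ 2 := by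
  have h1 : ∀ c : ℤ, 0 ≤ c * (c - 1) := fun c => by
    rcases le_or_gt c 0 with h | h
    · exact mul_nonneg_of_nonpos_of_nonpos h (by omega)
    · exact mul_nonneg h.le (by omega)
  nlinarith [h1 c, h1 d]

/-- Division is tested at a point whose components along ℤ[u] and ℤ[u]j are both deep holes. Its
squared distance to R is at least (1 + m)/3 when δ = 0, and at least m/3 when δ = 1, after
completing the square. Hence m = 1 in the first case, giving 3, and m ≤ 2 in the second, giving 2 or
5. -/
theorem disc_of_isEuclid_three (h : HasIntegralBasis R e) (hE : IsEuclid R) (hu : u ∈ R)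
    (hn : normSq u = 1) (ht : tr u = -1) : h.disc.natAbs ∈ ({2, 3, 5} : Set ℕ) := by
  obtain ⟨j, m, δ, hj, hm, hm1, h1, h2, h3, h4⟩ := h.exists_normalForm_three hu hn ht
  have hB := h.of_isGenerator hu ⟨hn, Or.inr ht⟩ hj
  simp only [Set.mem_insert_iff, Set.mem_singleton_iff]
  rcases h3 with rfl | rfl
  · obtain ⟨c₀, c₁, d₀, d₁, hlt⟩ := hB.exists_normSq_lt_of_isEuclid hE 3 (by norm_num) 2 1 2 1
    rw [normSq_pair, hn, ht, hm, h1, h2] at hlt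
    have hlt' : (2 - 3 * c₀) ^ 2 - (2 - 3 * c₀) * (1 - 3 * c₁) + (1 - 3 * c₁) ^ 2 +
        m * ((2 - 3 * d₀) ^ 2 - (2 - 3 * d₀) * (1 - 3 * d₁) + (1 - 3 * d₁) ^ 2) < 9 := by
      have h5 : (((2 - 3 * c₀) ^ 2 - (2 - 3 * c₀) * (1 - 3 * c₁) + (1 - 3 * c₁) ^ 2 +
        m * ((2 - 3 * d₀) ^ 2 - (2 - 3 * d₀) * (1 - 3 * d₁) + (1 - 3 * d₁) ^ 2) : ℤ) : ℝ)
          < (9 : ℤ) := by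
        push_cast at hlt ⊢
        linarith
      exact_mod_cast h5
    have h5 := three_le_hex c₀ c₁
    have h6 := three_le_hex d₀ d₁
    have : m < 2 := by nlinarith
    omega
  · obtain ⟨c₀, c₁, d₀, d₁, hlt⟩ := hB.exists_normSq_lt_of_isEuclid hE 3 (by norm_num) 0 0 2 1
    rw [normSq_pair, hn, ht, hm, h1, h2] at hlt
    have h5 := three_le_hex (c₀ - 2 * c₁ + d₀) (2 * c₀ - c₁ + d₁)
    have h6 := three_le_hex d₀ d₁
    have hlt' : (2 - 3 * (c₀ - 2 * c₁ + d₀)) ^ 2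
        - (2 - 3 * (c₀ - 2 * c₁ + d₀)) * (1 - 3 * (2 * c₀ - c₁ + d₁))
        + (1 - 3 * (2 * c₀ - c₁ + d₁)) ^ 2 +
        (3 * m - 1) * ((2 - 3 * d₀) ^ 2 - (2 - 3 * d₀) * (1 - 3 * d₁) + (1 - 3 * d₁) ^ 2) < 27 := by
      have h7 : (((2 - 3 * (c₀ - 2 * c₁ + d₀)) ^ 2
        - (2 - 3 * (c₀ - 2 * c₁ + d₀)) * (1 - 3 * (2 * c₀ - c₁ + d₁))
        + (1 - 3 * (2 * c₀ - c₁ + d₁)) ^ 2 +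
        (3 * m - 1) * ((2 - 3 * d₀) ^ 2 - (2 - 3 * d₀) * (1 - 3 * d₁) + (1 - 3 * d₁) ^ 2) : ℤ) : ℝ)
          < (27 : ℤ) := by
        push_cast at hlt ⊢
        linarith
      exact_mod_cast h7
    have : m < 3 := by nlinarith
    omega

/-- The test points are halves of lattice points. The squared distance to R is at least (1 + m)/2
when δ = ε = 0, which is impossible, and at least m/2 in the two other cases, so that m = 1 and the
discriminant is 3 or 2. -/
theorem disc_of_isEuclid_four (h : HasIntegralBasis R e) (hE : IsEuclid R) (hu : u ∈ R)
    (hn : normSq u = 1) (ht : tr u = 0) : h.disc.natAbs ∈ ({2, 3, 5} : Set ℕ) := by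
  obtain ⟨j, m, δ, ε, hj, hm, hm1, h1, h2, h3, h4⟩ := h.exists_normalForm_four hu hn ht
  have hB := h.of_isGenerator hu ⟨hn, Or.inl ht⟩ hj
  simp only [Set.mem_insert_iff, Set.mem_singleton_iff]
  rcases h3 with ⟨rfl, rfl⟩ | ⟨rfl, rfl⟩ | ⟨rfl, rfl⟩
  · obtain ⟨c₀, c₁, d₀, d₁, hlt⟩ := hB.exists_normSq_lt_of_isEuclid hE 2 (by norm_num) 1 1 1 1
    rw [normSq_pair, hn, ht, hm, h1, h2] at hlt
    have hlt' : (1 - 2 * c₀) ^ 2 + (1 - 2 * c₁) ^ 2 +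
        m * ((1 - 2 * d₀) ^ 2 + (1 - 2 * d₁) ^ 2) < 4 := by
      have h5 : (((1 - 2 * c₀) ^ 2 + (1 - 2 * c₁) ^ 2 +
        m * ((1 - 2 * d₀) ^ 2 + (1 - 2 * d₁) ^ 2) : ℤ) : ℝ) < (4 : ℤ) := by
        push_cast at hlt ⊢
        linarith
      exact_mod_cast h5
    have h5 := two_le_odd_sq c₀ c₁
    have h6 := two_le_odd_sq d₀ d₁
    nlinarith
  · obtain ⟨c₀, c₁, d₀, d₁, hlt⟩ := hB.exists_normSq_lt_of_isEuclid hE 2 (by norm_num) 0 0 1 1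
    rw [normSq_pair, hn, ht, hm, h1, h2] at hlt
    have h5 := two_le_odd_sq (2 * c₀ + d₀) (2 * c₁ + d₁)
    have h6 := two_le_odd_sq d₀ d₁
    have hlt' : (1 - 2 * (2 * c₀ + d₀)) ^ 2 + (1 - 2 * (2 * c₁ + d₁)) ^ 2 +
        (4 * m - 1) * ((1 - 2 * d₀) ^ 2 + (1 - 2 * d₁) ^ 2) < 16 := by
      have h7 : (((1 - 2 * (2 * c₀ + d₀)) ^ 2 + (1 - 2 * (2 * c₁ + d₁)) ^ 2 +
        (4 * m - 1) * ((1 - 2 * d₀) ^ 2 + (1 - 2 * d₁) ^ 2) : ℤ) : ℝ) < (16 : ℤ) := by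
        push_cast at hlt ⊢
        linarith
      exact_mod_cast h7
    have : m < 2 := by nlinarith
    omega
  · obtain ⟨c₀, c₁, d₀, d₁, hlt⟩ := hB.exists_normSq_lt_of_isEuclid hE 2 (by norm_num) 0 0 1 1
    rw [normSq_pair, hn, ht, hm, h1, h2] at hlt
    have h6 := two_le_odd_sq d₀ d₁
    -- The two squared integers have opposite parities, so they are not both zero.
    have h5 : 1 ≤ (-2 * c₀ - d₀ + d₁) ^ 2 + (-2 * c₁ + 1 - d₀ - d₁) ^ 2 := by
      by_contra! hcon
      have p1 : 0 ≤ (-2 * c₀ - d₀ + d₁) ^ 2 := sq_nonneg _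
      have p2 : 0 ≤ (-2 * c₁ + 1 - d₀ - d₁) ^ 2 := sq_nonneg _
      have e1 : (-2 * c₀ - d₀ + d₁) ^ 2 = 0 := by omega
      have e2 : (-2 * c₁ + 1 - d₀ - d₁) ^ 2 = 0 := by omega
      have e3 := (pow_eq_zero_iff two_ne_zero).mp e1
      have e4 := (pow_eq_zero_iff two_ne_zero).mp e2
      omega
    have hlt' : 2 * ((-2 * c₀ - d₀ + d₁) ^ 2 + (-2 * c₁ + 1 - d₀ - d₁) ^ 2) +
        (2 * m - 1) * ((1 - 2 * d₀) ^ 2 + (1 - 2 * d₁) ^ 2) < 8 := by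
      have h7 : ((2 * ((-2 * c₀ - d₀ + d₁) ^ 2 + (-2 * c₁ + 1 - d₀ - d₁) ^ 2) +
        (2 * m - 1) * ((1 - 2 * d₀) ^ 2 + (1 - 2 * d₁) ^ 2) : ℤ) : ℝ) < (8 : ℤ) := by
        push_cast at hlt ⊢
        linarith
      exact_mod_cast h7
    have : m < 2 := by nlinarith
    omega

/-- A Euclidean order has a unit different from `±1`. -/
theorem exists_root_of_isEuclid (h : HasIntegralBasis R e) (hM : IsNormMaximal R)
    (hE : IsEuclid R) : ∃ u ∈ R, IsRootUnit u := by
  have hunit : (∃ u ∈ R, IsRootUnit u) ∨ ∀ x ∈ R, normSq x = 1 → x = 1 ∨ x = -1 := by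
    by_cases hall : ∀ x ∈ R, normSq x = 1 → x = 1 ∨ x = -1
    · exact Or.inr hall
    · left
      push Not at hall
      obtain ⟨x, hx, hn, hx1, hx2⟩ := hall
      obtain ⟨t, ht⟩ := h.exists_tr_eq hx
      have hI : 0 < imInner x x := by
        refine lt_of_le_of_ne (imInner_self_nonneg x) fun h0 => ?_
        have h3 : x.imI = 0 ∧ x.imJ = 0 ∧ x.imK = 0 := by
          rw [imInner] at h0
          refine ⟨?_, ?_, ?_⟩ <;>
            nlinarith [sq_nonneg x.imI, sq_nonneg x.imJ, sq_nonneg x.imK]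
        rw [Quaternion.normSq_def', h3.1, h3.2.1, h3.2.2] at hn
        have h4 : (x.re - 1) * (x.re + 1) = 0 := by linarith
        rcases mul_eq_zero.mp h4 with h4 | h4
        · exact hx1 (by ext <;> simp [h3]; linarith)
        · exact hx2 (by ext <;> simp [h3]; linarith)
      rw [imInner_self, hn, ht] at hI
      have hI' : t ^ 2 < 4 := by
        have : (t : ℝ) ^ 2 < 4 := by linarith
        exact_mod_cast this
      have h1 : -2 < t ∧ t < 2 := ⟨by nlinarith, by nlinarith⟩
      have h2 : t = 0 ∨ t = -1 ∨ t = 1 := by omega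
      rcases h2 with rfl | rfl | rfl
      · exact ⟨x, hx, hn, Or.inl (by simpa using ht)⟩
      · exact ⟨x, hx, hn, Or.inr (by simpa using ht)⟩
      · refine ⟨-x, R.neg_mem hx, by rw [Quaternion.normSq_neg, hn], Or.inr ?_⟩
        have : tr (-x) = -tr x := by simp [tr]
        rw [this, ht]; simp
  refine hunit.resolve_right fun hpm => ?_
  -- Let b have the least norm among nonzero non-units. If ±1 are the only units, every remainder
  -- modulo b is 0, 1 or -1, so each basis vector is an integer plus a left multiple of b.
  obtain ⟨b, ⟨hb, hb0, hb1⟩, hmin⟩ := exists_min_of_natCast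
    (S := {x | x ∈ R ∧ x ≠ 0 ∧ normSq x ≠ 1}) ⟨1 + 1, R.add_mem R.one_mem R.one_mem, fun h0 => by
      have h1 : (1 + 1 : ℍ[ℝ]).re = (0 : ℍ[ℝ]).re := by rw [h0]
      simp only [Quaternion.re_add, Quaternion.re_one, Quaternion.re_zero] at h1
      norm_num at h1, by
      simp only [Quaternion.normSq_def', Quaternion.re_add, Quaternion.imI_add,
        Quaternion.imJ_add, Quaternion.imK_add, Quaternion.re_one, Quaternion.imI_one,
        Quaternion.imJ_one, Quaternion.imK_one]
      norm_num⟩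
    (fun x => normSq x) (fun x hx => h.exists_normSq_eq hx.1)
    (fun x _ => Quaternion.normSq_nonneg)
  obtain ⟨n, hn⟩ := h.exists_normSq_eq hb
  have hn1 := one_le_of_normSq_eq hb0 hn
  have hn2 : n ≠ 1 := by rintro rfl; exact hb1 (by simpa using hn)
  have hres : ∀ x ∈ R, ∃ (k : ℤ) (g : ℍ[ℝ]), g ∈ R ∧ x - ((k : ℝ) : ℍ[ℝ]) = g * b := fun x hx => by
    obtain ⟨c, hc, hlt⟩ := hE x hx b hb hb0
    have hd : x - c * b ∈ R := R.sub_mem hx (R.mul_mem hc hb)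
    have h3 : x - c * b = 0 ∨ x - c * b = 1 ∨ x - c * b = -1 := by
      by_cases h0 : x - c * b = 0
      · exact Or.inl h0
      · refine Or.inr (hpm _ hd ?_)
        by_contra hne
        exact absurd (hmin _ ⟨hd, h0, hne⟩) (not_le.mpr hlt)
    rcases h3 with h3 | h3 | h3
    · exact ⟨0, c, hc, by simpa using sub_eq_zero.mp h3⟩
    · exact ⟨1, c, hc, by rw [sub_eq_iff_eq_add] at h3 ⊢; rw [h3]; simp [add_comm]⟩
    · exact ⟨-1, c, hc, by rw [sub_eq_iff_eq_add] at h3 ⊢; rw [h3]; simp [add_comm]⟩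
  choose k g hg hk using fun i => hres _ (h.basis_mem i)
  have htriple : tripleTrace (g 1 * b) (g 2 * b) (g 3 * b) = h.disc := by
    rw [← hk, ← hk, ← hk, ← h.tripleTrace_basis]
    simp [tripleTrace_eq]
  obtain ⟨p, hp, hpn⟩ := Nat.exists_prime_and_dvd (n := n.natAbs) (by omega)
  rw [← Int.natCast_dvd] at hpn
  have hnp : (n : ℝ) ∈ mult p := intCast_mem_mult.mpr hpn
  set f := fun i => g i * b with hf
  have hfR : ∀ i, f i ∈ R := fun i => R.mul_mem (hg i) hb
  have hfn : ∀ i, normSq (f i) ∈ mult p := fun i => by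
    rw [hf, map_mul, hn]
    exact mul_mem_mult' (h.normSq_mem (hg i)) hnp
  -- The trilinear form on three left multiples of b is divisible by n(b), and the integer shifts do
  -- not change its value disc.
  have hd : (p : ℤ) ∣ h.disc := by
    rw [← intCast_mem_mult, ← htriple]
    have h3 : tripleTrace (g 1 * b) (g 2 * b) (g 3 * b) =
        -(normSq b * tr ((g 1 * b * g 2 - g 2 * b * g 1) * star (g 3))) := by
      have h4 : (g 1 * b * g 2 - g 2 * b * g 1) * b * star (g 3 * b) =
          normSq b • ((g 1 * b * g 2 - g 2 * b * g 1) * star (g 3)) := by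
        rw [star_mul, ← mul_assoc, mul_assoc _ b (star b), Quaternion.self_mul_star,
          ← Quaternion.coe_commutes, mul_assoc, Quaternion.coe_mul_eq_smul]
      rw [← tr_smul, ← h4, sub_mul, mul_assoc (g 1 * b), mul_assoc (g 2 * b)]
      rw [star_eq_tr_sub (g 3 * b), mul_sub, tr_sub, ← Quaternion.coe_commutes,
        Quaternion.coe_mul_eq_smul, tr_smul, tr_sub, tr_mul_comm (x := g 1 * b)]
      rw [tripleTrace]
      ring
    rw [h3, hn]
    refine neg_mem (mul_mem_mult hnp (h.tr_mem (R.mul_mem (R.sub_mem ?_ ?_)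
      (h.star_mem (hg 3)))))
    · exact R.mul_mem (R.mul_mem (hg 1) hb) (hg 2)
    · exact R.mul_mem (R.mul_mem (hg 2) hb) (hg 1)
  have hprod : ∀ i k, f i * f k ∈ multiples R p := fun i k => by
    refine h.mem_multiples_of_normSq_mem hM hp hd (R.mul_mem (hfR i) (hfR k)) ?_
    rw [map_mul]
    exact mul_mem_mult_mul (hfn i) (hfn k)
  obtain ⟨w, hw, hw'⟩ := sub_mem (hprod 1 2) (hprod 2 1)
  -- Products of two of the `f i` lie in pR, and the third factor lies in the radical, so the
  -- discriminant would be divisible by p².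
  refine h.not_sq_dvd_disc hM hp ?_
  rw [← intCast_mem_mult, ← htriple, tripleTrace]
  change tr ((f 1 * f 2 - f 2 * f 1) * f 3) ∈ _
  rw [hw', smul_mul_assoc, tr_smul, tr_mul_comm]
  exact mul_mem_mult_mul (mem_mult.mpr ⟨1, by simp⟩)
    ((h.radical_of_normSq_mem hM hp hd (hfR 3) (hfn 3)).2.2 w hw)

theorem disc_of_isEuclid (h : HasIntegralBasis R e) (hM : IsNormMaximal R)
    (hE : IsEuclid R) : h.disc.natAbs ∈ ({2, 3, 5} : Set ℕ) := by
  obtain ⟨u, hu, hn, ht | ht⟩ := h.exists_root_of_isEuclid hM hE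
  · exact h.disc_of_isEuclid_four hE hu hn ht
  · exact h.disc_of_isEuclid_three hE hu hn ht

end HasIntegralBasis

/-! ### Triangles of the hexagonal lattice -/

/-- The point `(x, y)` has barycentric coordinates `w` in a unit triangle of the hexagonal lattice
(for the form `x² - xy + y²`) with vertices `(B k, C k)` of colour `k + c`. -/
structure HexTriangle (x y : ℝ) (c : ℤ) (B C : Fin 3 → ℤ) (w : Fin 3 → ℝ) : Prop where
  nonneg : ∀ k, 0 ≤ w k
  sum : w 0 + w 1 + w 2 = 1
  fst : w 0 * B 0 + w 1 * B 1 + w 2 * B 2 = x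
  snd : w 0 * C 0 + w 1 * C 1 + w 2 * C 2 = y
  color : ∀ k : Fin 3, (3 : ℤ) ∣ B k + C k - (k : ℕ) - c
  side : ∀ k l, k ≠ l →
    (B k - B l) ^ 2 - (B k - B l) * (C k - C l) + (C k - C l) ^ 2 = 1
  integral : ∀ N : ℤ, (∃ k : ℤ, N * x = k) → (∃ k : ℤ, N * y = k) → ∀ i, ∃ k : ℤ, N * w i = k

namespace HexTriangle

variable {x y : ℝ} {c : ℤ} {B C : Fin 3 → ℤ} {w : Fin 3 → ℝ}

theorem rotate (h : HexTriangle x y c B C w) : HexTriangle x y (c + 1) (fun k => B (k + 1))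
    (fun k => C (k + 1)) (fun k => w (k + 1)) := by
  refine ⟨fun k => h.nonneg _, ?_, ?_, ?_, fun k => ?_, fun k l hkl => h.side _ _ (by simpa),
    fun N hx hy i => h.integral N hx hy _⟩
  · have := h.sum
    change w 1 + w 2 + w 0 = 1
    linarith
  · have := h.fst
    change w 1 * B 1 + w 2 * B 2 + w 0 * B 0 = x
    linarith
  · have := h.snd
    change w 1 * C 1 + w 2 * C 2 + w 0 * C 0 = y
    linarith
  · have h0 := h.color 0
    have h1 := h.color 1
    have h2 := h.color 2
    fin_cases k
    · change (3 : ℤ) ∣ B 1 + C 1 - ((0 : ℕ) : ℤ) - (c + 1)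
      simp at h1; push_cast; omega
    · change (3 : ℤ) ∣ B 2 + C 2 - ((1 : ℕ) : ℤ) - (c + 1)
      simp at h2; push_cast; omega
    · change (3 : ℤ) ∣ B 0 + C 0 - ((2 : ℕ) : ℤ) - (c + 1)
      simp at h0; push_cast; omega

theorem of_dvd (h : HexTriangle x y c B C w) {c' : ℤ} (hc : (3 : ℤ) ∣ c' - c) :
    HexTriangle x y c' B C w :=
  { h with color := fun k => by have := h.color k; omega }

/-- The unit cell containing (x, y) is cut by its diagonal into two triangles, whose sides have
length 1 for the form x² - xy + y². -/
theorem exists_of_fract (x y : ℝ) : ∃ c B C w, HexTriangle x y c B C w := by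
  have hx := Int.floor_add_fract x
  have hy := Int.floor_add_fract y
  have hx0 := Int.fract_nonneg x
  have hx1 := (Int.fract_lt_one x).le
  have hy0 := Int.fract_nonneg y
  have hy1 := (Int.fract_lt_one y).le
  have hN : ∀ (N : ℤ) (x : ℝ), (∃ k : ℤ, N * x = k) → ∃ k : ℤ, N * Int.fract x = k :=
    fun N x ⟨k, hk⟩ => ⟨k - N * ⌊x⌋, by rw [Int.fract]; push_cast; rw [← hk]; ring⟩
  set a := ⌊x⌋
  set b := ⌊y⌋
  rcases le_total (Int.fract y) (Int.fract x) with hle | hle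
  · refine ⟨a + b, ![a, a + 1, a + 1], ![b, b, b + 1],
      ![1 - Int.fract x, Int.fract x - Int.fract y, Int.fract y], ?_, ?_, ?_, ?_, ?_, ?_, ?_⟩
    · intro k; fin_cases k <;> simp <;> linarith
    · simp
    · simp; linarith
    · simp; linarith
    · intro k
      fin_cases k
      · change (3 : ℤ) ∣ a + b - ((0 : ℕ) : ℤ) - (a + b); omega
      · change (3 : ℤ) ∣ a + 1 + b - ((1 : ℕ) : ℤ) - (a + b); omega
      · change (3 : ℤ) ∣ a + 1 + (b + 1) - ((2 : ℕ) : ℤ) - (a + b); omega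
    · intro k l hkl
      fin_cases k <;> fin_cases l <;> first | exact absurd rfl hkl | simp
    · intro N h1 h2
      obtain ⟨k, hk⟩ := hN N x h1
      obtain ⟨l, hl⟩ := hN N y h2
      intro i
      fin_cases i
      · exact ⟨N - k, by push_cast; rw [← hk]; ring⟩
      · exact ⟨k - l, by push_cast; rw [← hk, ← hl]; ring⟩
      · exact ⟨l, by rw [← hl]; simp⟩
  · refine ⟨a + b, ![a, a, a + 1], ![b, b + 1, b + 1],
      ![1 - Int.fract y, Int.fract y - Int.fract x, Int.fract x], ?_, ?_, ?_, ?_, ?_, ?_, ?_⟩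
    · intro k; fin_cases k <;> simp <;> linarith
    · simp
    · simp; linarith
    · simp; linarith
    · intro k
      fin_cases k
      · change (3 : ℤ) ∣ a + b - ((0 : ℕ) : ℤ) - (a + b); omega
      · change (3 : ℤ) ∣ a + (b + 1) - ((1 : ℕ) : ℤ) - (a + b); omega
      · change (3 : ℤ) ∣ a + 1 + (b + 1) - ((2 : ℕ) : ℤ) - (a + b); omega
    · intro k l hkl
      fin_cases k <;> fin_cases l <;> first | exact absurd rfl hkl | simp
    · intro N h1 h2
      obtain ⟨k, hk⟩ := hN N x h1
      obtain ⟨l, hl⟩ := hN N y h2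
      intro i
      fin_cases i
      · exact ⟨N - l, by push_cast; rw [← hl]; ring⟩
      · exact ⟨l - k, by push_cast; rw [← hk, ← hl]; ring⟩
      · exact ⟨k, by rw [← hk]; simp⟩

theorem exists_of_color (x y : ℝ) (c : ℤ) : ∃ B C w, HexTriangle x y c B C w := by
  obtain ⟨d, B, C, w, h⟩ := exists_of_fract x y
  have h3 : (c - d) % 3 = 0 ∨ (c - d) % 3 = 1 ∨ (c - d) % 3 = 2 := by omega
  rcases h3 with h3 | h3 | h3
  · exact ⟨_, _, _, h.of_dvd (by omega)⟩
  · exact ⟨_, _, _, h.rotate.of_dvd (by omega)⟩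
  · exact ⟨_, _, _, h.rotate.rotate.of_dvd (by omega)⟩

/-- The left side is the mean squared distance from the vertices to their barycentre, which equals
the sum of the products w_k w_l over the three sides of length 1; it is largest at equal weights. -/
theorem sum_hex_sub (h : HexTriangle x y c B C w) :
    w 0 * (B 0 ^ 2 - B 0 * C 0 + C 0 ^ 2) + w 1 * (B 1 ^ 2 - B 1 * C 1 + C 1 ^ 2)
      + w 2 * (B 2 ^ 2 - B 2 * C 2 + C 2 ^ 2) - (x ^ 2 - x * y + y ^ 2) ≤ 1 / 3 := by
  have h1 : ((B 0 - B 1) ^ 2 - (B 0 - B 1) * (C 0 - C 1) + (C 0 - C 1) ^ 2 : ℝ) = 1 := by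
    exact_mod_cast h.side 0 1 (by decide)
  have h2 : ((B 0 - B 2) ^ 2 - (B 0 - B 2) * (C 0 - C 2) + (C 0 - C 2) ^ 2 : ℝ) = 1 := by
    exact_mod_cast h.side 0 2 (by decide)
  have h3 : ((B 1 - B 2) ^ 2 - (B 1 - B 2) * (C 1 - C 2) + (C 1 - C 2) ^ 2 : ℝ) = 1 := by
    exact_mod_cast h.side 1 2 (by decide)
  have hw : w 0 = 1 - w 1 - w 2 := by linarith [h.sum]
  have e : w 0 * (B 0 ^ 2 - B 0 * C 0 + C 0 ^ 2) + w 1 * (B 1 ^ 2 - B 1 * C 1 + C 1 ^ 2)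
      + w 2 * (B 2 ^ 2 - B 2 * C 2 + C 2 ^ 2) - (x ^ 2 - x * y + y ^ 2) =
      w 0 * w 1 + w 0 * w 2 + w 1 * w 2 := by
    rw [← h.fst, ← h.snd, hw]
    linear_combination ((1 - w 1 - w 2) * w 1) * h1 + ((1 - w 1 - w 2) * w 2) * h2
      + (w 1 * w 2) * h3
  rw [e, hw]
  nlinarith [sq_nonneg (w 1 - w 2), sq_nonneg (3 * (w 1 + w 2) - 2)]

end HexTriangle

/-! ### Simplices of lattice points -/

/-- The point `x` is a convex combination of elements of `R` whose mean squared distance to `x`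
is less than `1`, with rationality properties. -/
def HasSimplex (R : Subring ℍ[ℝ]) (x : ℍ[ℝ]) : Prop :=
  ∃ (ι : Type) (_ : Fintype ι) (p : ι → ℍ[ℝ]) (μ : ι → ℝ), (∀ i, p i ∈ R) ∧ (∀ i, 0 ≤ μ i) ∧
    ∑ i, μ i = 1 ∧ ∑ i, μ i • p i = x ∧ ∑ i, μ i * normSq (p i) - normSq x < 1 ∧
    ∀ N : ℤ, (N : ℝ) • x ∈ R → ∃ k : ℤ, N * ∑ i, μ i * normSq (p i) = k

theorem tr_sum {ι : Type*} (s : Finset ι) (f : ι → ℍ[ℝ]) : tr (∑ i ∈ s, f i) = ∑ i ∈ s, tr (f i) :=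
  map_sum (AddMonoidHom.mk' tr fun _ _ => tr_add) f s

theorem sum_mul_tr {ι : Type*} [Fintype ι] (μ : ι → ℝ) (p : ι → ℍ[ℝ]) (z : ℍ[ℝ]) :
    ∑ i, μ i * tr (z * star (p i)) = tr (z * star (∑ i, μ i • p i)) := by
  rw [star_sum, Finset.mul_sum, tr_sum]
  refine Finset.sum_congr rfl fun i _ => ?_
  rw [Quaternion.star_smul, mul_smul_comm, tr_smul]

/-- The parallel axis theorem: the mean squared distance to z is the squared distance from z to the
barycentre x plus the variance. -/
theorem sum_mul_normSq_sub {ι : Type*} [Fintype ι] {μ : ι → ℝ} {p : ι → ℍ[ℝ]} {x : ℍ[ℝ]}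
    (h1 : ∑ i, μ i = 1) (hx : ∑ i, μ i • p i = x) (z : ℍ[ℝ]) :
    ∑ i, μ i * normSq (z - p i) =
      normSq (z - x) + (∑ i, μ i * normSq (p i) - normSq x) := by
  have h2 : ∀ i, μ i * normSq (z - p i) =
      μ i * normSq z + μ i * normSq (p i) - μ i * tr (z * star (p i)) := fun i => by
    rw [normSq_sub_eq]; ring
  simp only [h2, Finset.sum_add_distrib, Finset.sum_sub_distrib]
  rw [← Finset.sum_mul, h1, sum_mul_tr, hx, normSq_sub_eq]
  ring

section

variable {R : Subring ℍ[ℝ]} {e : Fin 4 → ℍ[ℝ]} {x : ℍ[ℝ]}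

theorem HasSimplex.add_mem (h : HasIntegralBasis R e) (hx : HasSimplex R x) {p₀ : ℍ[ℝ]}
    (hp₀ : p₀ ∈ R) : HasSimplex R (p₀ + x) := by
  obtain ⟨ι, _, p, μ, hp, hμ, h1, hpx, hlt, hN⟩ := hx
  have e1 : ∑ i, μ i * normSq (p₀ + p i) =
      normSq p₀ + ∑ i, μ i * normSq (p i) + tr (p₀ * star x) := by
    have h2 : ∀ i, μ i * normSq (p₀ + p i) =
        μ i * normSq p₀ + μ i * normSq (p i) + μ i * tr (p₀ * star (p i)) := fun i => by
      rw [normSq_add_eq]; ring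
    simp only [h2, Finset.sum_add_distrib]
    rw [← Finset.sum_mul, h1, sum_mul_tr, hpx, one_mul]
  refine ⟨ι, inferInstance, fun i => p₀ + p i, μ, fun i => R.add_mem hp₀ (hp i), hμ, h1, ?_, ?_, ?_⟩
  · simp only [smul_add, Finset.sum_add_distrib]
    rw [← Finset.sum_smul, h1, one_smul, hpx]
  · rw [e1, normSq_add_eq]; linarith
  · intro N hN'
    have h3 : (N : ℝ) • x ∈ R := by
      have := R.sub_mem hN' (smul_mem_of_mem N hp₀)
      rwa [smul_add, add_sub_cancel_left] at this
    obtain ⟨k, hk⟩ := hN N h3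
    obtain ⟨n, hn⟩ := h.exists_normSq_eq hp₀
    obtain ⟨t, ht⟩ := h.exists_tr_eq (R.mul_mem hp₀ (h.star_mem h3))
    rw [Quaternion.star_smul, mul_smul_comm, tr_smul] at ht
    refine ⟨N * n + k + t, ?_⟩
    rw [e1, mul_add, mul_add, hk, hn, ht]
    push_cast; ring

/-- Every hemisphere attached to an element outside `R` lies below the floor made of the unit
hemispheres centred in `R`. -/
def HasFloor (R : Subring ℍ[ℝ]) : Prop :=
  ∀ (x : ℍ[ℝ]) (N : ℕ), 0 < N → (N : ℝ) • x ∈ R → (∃ k : ℤ, N * normSq x = k) →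
    ∃ p ∈ R, ∃ μ > 0, ∀ (z : ℍ[ℝ]) (r : ℝ), (∀ q ∈ R, 1 ≤ normSq (z - q) + r ^ 2) →
      μ * (normSq (z - p) + r ^ 2 - 1) ≤ normSq (z - x) + r ^ 2 - 1 / N

/-- Let V be the variance of the simplex at x. Since NV is an integer less than N, V is at most 1 -
1/N. Averaging the nonnegative quantities n(z - p_i) + r² - 1 gives n(z - x) + V + r² - 1, which the
bound on V compares with the hemisphere at x; any single term of positive weight may be kept. -/
theorem hasFloor_of_hasSimplex (h : ∀ x, HasSimplex R x) : HasFloor R := by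
  intro x N hN hNx ⟨k, hk⟩
  obtain ⟨ι, _, p, μ, hp, hμ, h1, hpx, hlt, hint⟩ := h x
  obtain ⟨l, hl⟩ := hint N (by exact_mod_cast hNx)
  have hNR : (0 : ℝ) < N := by exact_mod_cast hN
  have hQ : ∑ i, μ i * normSq (p i) - normSq x ≤ 1 - 1 / N := by
    have h2 : (l : ℝ) - k < N := by
      rw [← hl, ← hk]; push_cast; rw [← mul_sub]
      nlinarith
    have h3 : l - k ≤ N - 1 := by
      have : l - k < N := by exact_mod_cast h2
      omega
    have h4 : (l : ℝ) - k ≤ N - 1 := by exact_mod_cast h3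
    rw [← hl, ← hk] at h4
    push_cast at h4
    have h5 : 1 - 1 / (N : ℝ) = (N - 1) / N := by field_simp
    rw [h5, le_div_iff₀ hNR]
    linarith
  obtain ⟨i, -, hi⟩ : ∃ i ∈ Finset.univ, 0 < μ i := by
    apply Finset.exists_lt_of_sum_lt (f := fun _ => (0 : ℝ))
    rw [h1]; simp
  refine ⟨p i, hp i, μ i, hi, fun z r hz => ?_⟩
  have h2 := sum_mul_normSq_sub h1 hpx z
  have h3 : ∑ i, μ i * (normSq (z - p i) + r ^ 2 - 1) =
      normSq (z - x) + (∑ i, μ i * normSq (p i) - normSq x) + r ^ 2 - 1 := by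
    have h4 : ∀ i, μ i * (normSq (z - p i) + r ^ 2 - 1) =
      μ i * normSq (z - p i) + μ i * (r ^ 2 - 1) := fun i => by ring
    simp only [h4, Finset.sum_add_distrib]
    rw [h2, ← Finset.sum_mul, h1]; ring
  have h5 := Finset.single_le_sum (f := fun i => μ i * (normSq (z - p i) + r ^ 2 - 1))
    (fun i _ => mul_nonneg (hμ i) (by linarith [hz _ (hp i)])) (Finset.mem_univ i)
  rw [h3] at h5
  linarith

theorem HasSimplex.exists_normSq_sub_lt {x : ℍ[ℝ]} (h : HasSimplex R x) :
    ∃ p ∈ R, normSq (x - p) < 1 := by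
  obtain ⟨ι, _, p, μ, hp, hμ, h1, hpx, hlt, -⟩ := h
  have h2 := sum_mul_normSq_sub h1 hpx x
  rw [sub_self, map_zero, zero_add] at h2
  by_contra! hcon
  have h3 : ∑ i, μ i * 1 ≤ ∑ i, μ i * normSq (x - p i) :=
    Finset.sum_le_sum fun i _ => mul_le_mul_of_nonneg_left (hcon _ (hp i)) (hμ i)
  simp only [mul_one] at h3
  linarith

theorem isEuclid_of_hasSimplex (h : ∀ x, HasSimplex R x) : IsEuclid R := by
  intro a _ b _ hb
  obtain ⟨p, hp, hlt⟩ := (h (a * b⁻¹)).exists_normSq_sub_lt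
  refine ⟨p, hp, ?_⟩
  have h3 : a - p * b = (a * b⁻¹ - p) * b := by
    rw [sub_mul, mul_assoc, inv_mul_cancel₀ hb, mul_one]
  have h4 : 0 < normSq b :=
    lt_of_le_of_ne Quaternion.normSq_nonneg (Ne.symm (Quaternion.normSq_ne_zero.mpr hb))
  rw [h3, map_mul]
  nlinarith

end

/-! ### Simplices for the orders of reduced discriminant 2, 3 and 5 -/

/-- The first coordinates of the three vectors of colour 1. -/
def hexFst : Fin 3 → ℤ := ![1, 0, -1]

/-- The second coordinates of the three vectors of colour 1. -/
def hexSnd : Fin 3 → ℤ := ![0, 1, -1]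

theorem exists_hex_of_color {a b : ℤ} (h : a ^ 2 - a * b + b ^ 2 = 1) (hc : (3 : ℤ) ∣ a + b - 1) :
    ∃ i, a = hexFst i ∧ b = hexSnd i := by
  have ha : a ^ 2 ≤ 1 := by nlinarith [sq_nonneg (a - 2 * b), sq_nonneg (2 * a - b)]
  have hb : b ^ 2 ≤ 1 := by nlinarith [sq_nonneg (a - 2 * b), sq_nonneg (2 * a - b)]
  have ha1 : -1 ≤ a := by nlinarith
  have ha2 : a ≤ 1 := by nlinarith
  have hb1 : -1 ≤ b := by nlinarith
  have hb2 : b ≤ 1 := by nlinarith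
  have h4 : (a = 1 ∧ b = 0) ∨ (a = 0 ∧ b = 1) ∨ (a = -1 ∧ b = -1) := by
    interval_cases a <;> interval_cases b <;> omega
  rcases h4 with ⟨rfl, rfl⟩ | ⟨rfl, rfl⟩ | ⟨rfl, rfl⟩
  exacts [⟨0, rfl, rfl⟩, ⟨1, rfl, rfl⟩, ⟨2, rfl, rfl⟩]

/-- The three vectors of colour 1 sum to zero, so their coefficients matter only up to a common
constant c, which is fixed by the total masses w₁ and w₂. The two inequalities leave enough mass to
realise the signed coefficients l₁ + c, c - l₂, c as differences of nonnegative weights. -/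
theorem exists_hex_weights {l₁ l₂ w₁ w₂ : ℝ} (hl₁ : 0 ≤ l₁) (hl₂ : 0 ≤ l₂) (hw₁ : 0 ≤ w₁)
    (hw₂ : 0 ≤ w₂) (h1 : 2 * (l₁ - w₁) + (l₂ - w₂) ≤ 0) (h2 : (l₁ - w₁) + 2 * (l₂ - w₂) ≤ 0)
    {i j : Fin 3} (hij : i ≠ j) : ∃ u v : Fin 3 → ℝ, (∀ m, 0 ≤ u m) ∧ (∀ m, 0 ≤ v m) ∧
      u 0 + u 1 + u 2 = w₁ ∧ v 0 + v 1 + v 2 = w₂ ∧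
      (u 0 - v 0) - (u 2 - v 2) = l₁ * hexFst i - l₂ * hexFst j ∧
      (u 1 - v 1) - (u 2 - v 2) = l₁ * hexSnd i - l₂ * hexSnd j := by
  obtain ⟨c, hc⟩ : ∃ c, 3 * c = w₁ - w₂ - l₁ + l₂ := ⟨(w₁ - w₂ - l₁ + l₂) / 3, by ring⟩
  have key : ∃ x y z x' y' z' : ℝ, 0 ≤ x ∧ 0 ≤ y ∧ 0 ≤ z ∧ 0 ≤ x' ∧ 0 ≤ y' ∧ 0 ≤ z' ∧
      x + y + z = w₁ ∧ x' + y' + z' = w₂ ∧ x - x' = l₁ + c ∧ y - y' = c - l₂ ∧ z - z' = c := by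
    rcases le_total 0 c with hc0 | hc0
    · rcases le_total 0 (c - l₂) with hc1 | hc1
      · exact ⟨w₁ - (c - l₂) - c, c - l₂, c, w₁ - (c - l₂) - c - (l₁ + c), 0, 0, by linarith,
          by linarith, by linarith, by linarith, le_rfl, le_rfl, by ring, by linarith, by ring,
          by ring, by ring⟩
      · exact ⟨w₁ - c, 0, c, w₁ - c - (l₁ + c), l₂ - c, 0, by linarith,
          by linarith, by linarith, by linarith, by linarith, le_rfl, by ring, by linarith, by ring,
          by ring, by ring⟩
    · rcases le_total 0 (l₁ + c) with hc1 | hc1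
      · exact ⟨l₁ + c, w₂ + c + (c - l₂), 0, 0, w₂ + c, -c, by linarith,
          by linarith, by linarith, by linarith, by linarith, by linarith, by linarith,
          by linarith, by ring, by ring, by ring⟩
      · exact ⟨0, w₂ + c + (l₁ + c) + (c - l₂), 0, -(l₁ + c), w₂ + c + (l₁ + c), -c, by linarith,
          by linarith, by linarith, by linarith, by linarith, by linarith, by linarith,
          by linarith, by ring, by ring, by ring⟩
  obtain ⟨x, y, z, x', y', z', k1, k2, k3, k4, k5, k6, e1, e2, e3, e4, e5⟩ := key
  have hnn : ∀ a b c : ℝ, 0 ≤ a → 0 ≤ b → 0 ≤ c → ∀ m, 0 ≤ ![a, b, c] m :=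
    fun a b c ha hb hc m => by fin_cases m <;> assumption
  fin_cases i <;> fin_cases j <;> first | exact absurd rfl hij | skip
  · exact ⟨![x, y, z], ![x', y', z'], hnn _ _ _ k1 k2 k3, hnn _ _ _ k4 k5 k6,
      by simp; linarith, by simp; linarith, by simp [hexFst]; linarith,
      by simp [hexSnd]; linarith⟩
  · exact ⟨![x, z, y], ![x', z', y'], hnn _ _ _ k1 k3 k2, hnn _ _ _ k4 k6 k5,
      by simp; linarith, by simp; linarith, by simp [hexFst]; linarith,
      by simp [hexSnd]; linarith⟩
  · exact ⟨![y, x, z], ![y', x', z'], hnn _ _ _ k2 k1 k3, hnn _ _ _ k5 k4 k6,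
      by simp; linarith, by simp; linarith, by simp [hexFst]; linarith,
      by simp [hexSnd]; linarith⟩
  · exact ⟨![z, x, y], ![z', x', y'], hnn _ _ _ k3 k1 k2, hnn _ _ _ k6 k4 k5,
      by simp; linarith, by simp; linarith, by simp [hexFst]; linarith,
      by simp [hexSnd]; linarith⟩
  · exact ⟨![y, z, x], ![y', z', x'], hnn _ _ _ k2 k3 k1, hnn _ _ _ k5 k6 k4,
      by simp; linarith, by simp; linarith, by simp [hexFst]; linarith,
      by simp [hexSnd]; linarith⟩
  · exact ⟨![z, y, x], ![z', y', x'], hnn _ _ _ k3 k2 k1, hnn _ _ _ k6 k5 k4,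
      by simp; linarith, by simp; linarith, by simp [hexFst]; linarith,
      by simp [hexSnd]; linarith⟩

/-- The element with coordinates `(a₀, a₁, b₀, b₁)` in the basis `(1, u, j, uj)`. -/
def combo (u j : ℍ[ℝ]) (a₀ a₁ b₀ b₁ : ℝ) : ℍ[ℝ] :=
  a₀ • (1 : ℍ[ℝ]) + a₁ • u + b₀ • j + b₁ • (u * j)

section

variable {R : Subring ℍ[ℝ]} {u j x : ℍ[ℝ]}

theorem combo_eq (a₀ a₁ b₀ b₁ : ℝ) : combo u j a₀ a₁ b₀ b₁ =
    ∑ i, ![a₀, a₁, b₀, b₁] i • (![1, u, j, u * j] : Fin 4 → ℍ[ℝ]) i := by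
  simp only [Fin.sum_univ_four, Matrix.cons_val, combo]

theorem combo_eq_coe (a₀ a₁ b₀ b₁ : ℝ) : combo u j a₀ a₁ b₀ b₁ =
    (a₀ : ℍ[ℝ]) + a₁ • u + b₀ • j + b₁ • (u * j) := by
  rw [show (a₀ : ℍ[ℝ]) = a₀ • (1 : ℍ[ℝ]) by rw [← Quaternion.coe_mul_eq_smul, mul_one], combo]

theorem combo_mem (h : HasIntegralBasis R ![1, u, j, u * j]) (a₀ a₁ b₀ b₁ : ℤ) :
    combo u j a₀ a₁ b₀ b₁ ∈ R := by
  rw [combo_eq_coe]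
  exact R.add_mem (R.add_mem (add_smul_mem (h.basis_mem 1) _ _) (smul_mem_of_mem _ (h.basis_mem 2)))
    (smul_mem_of_mem _ (h.basis_mem 3))

theorem exists_int_of_combo_mem (h : HasIntegralBasis R ![1, u, j, u * j]) {a₀ a₁ b₀ b₁ : ℝ}
    (hx : combo u j a₀ a₁ b₀ b₁ ∈ R) :
    (∃ k : ℤ, a₀ = k) ∧ (∃ k : ℤ, a₁ = k) ∧ (∃ k : ℤ, b₀ = k) ∧ (∃ k : ℤ, b₁ = k) := by
  obtain ⟨c, hc⟩ := (h.mem _).mp hx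
  rw [combo_eq, ← sub_eq_zero, ← Finset.sum_sub_distrib] at hc
  simp only [← sub_smul] at hc
  have h0 := Fintype.linearIndependent_iff.mp h.li _ hc
  exact ⟨⟨c 0, sub_eq_zero.mp (h0 0)⟩, ⟨c 1, sub_eq_zero.mp (h0 1)⟩, ⟨c 2, sub_eq_zero.mp (h0 2)⟩,
    ⟨c 3, sub_eq_zero.mp (h0 3)⟩⟩

theorem exists_combo_eq (h : HasIntegralBasis R ![1, u, j, u * j]) (x : ℍ[ℝ]) :
    ∃ a₀ a₁ b₀ b₁ : ℝ, x = combo u j a₀ a₁ b₀ b₁ := by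
  obtain ⟨c, rfl⟩ := h.exists_real_coords x
  refine ⟨c 0, c 1, c 2, c 3, ?_⟩
  rw [combo_eq]
  refine Finset.sum_congr rfl fun i _ => ?_
  fin_cases i <;> rfl

theorem smul_combo (N a₀ a₁ b₀ b₁ : ℝ) :
    N • combo u j a₀ a₁ b₀ b₁ = combo u j (N * a₀) (N * a₁) (N * b₀) (N * b₁) := by
  simp only [combo, smul_add, smul_smul]

theorem sum_smul_combo {ι : Type} [Fintype ι] (μ a₀ a₁ b₀ b₁ : ι → ℝ) :
    ∑ i, μ i • combo u j (a₀ i) (a₁ i) (b₀ i) (b₁ i) =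
      combo u j (∑ i, μ i * a₀ i) (∑ i, μ i * a₁ i) (∑ i, μ i * b₀ i) (∑ i, μ i * b₁ i) := by
  simp only [combo, smul_add, smul_smul, Finset.sum_add_distrib, Finset.sum_smul]

/-- The lattice is an orthogonal sum of two hexagonal lattices. The product of two triangles has
variance at most 1/3 + 1/3. -/
theorem hasSimplex_of_orthogonal (h : HasIntegralBasis R ![1, u, j, u * j]) (hn : normSq u = 1)
    (ht : tr u = -1) (hm : normSq j = 1) (h1 : tr j = 0) (h2 : tr (u * star j) = 0)
    (x : ℍ[ℝ]) : HasSimplex R x := by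
  obtain ⟨a₀, a₁, b₀, b₁, rfl⟩ := exists_combo_eq h x
  have hnorm : ∀ a₀ a₁ b₀ b₁ : ℝ, normSq (combo u j a₀ a₁ b₀ b₁) =
      (a₀ ^ 2 - a₀ * a₁ + a₁ ^ 2) + (b₀ ^ 2 - b₀ * b₁ + b₁ ^ 2) := fun a₀ a₁ b₀ b₁ => by
    rw [combo_eq_coe, normSq_pair, hn, ht, hm, h1, h2]; ring
  obtain ⟨A, A', l, hl⟩ := HexTriangle.exists_of_color a₀ a₁ 0
  obtain ⟨B, B', w, hw⟩ := HexTriangle.exists_of_color b₀ b₁ 0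
  have hQ : ∑ i : Fin 3 × Fin 3, l i.1 * w i.2 *
      normSq (combo u j (A i.1) (A' i.1) (B i.2) (B' i.2)) =
        (l 0 * (A 0 ^ 2 - A 0 * A' 0 + A' 0 ^ 2) + l 1 * (A 1 ^ 2 - A 1 * A' 1 + A' 1 ^ 2)
          + l 2 * (A 2 ^ 2 - A 2 * A' 2 + A' 2 ^ 2)) +
        (w 0 * (B 0 ^ 2 - B 0 * B' 0 + B' 0 ^ 2) + w 1 * (B 1 ^ 2 - B 1 * B' 1 + B' 1 ^ 2)
          + w 2 * (B 2 ^ 2 - B 2 * B' 2 + B' 2 ^ 2)) := by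
    simp only [hnorm, Fintype.sum_prod_type, Fin.sum_univ_three]
    have e1 := hl.sum
    have e2 := hw.sum
    linear_combination (l 0 * (A 0 ^ 2 - A 0 * A' 0 + A' 0 ^ 2) + l 1 * (A 1 ^ 2 - A 1 * A' 1 + A' 1 ^ 2)
          + l 2 * (A 2 ^ 2 - A 2 * A' 2 + A' 2 ^ 2)) * e2 +
        (w 0 * (B 0 ^ 2 - B 0 * B' 0 + B' 0 ^ 2) + w 1 * (B 1 ^ 2 - B 1 * B' 1 + B' 1 ^ 2)
          + w 2 * (B 2 ^ 2 - B 2 * B' 2 + B' 2 ^ 2)) * e1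
  refine ⟨Fin 3 × Fin 3, inferInstance, fun i => combo u j (A i.1) (A' i.1) (B i.2) (B' i.2),
    fun i => l i.1 * w i.2, fun i => combo_mem h _ _ _ _,
    fun i => mul_nonneg (hl.nonneg _) (hw.nonneg _), ?_, ?_, ?_, ?_⟩
  · simp only [Fintype.sum_prod_type, Fin.sum_univ_three]
    linear_combination (w 0 + w 1 + w 2) * hl.sum + hw.sum
  · rw [sum_smul_combo]
    simp only [Fintype.sum_prod_type, Fin.sum_univ_three]
    have e1 := hl.sum
    have e2 := hw.sum
    congr 1
    · rw [← hl.fst]; linear_combination (l 0 * A 0 + l 1 * A 1 + l 2 * A 2) * e2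
    · rw [← hl.snd]; linear_combination (l 0 * A' 0 + l 1 * A' 1 + l 2 * A' 2) * e2
    · rw [← hw.fst]; linear_combination (w 0 * B 0 + w 1 * B 1 + w 2 * B 2) * e1
    · rw [← hw.snd]; linear_combination (w 0 * B' 0 + w 1 * B' 1 + w 2 * B' 2) * e1
  · rw [hQ, hnorm]
    have := hl.sum_hex_sub
    have := hw.sum_hex_sub
    linarith
  · intro N hN
    rw [smul_combo] at hN
    obtain ⟨k0, k1, k2, k3⟩ := exists_int_of_combo_mem h hN
    choose s hs using hl.integral N k0 k1
    choose t ht using hw.integral N k2 k3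
    rw [hQ]
    refine ⟨(s 0 * (A 0 ^ 2 - A 0 * A' 0 + A' 0 ^ 2) + s 1 * (A 1 ^ 2 - A 1 * A' 1 + A' 1 ^ 2)
          + s 2 * (A 2 ^ 2 - A 2 * A' 2 + A' 2 ^ 2)) +
        (t 0 * (B 0 ^ 2 - B 0 * B' 0 + B' 0 ^ 2) + t 1 * (B 1 ^ 2 - B 1 * B' 1 + B' 1 ^ 2)
          + t 2 * (B 2 ^ 2 - B 2 * B' 2 + B' 2 ^ 2)), ?_⟩
    push_cast
    rw [← hs, ← hs, ← hs, ← ht, ← ht, ← ht]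
    ring

/-- The point with hexagonal coordinates `(X, Y)` and `(b₀, b₁)`. -/
def hexCombo (u j : ℍ[ℝ]) (X Y b₀ b₁ : ℝ) : ℍ[ℝ] :=
  combo u j ((2 * (Y - b₁) - (X - b₀)) / 3) (((Y - b₁) - 2 * (X - b₀)) / 3) b₀ b₁

theorem hexCombo_mem (h : HasIntegralBasis R ![1, u, j, u * j]) {X Y b₀ b₁ : ℤ}
    (hc : (3 : ℤ) ∣ X + Y - b₀ - b₁) : hexCombo u j X Y b₀ b₁ ∈ R := by
  obtain ⟨k, hk⟩ := hc
  have hk' : (X : ℝ) + Y - b₀ - b₁ = 3 * k := by exact_mod_cast hk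
  have e1 : (2 * ((Y : ℝ) - b₁) - (X - b₀)) / 3 = ((2 * k - (X - b₀) : ℤ) : ℝ) := by
    push_cast; linarith
  have e2 : (((Y : ℝ) - b₁) - 2 * (X - b₀)) / 3 = ((k - (X - b₀) : ℤ) : ℝ) := by
    push_cast; linarith
  rw [hexCombo, e1, e2]
  exact combo_mem h _ _ _ _

theorem hexCombo_add (X Y b₀ b₁ X' Y' b₀' b₁' : ℝ) :
    hexCombo u j X Y b₀ b₁ + hexCombo u j X' Y' b₀' b₁' =
      hexCombo u j (X + X') (Y + Y') (b₀ + b₀') (b₁ + b₁') := by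
  simp only [hexCombo, combo]
  module

theorem sum_smul_hexCombo {ι : Type} [Fintype ι] (μ X Y b₀ b₁ : ι → ℝ) :
    ∑ i, μ i • hexCombo u j (X i) (Y i) (b₀ i) (b₁ i) =
      hexCombo u j (∑ i, μ i * X i) (∑ i, μ i * Y i) (∑ i, μ i * b₀ i) (∑ i, μ i * b₁ i) := by
  simp only [hexCombo, sum_smul_combo]
  congr 1 <;> rw [eq_div_iff (by norm_num), Finset.sum_mul] <;>
    simp only [← Finset.sum_sub_distrib, Finset.mul_sum, ← mul_sub] <;>
    refine Finset.sum_congr rfl fun i _ => ?_ <;> ring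

/-- With s = w₁ + w₂ the left side is at most ms - Ds²/4, whose maximum m²/D equals (D + 1)²/(9D).
-/
theorem hex_estimate {D m w₁ w₂ E : ℝ} (hD0 : 0 < D) (hD1 : (D + 1) ^ 2 < 9 * D)
    (hm : D + 1 = 3 * m) (hE : 0 ≤ E) :
    m * (w₁ + w₂) - (E + D * (w₁ ^ 2 + w₁ * w₂ + w₂ ^ 2)) / 3 < 1 := by
  have e6 : 3 * (w₁ + w₂) ^ 2 ≤ 4 * (w₁ ^ 2 + w₁ * w₂ + w₂ ^ 2) := by
    nlinarith [sq_nonneg (w₁ - w₂)]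
  have e7 : 4 * D * (3 * m * (w₁ + w₂)) ≤
      3 * (D * (w₁ + w₂)) ^ 2 + 4 * (D + 1) ^ 2 / 3 := by
    rw [← hm]; nlinarith [sq_nonneg (3 * D * (w₁ + w₂) - 2 * (D + 1))]
  have e8 : 3 * (D * (w₁ + w₂)) ^ 2 ≤ 4 * D * (D * (w₁ ^ 2 + w₁ * w₂ + w₂ ^ 2)) := by
    have := mul_le_mul_of_nonneg_left e6 (sq_nonneg D)
    linarith
  have e9 : 4 * D * (3 * m * (w₁ + w₂)) <
      4 * D * (3 + D * (w₁ ^ 2 + w₁ * w₂ + w₂ ^ 2)) := by linarith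
  have e10 := lt_of_mul_lt_mul_left e9 (by positivity)
  linarith

-- The lattice consists of pairs of hexagonal points of equal colour, so the vertices of two
-- triangles can be combined only along colours, while the colour weights l and w need not agree.
-- The second triangle keeps its weights w. At colour 0 its vertex is paired with the vertex `A 0`;
-- at colours 1 and 2 it is paired with the three neighbours of `A 0` of that colour, with weights
-- chosen to give the right barycentre. This needs l - w to be largest at colour 0. Relative to the
-- base vertex, the points have norm 0 or (1 + D)/3 = m, so the variance is controlled by
-- `hex_estimate`.
set_option maxHeartbeats 1000000 in
theorem hasSimplex_hexCombo (h : HasIntegralBasis R ![1, u, j, u * j]) {D : ℝ} {m : ℤ}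
    (hD0 : 0 < D) (hD1 : (D + 1) ^ 2 < 9 * D) (hm : D + 1 = 3 * m)
    (hnorm : ∀ X Y b₀ b₁ : ℝ, normSq (hexCombo u j X Y b₀ b₁) =
      ((X ^ 2 - X * Y + Y ^ 2) + D * (b₀ ^ 2 - b₀ * b₁ + b₁ ^ 2)) / 3)
    {X Y b₀ b₁ : ℝ} {c : ℤ} {A A' B B' : Fin 3 → ℤ} {l w : Fin 3 → ℝ}
    (hl : HexTriangle X Y c A A' l) (hw : HexTriangle b₀ b₁ c B B' w)
    (h1 : l 1 - w 1 ≤ l 0 - w 0) (h2 : l 2 - w 2 ≤ l 0 - w 0) :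
    HasSimplex R (hexCombo u j X Y b₀ b₁) := by
  have hA0 := hl.color 0
  have hB0 := hw.color 0
  have hA1 := hl.color 1
  have hB1 := hw.color 1
  have hA2 := hl.color 2
  have hB2 := hw.color 2
  simp only [Fin.val_zero, Fin.val_one, Fin.val_two, Nat.cast_zero, Nat.cast_one,
    Nat.cast_ofNat] at hA0 hB0 hA1 hB1 hA2 hB2
  have hsl := hl.sum
  have hsw := hw.sum
  obtain ⟨i, hi, hi'⟩ := exists_hex_of_color (hl.side 1 0 (by decide)) (by omega)
  obtain ⟨k, hk, hk'⟩ := exists_hex_of_color (hl.side 0 2 (by decide)) (by omega)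
  obtain ⟨f, hf, hf'⟩ := exists_hex_of_color (hw.side 1 0 (by decide)) (by omega)
  obtain ⟨g, hg, hg'⟩ := exists_hex_of_color (hw.side 0 2 (by decide)) (by omega)
  -- Otherwise the side from `A 2` to `A 1` would be twice a unit vector.
  have hik : i ≠ k := by
    rintro rfl
    have e := hl.side 1 2 (by decide)
    rw [show A 1 - A 2 = 2 * hexFst i by omega, show A' 1 - A' 2 = 2 * hexSnd i by omega] at e
    have : (2 : ℤ) ∣ 1 := ⟨2 * (hexFst i ^ 2 - hexFst i * hexSnd i + hexSnd i ^ 2), by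
      rw [← e]; ring⟩
    omega
  obtain ⟨p, q, hp, hq, hpw, hqw, hpq, hpq'⟩ := exists_hex_weights (hl.nonneg 1) (hl.nonneg 2)
    (hw.nonneg 1) (hw.nonneg 2) (by linarith) (by linarith) hik
  have hfR : ((B 1 - B 0 : ℤ) : ℝ) = hexFst f := by rw [hf]
  have hgR : ((B 0 - B 2 : ℤ) : ℝ) = hexFst g := by rw [hg]
  have hfR' : ((B' 1 - B' 0 : ℤ) : ℝ) = hexSnd f := by rw [hf']
  have hgR' : ((B' 0 - B' 2 : ℤ) : ℝ) = hexSnd g := by rw [hg']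
  have hiR : ((A 1 - A 0 : ℤ) : ℝ) = hexFst i := by rw [hi]
  have hkR : ((A 0 - A 2 : ℤ) : ℝ) = hexFst k := by rw [hk]
  have hiR' : ((A' 1 - A' 0 : ℤ) : ℝ) = hexSnd i := by rw [hi']
  have hkR' : ((A' 0 - A' 2 : ℤ) : ℝ) = hexSnd k := by rw [hk']
  push_cast at hfR hgR hfR' hgR' hiR hkR hiR' hkR'
  have hX : X = A 0 + ((p 0 - q 0) - (p 2 - q 2)) := by
    rw [hpq, ← hl.fst, ← hiR, ← hkR]; linear_combination (A 0 : ℝ) * hsl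
  have hY : Y = A' 0 + ((p 1 - q 1) - (p 2 - q 2)) := by
    rw [hpq', ← hl.snd, ← hiR', ← hkR']; linear_combination (A' 0 : ℝ) * hsl
  have hb₀ : b₀ = B 0 + (w 1 * hexFst f - w 2 * hexFst g) := by
    rw [← hw.fst, ← hfR, ← hgR]; linear_combination (B 0 : ℝ) * hsw
  have hb₁ : b₁ = B' 0 + (w 1 * hexSnd f - w 2 * hexSnd g) := by
    rw [← hw.snd, ← hfR', ← hgR']; linear_combination (B' 0 : ℝ) * hsw
  have hNw : ∀ N : ℤ, (N : ℝ) • hexCombo u j X Y b₀ b₁ ∈ R →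
      (∃ t : ℤ, N * w 1 = t) ∧ ∃ t : ℤ, N * w 2 = t := fun N hN => by
    rw [hexCombo, smul_combo] at hN
    obtain ⟨-, -, k2, k3⟩ := exists_int_of_combo_mem h hN
    exact ⟨hw.integral N k2 k3 1, hw.integral N k2 k3 2⟩
  have hbase : hexCombo u j (A 0) (A' 0) (B 0) (B' 0) ∈ R := hexCombo_mem h (by omega)
  have hhex : ∀ m, ((hexFst m : ℝ) ^ 2 - hexFst m * hexSnd m + hexSnd m ^ 2) = 1 := fun m => by
    fin_cases m <;> simp [hexFst, hexSnd]
  have hcol : ∀ m, (3 : ℤ) ∣ hexFst m + hexSnd m - 1 := fun m => by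
    fin_cases m <;> simp [hexFst, hexSnd]
  rw [hX, hY, hb₀, hb₁, ← hexCombo_add]
  refine HasSimplex.add_mem h ?_ hbase
  have hN' : ∀ N : ℤ, (N : ℝ) • hexCombo u j ((p 0 - q 0) - (p 2 - q 2))
      ((p 1 - q 1) - (p 2 - q 2)) (w 1 * hexFst f - w 2 * hexFst g)
      (w 1 * hexSnd f - w 2 * hexSnd g) ∈ R →
      (∃ t : ℤ, N * w 1 = t) ∧ ∃ t : ℤ, N * w 2 = t := fun N hN => hNw N (by
    rw [hX, hY, hb₀, hb₁, ← hexCombo_add, smul_add]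
    exact R.add_mem (smul_mem_of_mem N hbase) hN)
  -- The seven points relative to the base vertex: the origin, three points of colour 1 over the
  -- direction f, and three of colour 2 over the direction -g.
  let μ : Unit ⊕ Fin 3 ⊕ Fin 3 → ℝ := Sum.elim (fun _ => w 0) (Sum.elim p q)
  let P : Unit ⊕ Fin 3 ⊕ Fin 3 → ℤ := Sum.elim (fun _ => 0) (Sum.elim hexFst (fun m => -hexFst m))
  let P' : Unit ⊕ Fin 3 ⊕ Fin 3 → ℤ := Sum.elim (fun _ => 0) (Sum.elim hexSnd (fun m => -hexSnd m))
  let S : Unit ⊕ Fin 3 ⊕ Fin 3 → ℤ :=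
    Sum.elim (fun _ => 0) (Sum.elim (fun _ => hexFst f) (fun _ => -hexFst g))
  let S' : Unit ⊕ Fin 3 ⊕ Fin 3 → ℤ :=
    Sum.elim (fun _ => 0) (Sum.elim (fun _ => hexSnd f) (fun _ => -hexSnd g))
  have hval : ∀ i, μ i * normSq (hexCombo u j (P i) (P' i) (S i) (S' i)) =
      Sum.elim (fun _ => (0 : ℝ)) (Sum.elim (fun i => m * p i) (fun i => m * q i)) i := by
    rintro (i | i | i)
    · simp [hnorm, P, P', S, S']
    · simp only [hnorm, P, P', S, S', μ, Sum.elim_inr, Sum.elim_inl]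
      rw [hhex, hhex]; linear_combination p i / 3 * hm
    · simp only [hnorm, P, P', S, S', μ, Sum.elim_inr]
      push_cast
      have e1 := hhex i
      have e2 := hhex g
      linear_combination q i / 3 * hm + q i / 3 * e1 + q i * D / 3 * e2
  have hQ : ∑ i, μ i * normSq (hexCombo u j (P i) (P' i) (S i) (S' i)) = m * (w 1 + w 2) := by
    simp only [hval, Fintype.sum_sum_type, Sum.elim_inr, Sum.elim_inl, Fin.sum_univ_three]
    rw [← hpw, ← hqw]; simp; ring
  refine ⟨Unit ⊕ Fin 3 ⊕ Fin 3, inferInstance,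
    fun i => hexCombo u j (P i) (P' i) (S i) (S' i), μ, ?_, ?_, ?_, ?_, ?_, ?_⟩
  · rintro (i | i | i)
    · exact hexCombo_mem h (by simp [P, P', S, S'])
    · exact hexCombo_mem h (by
        have := hcol i
        have := hcol f
        simp only [P, P', S, S', Sum.elim_inr, Sum.elim_inl]; omega)
    · exact hexCombo_mem h (by
        have := hcol i
        have := hcol g
        simp only [P, P', S, S', Sum.elim_inr]; omega)
  · rintro (i | i | i)
    exacts [hw.nonneg 0, hp i, hq i]
  · simp only [μ, Fintype.sum_sum_type, Sum.elim_inr, Sum.elim_inl, Fin.sum_univ_three]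
    simp; linarith
  · rw [sum_smul_hexCombo]
    simp only [μ, P, P', S, S', Fintype.sum_sum_type, Sum.elim_inr, Sum.elim_inl,
      Fin.sum_univ_three]
    rw [← hpw, ← hqw]
    congr 1
    · simp [hexFst]; ring
    · simp [hexSnd]; ring
    · simp; ring
    · simp; ring
  · rw [hQ, hnorm]
    have e1 := hhex f
    have e2 := hhex g
    have e3 : ((hexFst f : ℝ) + hexFst g) ^ 2 - (hexFst f + hexFst g) * (hexSnd f + hexSnd g)
        + (hexSnd f + hexSnd g) ^ 2 = 1 := by
      rw [← hfR, ← hgR, ← hfR', ← hgR']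
      have e := hw.side 1 2 (by decide)
      have e' : ((B 1 - B 2 : ℝ)) ^ 2 - (B 1 - B 2) * (B' 1 - B' 2) + (B' 1 - B' 2) ^ 2 = 1 := by
        exact_mod_cast e
      linear_combination e'
    have e4 : (w 1 * (hexFst f : ℝ) - w 2 * hexFst g) ^ 2 -
        (w 1 * (hexFst f : ℝ) - w 2 * hexFst g) * (w 1 * (hexSnd f : ℝ) - w 2 * hexSnd g) +
        (w 1 * (hexSnd f : ℝ) - w 2 * hexSnd g) ^ 2 = w 1 ^ 2 + w 1 * w 2 + w 2 ^ 2 := by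
      linear_combination (w 1 ^ 2 + w 1 * w 2) * e1 + (w 2 ^ 2 + w 1 * w 2) * e2
        - (w 1 * w 2) * e3
    rw [e4]
    set X' := p 0 - q 0 - (p 2 - q 2)
    set Y' := p 1 - q 1 - (p 2 - q 2)
    have e5 : 0 ≤ X' ^ 2 - X' * Y' + Y' ^ 2 := by
      nlinarith [sq_nonneg (X' - Y'), sq_nonneg X', sq_nonneg Y']
    exact hex_estimate hD0 hD1 hm e5
  · intro N hN
    obtain ⟨⟨s, hs⟩, t, ht⟩ := hN' N hN
    refine ⟨m * (s + t), ?_⟩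
    rw [hQ]
    push_cast
    rw [← hs, ← ht]; ring

theorem hasSimplex_of_skew (h : HasIntegralBasis R ![1, u, j, u * j]) (hn : normSq u = 1)
    (ht : tr u = -1) {m : ℤ} (hm : normSq j = m) (hm1 : m = 1 ∨ m = 2) (h1 : tr j = 0)
    (h2 : tr (u * star j) = -1) (x : ℍ[ℝ]) : HasSimplex R x := by
  have hnorm : ∀ X Y b₀ b₁ : ℝ, normSq (hexCombo u j X Y b₀ b₁) =
      ((X ^ 2 - X * Y + Y ^ 2) + (3 * m - 1) * (b₀ ^ 2 - b₀ * b₁ + b₁ ^ 2)) / 3 :=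
    fun X Y b₀ b₁ => by
      rw [hexCombo, combo_eq_coe, normSq_pair, hn, ht, hm, h1, h2]; ring
  obtain ⟨a₀, a₁, b₀, b₁, rfl⟩ := exists_combo_eq h x
  have hx : combo u j a₀ a₁ b₀ b₁ = hexCombo u j (a₀ - 2 * a₁ + b₀) (2 * a₀ - a₁ + b₁) b₀ b₁ := by
    rw [hexCombo]; congr 1 <;> ring
  rw [hx]
  have main := fun {X Y b₀ b₁ : ℝ} {c : ℤ} {A A' B B' : Fin 3 → ℤ} {l w : Fin 3 → ℝ} =>
    hasSimplex_hexCombo (X := X) (Y := Y) (b₀ := b₀) (b₁ := b₁) (c := c) (A := A) (A' := A')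
      (B := B) (B' := B') (l := l) (w := w) h (D := 3 * m - 1) (m := m)
      (by rcases hm1 with rfl | rfl <;> norm_num) (by rcases hm1 with rfl | rfl <;> norm_num)
      (by ring) hnorm
  obtain ⟨A, A', l, hl⟩ := HexTriangle.exists_of_color (a₀ - 2 * a₁ + b₀) (2 * a₀ - a₁ + b₁) 0
  obtain ⟨B, B', w, hw⟩ := HexTriangle.exists_of_color b₀ b₁ 0
  -- Relabelling both triangles cyclically moves the colour with the largest l - w to position 0.
  rcases le_total (l 0 - w 0) (l 1 - w 1) with h01 | h01
  · rcases le_total (l 1 - w 1) (l 2 - w 2) with h12 | h12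
    · exact main hl.rotate.rotate hw.rotate.rotate (h01.trans h12) h12
    · exact main hl.rotate hw.rotate h12 h01
  · rcases le_total (l 0 - w 0) (l 2 - w 2) with h02 | h02
    · exact main hl.rotate.rotate hw.rotate.rotate h02 (h01.trans h02)
    · exact main hl hw h01 h02

end

/-- In the normal form 3m - δ, the value 3 occurs only for m = 1, δ = 0, and the values 2 and 5 only
for δ = 1 with m = 1 and m = 2. -/
theorem HasIntegralBasis.hasSimplex {R : Subring ℍ[ℝ]} {e : Fin 4 → ℍ[ℝ]}
    (h : HasIntegralBasis R e) (hd : h.disc.natAbs ∈ ({2, 3, 5} : Set ℕ)) (x : ℍ[ℝ]) :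
    HasSimplex R x := by
  obtain ⟨u, hu, hn, ht⟩ := h.exists_third_root hd
  obtain ⟨j, m, δ, hj, hm, hm1, h1, h2, h3, h4⟩ := h.exists_normalForm_three hu hn ht
  have hB := h.of_isGenerator hu ⟨hn, Or.inr ht⟩ hj
  simp only [Set.mem_insert_iff, Set.mem_singleton_iff] at hd
  rcases h3 with rfl | rfl
  · obtain rfl : m = 1 := by omega
    exact hasSimplex_of_orthogonal hB hn ht (by simpa using hm) h1 (by simpa using h2) x
  · exact hasSimplex_of_skew hB hn ht hm (by omega) h1 (by simpa using h2) x

/-! ### The Dieudonné determinant and the action on the upper half-space -/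

section

variable (a b c d u v z x y t : ℍ[ℝ]) (r : ℝ)

/-- The square of the Dieudonné determinant. -/
def sqDet : ℝ := normSq (a * d) + normSq (b * c) - tr (a * star c * d * star b)

theorem tr_conj_mul : tr (a * x * star a) = normSq a * tr x := by
  rw [tr_mul_comm, ← mul_assoc, Quaternion.star_mul_self, Quaternion.coe_mul_eq_smul, tr_smul]

theorem mul_star_self_mul : x * (star a * (a * y)) = normSq a • (x * y) := by
  rw [← mul_assoc (star a), Quaternion.star_mul_self, Quaternion.coe_mul_eq_smul, mul_smul_comm]

theorem mul_self_star_mul : x * (a * (star a * y)) = normSq a • (x * y) := by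
  rw [← mul_assoc a, Quaternion.self_mul_star, Quaternion.coe_mul_eq_smul, mul_smul_comm]

theorem tr_neg : tr (-x) = -tr x := by simp [tr]

theorem tr_coe : tr ((r : ℝ) : ℍ[ℝ]) = 2 * r := by simp [tr]

theorem sqDet_col : sqDet a (a * z + b) c (c * z + d) = sqDet a b c d := by
  have e1 : tr (a * star c * (c * z + d) * star (a * z + b)) =
      normSq c * (2 * (normSq a * normSq z)) + normSq c * tr (a * z * star b)
        + normSq a * tr (star c * d * star z) + tr (a * star c * d * star b) := by
    have h1 : a * star c * (c * z + d) * star (a * z + b) =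
        normSq c • (a * (z * star z) * star a) + normSq c • (a * z * star b)
          + a * (star c * d * star z) * star a + a * star c * d * star b := by
      rw [star_add, star_mul, mul_add, mul_add, add_mul, add_mul]
      rw [mul_assoc a (star c), ← mul_assoc (star c) c z, Quaternion.star_mul_self,
        Quaternion.coe_mul_eq_smul]
      simp only [mul_smul_comm, smul_mul_assoc, mul_assoc]
      abel
    rw [h1, tr_add, tr_add, tr_add, tr_smul, tr_smul, tr_conj_mul, tr_conj_mul,
      Quaternion.self_mul_star, tr_coe]
    ring
  have e2 : tr (c * z * star d) = tr (star c * d * star z) := by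
    rw [← tr_star (x := c * z * star d)]
    simp only [star_mul, star_star]
    rw [← mul_assoc, tr_mul_comm, mul_assoc]
  rw [sqDet, sqDet, e1]
  simp only [map_mul, normSq_add_eq, e2]
  ring

theorem sqDet_swap : sqDet c d a b = sqDet a b c d := by
  have e : tr (c * star a * b * star d) = tr (a * star c * d * star b) := by
    rw [← tr_star (x := c * star a * b * star d)]
    simp only [star_mul, star_star]
    rw [tr_mul_comm, mul_assoc, mul_assoc, mul_assoc, tr_mul_comm]
    simp only [mul_assoc]
  rw [sqDet, sqDet, e]
  simp only [map_mul]
  ring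

theorem tr_cycle : tr (a * star c * d * star b) = tr (star c * d * star b * a) := by
  rw [mul_assoc, mul_assoc, tr_mul_comm]; simp only [mul_assoc]

theorem sqDet_row : sqDet (a + t * c) (b + t * d) c d = sqDet a b c d := by
  have e1 : tr ((a + t * c) * star c * d * star (b + t * d)) =
      tr (a * star c * d * star b) + normSq d * tr (a * star c * star t)
        + normSq c * tr (t * d * star b) + normSq c * normSq d * (2 * normSq t) := by
    have h1 : (a + t * c) * star c * d * star (b + t * d) =
        a * star c * d * star b + normSq d • (a * star c * star t)
          + normSq c • (t * d * star b) + (normSq c * normSq d) • (t * star t) := by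
      rw [star_add, star_mul, add_mul, add_mul, add_mul, mul_add, mul_add]
      have h2 : t * c * star c * d * (star d * star t) =
          (normSq c * normSq d) • (t * star t) := by
        rw [mul_assoc _ d, mul_self_star_mul, mul_assoc, mul_assoc, mul_self_star_mul, smul_smul,
          mul_comm]
      have h3 : a * star c * d * (star d * star t) = normSq d • (a * star c * star t) := by
        rw [mul_assoc _ d, mul_self_star_mul]
      have h4 : t * c * star c * d * star b = normSq c • (t * d * star b) := by
        rw [mul_assoc t, mul_assoc t, mul_assoc c, mul_self_star_mul, smul_mul_assoc]
      rw [h2, h3, h4, ← add_assoc]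
    rw [h1, tr_add, tr_add, tr_add, tr_smul, tr_smul, tr_smul, Quaternion.self_mul_star, tr_coe]
  have e2 : tr (b * star (t * d)) = tr (t * d * star b) := by
    rw [← tr_star (x := b * star (t * d))]
    simp only [star_mul, star_star]
  have e3 : tr (a * star (t * c)) = tr (a * star c * star t) := by
    simp only [star_mul, mul_assoc]
  rw [sqDet, sqDet, e1]
  simp only [map_mul, normSq_add_eq, e2, e3]
  ring

/-- The square of the norm of the denominator of the homography. -/
def actDenom : ℝ := normSq (c * z + d) + r ^ 2 * normSq c

/-- The numerator of the homography. -/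
def actNum : ℍ[ℝ] := (a * z + b) * star (c * z + d) + (r ^ 2) • (a * star c)

/-- A Cauchy-Schwarz identity with remainder: when the determinant is 1 the remainder is positive,
so the denominator of the action cannot vanish. -/
theorem normSq_actNum : normSq (actNum a b c d z r) + r ^ 2 * sqDet a b c d =
    actDenom a b z r * actDenom c d z r := by
  rw [← sqDet_col a b c d z, actNum, actDenom, actDenom, sqDet, normSq_add_eq]
  have e : tr ((a * z + b) * star (c * z + d) * star ((r ^ 2) • (a * star c))) =
      r ^ 2 * tr (a * star c * (c * z + d) * star (a * z + b)) := by
    rw [Quaternion.star_smul, mul_smul_comm, tr_smul, ← tr_star]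
    congr 2
    simp only [star_mul, star_star, mul_assoc]
  rw [e]
  simp only [map_mul, Quaternion.normSq_smul, Quaternion.normSq_star]
  ring

theorem actDenom_pos {r : ℝ} (hr : 0 < r) (h : sqDet a b c d = 1) : 0 < actDenom c d z r := by
  have h1 := normSq_actNum a b c d z r
  have h2 : 0 ≤ actDenom c d z r :=
    add_nonneg Quaternion.normSq_nonneg (mul_nonneg (sq_nonneg r) Quaternion.normSq_nonneg)
  refine lt_of_le_of_ne h2 fun h0 => ?_
  rw [← h0, h, mul_zero] at h1
  have := Quaternion.normSq_nonneg (a := actNum a b c d z r)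
  nlinarith

/-- This evaluates the cross term in `formValue_equivariant`. With w = c̄ d b̄ a, the relation w =
tr(w) - w̄ reduces the only term of higher degree, and the scalars collect into the determinant. -/
theorem star_mul_aux (hdet : sqDet a b c d = 1) :
    star (normSq d • a - b * star d * c) * (normSq c • b - a * star c * d) = -(star c * d) := by
  have h2 : normSq a * normSq d + normSq b * normSq c - tr (star c * d * (star b * a)) = 1 := by
    rw [← hdet, sqDet, tr_cycle, map_mul, map_mul]; simp only [mul_assoc]
  have h3 : star c * d * (star b * a) * (star c * d) =
      tr (star c * d * (star b * a)) • (star c * d) - (normSq c * normSq d) • (star a * b) := by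
    have h4 : star c * d * (star b * a) = ((tr (star c * d * (star b * a)) : ℝ) : ℍ[ℝ]) -
        star a * b * (star d * c) := by
      have := star_eq_tr_sub (star c * d * (star b * a))
      rw [eq_sub_iff_add_eq] at this ⊢
      rw [← this]
      simp only [star_mul, star_star, mul_assoc]
      abel
    conv_lhs => rw [h4]
    rw [sub_mul, Quaternion.coe_mul_eq_smul]
    congr 1
    have h5 : star d * c * (star c * d) = ((normSq c * normSq d : ℝ) : ℍ[ℝ]) := by
      rw [show star c * d = star (star d * c) by simp, Quaternion.self_mul_star, map_mul,
        Quaternion.normSq_star, mul_comm]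
    rw [mul_assoc, h5, ← Quaternion.coe_commutes, Quaternion.coe_mul_eq_smul]
  rw [star_sub, Quaternion.star_smul]
  simp only [star_mul, star_star, sub_mul, mul_sub, smul_mul_assoc, mul_smul_comm]
  have h5 : star c * (d * star b) * (a * star c * d) = star c * d * (star b * a) * (star c * d) := by
    simp only [mul_assoc]
  have h6 : star a * (a * star c * d) = normSq a • (star c * d) := by
    rw [mul_assoc, ← mul_assoc, Quaternion.star_mul_self, Quaternion.coe_mul_eq_smul]
  have h7 : star c * (d * star b) * b = normSq b • (star c * d) := by
    rw [← mul_assoc, mul_assoc, Quaternion.star_mul_self, ← Quaternion.coe_commutes,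
      Quaternion.coe_mul_eq_smul]
  rw [h5, h3, h6, h7]
  trans -((normSq a * normSq d + normSq b * normSq c - tr (star c * d * (star b * a))) •
    (star c * d))
  · module
  · rw [h2, one_smul]

theorem normSq_aux₁ : normSq (normSq c • b - a * star c * d) = normSq c * sqDet a b c d := by
  have e : tr (b * star (a * star c * d)) = tr (a * star c * d * star b) := by
    rw [← tr_star (x := b * star (a * star c * d)), star_mul, star_star]
  rw [normSq_sub_eq, sqDet, smul_mul_assoc, tr_smul, e]
  simp only [map_mul, Quaternion.normSq_smul, Quaternion.normSq_star]
  ring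

theorem normSq_aux₂ : normSq (normSq d • a - b * star d * c) = normSq d * sqDet a b c d := by
  have e : tr (a * star (b * star d * c)) = tr (a * star c * d * star b) := by
    simp only [star_mul, star_star, mul_assoc]
  rw [normSq_sub_eq, sqDet, smul_mul_assoc, tr_smul, e]
  simp only [map_mul, Quaternion.normSq_smul, Quaternion.normSq_star]
  ring

/-- The value at the vector `(u, v)` of the Hermitian form attached to the point `(z, r)`,
multiplied by `r`. -/
def formValue : ℝ := normSq (u - z * v) + r ^ 2 * normSq v

theorem formValue_equivariant (hdet : sqDet a b c d = 1) {r : ℝ} (hr : 0 < r) :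
    formValue (a * u + b * v) (c * u + d * v) ((actDenom c d z r)⁻¹ • actNum a b c d z r)
      (r / actDenom c d z r) = (actDenom c d z r)⁻¹ * formValue u v z r := by
  have hQ := (actDenom_pos a b c d z hr hdet).ne'
  set Q := actDenom c d z r with hQdef
  set P := actNum a b c d z r with hP
  set s := u - z * v with hs
  have hu : u = z * v + s := by rw [hs]; abel
  set α := a * z + b with hα
  set β := c * z + d with hβ
  have hdet' : sqDet a α c β = 1 := by rw [hα, hβ, sqDet_col, hdet]
  have hU : a * u + b * v = α * v + a * s := by rw [hu, hα]; noncomm_ring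
  have hV : c * u + d * v = β * v + c * s := by rw [hu, hβ]; noncomm_ring
  have hQ' : Q = normSq β + r ^ 2 * normSq c := rfl
  have hP' : P = α * star β + (r ^ 2) • (a * star c) := rfl
  -- The columns are translated so that z becomes 0. This leaves the determinant unchanged and
  -- splits the numerator into a part along v and a part along s = u - zv, whose norms are known
  -- from `normSq_aux₁` and `normSq_aux₂`.
  have key : Q • (α * v + a * s) - P * (β * v + c * s) =
      (r ^ 2) • ((normSq c • α - a * star c * β) * v) + (normSq β • a - α * star β * c) * s := by
    rw [hP', hQ']
    have h1 : α * star β * (β * v) = normSq β • (α * v) := by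
      rw [mul_assoc, mul_star_self_mul]
    have h2 : a * star c * (c * s) = normSq c • (a * s) := by
      rw [mul_assoc, mul_star_self_mul]
    simp only [add_mul, mul_add, smul_mul_assoc, h1, h2, sub_mul]
    simp only [mul_assoc]
    module
  have hn : normSq (Q • (α * v + a * s) - P * (β * v + c * s)) + r ^ 2 * normSq (β * v + c * s) =
      Q * (normSq s + r ^ 2 * normSq v) := by
    rw [key, normSq_add_eq, normSq_add_eq (x := β * v)]
    have e1 : tr ((r ^ 2) • ((normSq c • α - a * star c * β) * v) *
        star ((normSq β • a - α * star β * c) * s)) = -(r ^ 2 * tr (β * v * star (c * s))) := by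
      rw [smul_mul_assoc, tr_smul, star_mul, ← mul_assoc, tr_mul_comm]
      have e2 : star (normSq β • a - α * star β * c) *
          ((normSq c • α - a * star c * β) * v * star s) = -(star c * (β * v * star s)) := by
        have h1 : ∀ M m : ℍ[ℝ], star M * m = -(star c * β) →
            star M * (m * v * star s) = -(star c * (β * v * star s)) := fun M m h => by
          rw [← mul_assoc, ← mul_assoc, h]; simp only [neg_mul, mul_assoc]
        exact h1 _ _ (star_mul_aux a α c β hdet')
      rw [e2, tr_neg, tr_mul_comm, star_mul]
      simp only [mul_assoc]
      ring
    rw [e1, map_mul, normSq_aux₂, hdet', Quaternion.normSq_smul, map_mul, normSq_aux₁, hdet', hQ']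
    simp only [map_mul]
    ring
  rw [formValue, formValue, hU, hV, ← hs]
  have h3 : α * v + a * s - Q⁻¹ • P * (β * v + c * s) =
      Q⁻¹ • (Q • (α * v + a * s) - P * (β * v + c * s)) := by
    rw [smul_sub, smul_smul, inv_mul_cancel₀ hQ, one_smul, smul_mul_assoc]
  rw [h3, Quaternion.normSq_smul]
  have h4 : normSq (Q • (α * v + a * s) - P * (β * v + c * s)) =
      Q * (normSq s + r ^ 2 * normSq v) - r ^ 2 * normSq (β * v + c * s) := by linarith
  rw [h4]
  field_simp
  ring

end

/-! ### Inverses in the Hamilton-Bianchi group -/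

theorem sqDet_inverse {a b c d : ℍ[ℝ]} (h : sqDet a b c d = 1) :
    a * (normSq d • star a - star c * d * star b) + b * (normSq c • star b - star d * c * star a)
      = 1 := by
  have h2 : a * star c * d * star b + b * star d * c * star a =
      ((tr (a * star c * d * star b) : ℝ) : ℍ[ℝ]) := by
    have := star_eq_tr_sub (a * star c * d * star b)
    rw [eq_sub_iff_add_eq] at this
    rw [← this]
    simp only [star_mul, star_star, mul_assoc]
    abel
  have h3 : a * (normSq d • star a - star c * d * star b) +
      b * (normSq c • star b - star d * c * star a) =
      ((normSq a * normSq d + normSq b * normSq c : ℝ) : ℍ[ℝ]) -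
        (a * star c * d * star b + b * star d * c * star a) := by
    rw [mul_sub, mul_sub, mul_smul_comm, mul_smul_comm, Quaternion.self_mul_star,
      Quaternion.self_mul_star, ← Quaternion.coe_mul_eq_smul, ← Quaternion.coe_mul_eq_smul,
      ← Quaternion.coe_mul, ← Quaternion.coe_mul, Quaternion.coe_add, mul_comm (normSq d),
      mul_comm (normSq c)]
    simp only [mul_assoc]
    abel
  rw [h3, h2, ← Quaternion.coe_sub]
  rw [sqDet, map_mul, map_mul] at h
  rw [h, Quaternion.coe_one]

theorem mul_inverse_off (a b c d : ℍ[ℝ]) :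
    a * (normSq b • star c - star a * b * star d) + b * (normSq a • star d - star b * a * star c)
      = 0 := by
  have h1 : a * (star a * b * star d) = normSq a • (b * star d) := by
    rw [mul_assoc, ← mul_assoc, Quaternion.self_mul_star, Quaternion.coe_mul_eq_smul]
  have h2 : b * (star b * a * star c) = normSq b • (a * star c) := by
    rw [mul_assoc, ← mul_assoc, Quaternion.self_mul_star, Quaternion.coe_mul_eq_smul]
  rw [mul_sub, mul_sub, mul_smul_comm, mul_smul_comm, h1, h2]
  abel

theorem mem_SL2_iff {A : Subalgebra ℚ ℍ[ℝ]} {O : Subring A} {g : Matrix (Fin 2) (Fin 2) ℍ[ℝ]} :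
    g ∈ SL2 O ↔ sqDet (g 0 0) (g 0 1) (g 1 0) (g 1 1) = 1 ∧ ∀ i j, g i j ∈ image O := by
  have h1 : dieudonneDet g = Real.sqrt (sqDet (g 0 0) (g 0 1) (g 1 0) (g 1 1)) := rfl
  rw [SL2, Set.mem_ofPred_eq, h1, Real.sqrt_eq_one]
  simp only [mem_image]

theorem act_eq (g : Matrix (Fin 2) (Fin 2) ℍ[ℝ]) (x : ℍ[ℝ] × ℝ) :
    act g x = ((actDenom (g 1 0) (g 1 1) x.1 x.2)⁻¹ •
      actNum (g 0 0) (g 0 1) (g 1 0) (g 1 1) x.1 x.2, x.2 / actDenom (g 1 0) (g 1 1) x.1 x.2) := rfl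

section

variable {A : Subalgebra ℚ ℍ[ℝ]} {O : Subring A} {R : Subring ℍ[ℝ]} {e : Fin 4 → ℍ[ℝ]}

/-- The inverse is given by explicit polynomials in the entries, their conjugates and their norms,
so it stays in the order. -/
theorem exists_inverse (h : HasIntegralBasis (image O) e) {g : Matrix (Fin 2) (Fin 2) ℍ[ℝ]}
    (hg : g ∈ SL2 O) : ∃ g' : Matrix (Fin 2) (Fin 2) ℍ[ℝ], (∀ i j, g' i j ∈ image O) ∧
      g * g' = 1 ∧ g' * g = 1 := by
  obtain ⟨hdet, hm⟩ := mem_SL2_iff.mp hg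
  have hs := fun i j => h.star_mem (hm i j)
  have hsm : ∀ x ∈ image O, ∀ y ∈ image O, normSq x • y ∈ image O := fun x hx y hy => by
    obtain ⟨k, hk⟩ := h.exists_normSq_eq hx
    rw [hk]
    exact smul_mem_of_mem k hy
  have key : ∀ i j k l, normSq (g i j) • star (g k l) ∈ image O := fun i j k l =>
    hsm _ (hm i j) _ (hs k l)
  have key2 : ∀ i j k l m n, star (g i j) * g k l * star (g m n) ∈ image O :=
    fun i j k l m n => mul_mem (mul_mem (hs i j) (hm k l)) (hs m n)
  set a := g 0 0 with ha
  set b := g 0 1 with hb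
  set c := g 1 0 with hc
  set d := g 1 1 with hd
  set g' : Matrix (Fin 2) (Fin 2) ℍ[ℝ] :=
    !![normSq d • star a - star c * d * star b, normSq b • star c - star a * b * star d;
       normSq c • star b - star d * c * star a, normSq a • star d - star b * a * star c] with hg'
  have hgg' : g * g' = 1 := by
    ext1 i j
    rw [Matrix.mul_apply, Fin.sum_univ_two]
    fin_cases i <;> fin_cases j
    · exact sqDet_inverse hdet
    · exact mul_inverse_off a b c d
    · exact mul_inverse_off c d a b
    · rw [← sqDet_swap] at hdet
      exact sqDet_inverse hdet
  refine ⟨g', fun i j => ?_, hgg', mul_eq_one_comm.mp hgg'⟩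
  fin_cases i <;> fin_cases j
  · exact sub_mem (key 1 1 0 0) (key2 1 0 1 1 0 1)
  · exact sub_mem (key 0 1 1 0) (key2 0 0 0 1 1 1)
  · exact sub_mem (key 1 0 0 1) (key2 1 1 1 0 0 0)
  · exact sub_mem (key 0 0 1 1) (key2 0 1 0 0 1 0)

/-! ### Norms of ideals generated by two elements -/

/-- The additive group generated by the norms of the elements of `Ru + Rv`. -/
def normGroup (R : Subring ℍ[ℝ]) (u v : ℍ[ℝ]) : AddSubgroup ℝ :=
  AddSubgroup.closure {t | ∃ x ∈ R, ∃ y ∈ R, t = normSq (x * u + y * v)}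

theorem normSq_mem_normGroup {x y : ℍ[ℝ]} (hx : x ∈ R) (hy : y ∈ R) (u v : ℍ[ℝ]) :
    normSq (x * u + y * v) ∈ normGroup R u v :=
  AddSubgroup.subset_closure ⟨x, hx, y, hy, rfl⟩

theorem normGroup_le {a b c d : ℍ[ℝ]} (ha : a ∈ R) (hb : b ∈ R) (hc : c ∈ R) (hd : d ∈ R)
    (u v : ℍ[ℝ]) : normGroup R (a * u + b * v) (c * u + d * v) ≤ normGroup R u v := by
  rw [normGroup, AddSubgroup.closure_le]
  rintro _ ⟨x, hx, y, hy, rfl⟩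
  have : x * (a * u + b * v) + y * (c * u + d * v) =
      (x * a + y * c) * u + (x * b + y * d) * v := by noncomm_ring
  rw [this]
  exact normSq_mem_normGroup (R.add_mem (R.mul_mem hx ha) (R.mul_mem hy hc))
    (R.add_mem (R.mul_mem hx hb) (R.mul_mem hy hd)) u v

theorem normGroup_mul_right (u v w : ℍ[ℝ]) : normGroup R (u * w) (v * w) =
    (normGroup R u v).map (AddMonoidHom.mulRight (normSq w)) := by
  rw [normGroup, normGroup, AddMonoidHom.map_closure]
  congr 1
  ext t
  constructor
  · rintro ⟨x, hx, y, hy, rfl⟩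
    refine ⟨_, ⟨x, hx, y, hy, rfl⟩, ?_⟩
    change normSq _ * normSq w = _
    rw [← map_mul, add_mul, mul_assoc, mul_assoc]
  · rintro ⟨_, ⟨x, hx, y, hy, rfl⟩, rfl⟩
    refine ⟨x, hx, y, hy, ?_⟩
    change normSq _ * normSq w = _
    rw [← map_mul, add_mul, mul_assoc, mul_assoc]

theorem eq_of_zmultiples_eq {s t : ℝ} (hs : 0 < s) (ht : 0 < t)
    (h : AddSubgroup.zmultiples s = AddSubgroup.zmultiples t) : s = t := by
  have aux : ∀ {s t : ℝ}, 0 < s → 0 < t →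
      AddSubgroup.zmultiples s = AddSubgroup.zmultiples t → t ≤ s := fun {s t} hs ht h => by
    have h1 : s ∈ AddSubgroup.zmultiples t := h ▸ AddSubgroup.mem_zmultiples s
    obtain ⟨k, hk⟩ := AddSubgroup.mem_zmultiples_iff.mp h1
    rw [zsmul_eq_mul] at hk
    have hk0 : (0 : ℝ) < k := by
      by_contra! h0
      nlinarith
    have hk1 : (1 : ℝ) ≤ k := by exact_mod_cast hk0
    nlinarith
  exact le_antisymm (aux ht hs h.symm) (aux hs ht h)

/-- The group lies between ℤ and (1/M)ℤ, hence is cyclic, and since it contains 1 a generator is the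
inverse of an integer. -/
theorem exists_eq_zmultiples_inv {G : AddSubgroup ℝ} {M : ℕ} (hM : 0 < M)
    (hG : ∀ t ∈ G, ∃ k : ℤ, M * t = k) (h1 : (1 : ℝ) ∈ G) :
    ∃ N : ℕ, 0 < N ∧ G = AddSubgroup.zmultiples (1 / N : ℝ) := by
  have hMR : (M : ℝ) ≠ 0 := by positivity
  let f : ℤ →+ ℝ := (AddMonoidHom.mulRight (1 / M : ℝ)).comp (Int.castAddHom ℝ)
  have hf : ∀ k : ℤ, f k = k / M := fun k => by simp [f, div_eq_mul_inv]
  obtain ⟨a, ha⟩ := Int.subgroup_cyclic (G.comap f)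
  have hmem : ∀ k : ℤ, (k : ℝ) / M ∈ G ↔ ∃ l : ℤ, k = l * a := fun k => by
    rw [← hf, ← AddSubgroup.mem_comap, ha, AddSubgroup.mem_closure_singleton]
    exact exists_congr fun l => by rw [smul_eq_mul, eq_comm]
  obtain ⟨m, hm⟩ := (hmem M).mp (by simpa [hMR] using h1)
  have hm0 : m ≠ 0 := by rintro rfl; simp at hm; omega
  have ha0 : a ≠ 0 := by rintro rfl; simp at hm; omega
  have hmR : (M : ℝ) = m * a := by exact_mod_cast hm
  have ha' : (a : ℝ) / M ∈ G := (hmem a).mpr ⟨1, by simp⟩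
  have hm' : (a : ℝ) / M = 1 / m := by
    have : (a : ℝ) ≠ 0 := by exact_mod_cast ha0
    have : (m : ℝ) ≠ 0 := by exact_mod_cast hm0
    rw [hmR]; field_simp
  have key : G = AddSubgroup.zmultiples (1 / m : ℝ) := by
    apply le_antisymm
    · intro t ht
      obtain ⟨k, hk⟩ := hG t ht
      have ht' : t = k / M := by rw [← hk]; field_simp
      obtain ⟨l, hl⟩ := (hmem k).mp (ht' ▸ ht)
      refine AddSubgroup.mem_zmultiples_iff.mpr ⟨l, ?_⟩
      rw [ht', ← hm', hl]; push_cast; rw [zsmul_eq_mul]; ring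
    · rw [AddSubgroup.zmultiples_le, ← hm']
      exact ha'
  refine ⟨m.natAbs, Int.natAbs_pos.mpr hm0, ?_⟩
  rw [key]
  rcases Int.natAbs_eq m with h2 | h2
  · have : (m : ℝ) = (m.natAbs : ℝ) := by
      conv_lhs => rw [h2]
      exact Int.cast_natCast _
    rw [this]
  · have : (m : ℝ) = -(m.natAbs : ℝ) := by
      conv_lhs => rw [h2]
      rw [Int.cast_neg, Int.cast_natCast]
    rw [this, one_div, one_div, inv_neg, AddSubgroup.zmultiples_neg]

end

/-! ### Norms of cusp ideals -/

section

variable {A : Subalgebra ℚ ℍ[ℝ]} {O : Subring A} {e : Fin 4 → ℍ[ℝ]} {α : A}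

theorem exists_natCast_mul_mem (hO : Submodule.span ℚ (O : Set A) = ⊤) (α : A) :
    ∃ k : ℕ, 0 < k ∧ (k : A) * α ∈ O := by
  have hα : α ∈ Submodule.span ℚ (O : Set A) := hO ▸ Submodule.mem_top
  induction hα using Submodule.span_induction with
  | mem x hx => exact ⟨1, one_pos, by simpa using hx⟩
  | zero => exact ⟨1, one_pos, by simp⟩
  | add x y _ _ hx hy =>
    obtain ⟨k, hk, hx⟩ := hx
    obtain ⟨l, hl, hy⟩ := hy
    refine ⟨k * l, Nat.mul_pos hk hl, ?_⟩
    have : ((k * l : ℕ) : A) * (x + y) = (l : A) * ((k : A) * x) + (k : A) * ((l : A) * y) := by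
      push_cast
      rw [mul_add, mul_assoc, mul_assoc, ← mul_assoc (k : A) (l : A) x,
        (Nat.cast_commute k (l : A)).eq, mul_assoc]
    rw [this]
    exact O.add_mem (O.mul_mem (natCast_mem O l) hx) (O.mul_mem (natCast_mem O k) hy)
  | smul q x _ hx =>
    obtain ⟨k, hk, hx⟩ := hx
    refine ⟨k * q.den, Nat.mul_pos hk q.pos, ?_⟩
    have : ((k * q.den : ℕ) : A) * (q • x) = (q.num : A) * ((k : A) * x) := by
      rw [Algebra.smul_def]
      have h1 : ((k * q.den : ℕ) : A) = algebraMap ℚ A (k * q.den) := by simp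
      have h2 : (q.num : A) = algebraMap ℚ A q.num := by simp
      have h3 : (k : A) = algebraMap ℚ A k := by simp
      rw [h1, h2, h3, ← mul_assoc, ← mul_assoc, ← map_mul, ← map_mul]
      congr 2
      have := Rat.den_mul_eq_num q
      linear_combination (k : ℚ) * this
    rw [this]
    exact O.mul_mem (intCast_mem O _) hx

theorem mem_cuspIdeal {x : A} : x ∈ cuspIdeal O α ↔ ∃ a ∈ O, ∃ b ∈ O, x = a * α + b := by
  rw [cuspIdeal, Submodule.mem_span_pair]
  constructor
  · rintro ⟨a, b, rfl⟩
    exact ⟨a, a.2, b, b.2, by rw [Subring.smul_def, Subring.smul_def]; simp⟩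
  · rintro ⟨a, ha, b, hb, rfl⟩
    exact ⟨⟨a, ha⟩, ⟨b, hb⟩, by rw [Subring.smul_def, Subring.smul_def]; simp⟩

theorem exists_idealNorm_eq (hO : Submodule.span ℚ (O : Set A) = ⊤) (α : A) :
    ∃ c : ℕ, 0 < c ∧ (∀ x ∈ cuspIdeal O α, (c : A) * x ∈ O) ∧ idealNorm O (cuspIdeal O α) =
      (gcdNorm ((fun x : A => ((c : A) * x : ℍ[ℝ])) '' (cuspIdeal O α : Set A)) : ℝ) /
        normSq (c : ℍ[ℝ]) := by
  classical
  have hex : ∃ c : ℕ, 0 < c ∧ ∀ x ∈ cuspIdeal O α, (c : A) * x ∈ O := by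
    obtain ⟨k, hk, hkα⟩ := exists_natCast_mul_mem hO α
    refine ⟨k, hk, fun x hx => ?_⟩
    obtain ⟨a, ha, b, hb, rfl⟩ := mem_cuspIdeal.mp hx
    rw [mul_add, ← mul_assoc, (Nat.cast_commute k a).eq, mul_assoc]
    exact O.add_mem (O.mul_mem ha hkα) (O.mul_mem (natCast_mem O k) hb)
  refine ⟨Nat.find hex, (Nat.find_spec hex).1, (Nat.find_spec hex).2, ?_⟩
  rw [idealNorm, dif_pos hex]

/-- The positive integer `N` is the denominator of `α`: the inverse of the norm of `Oα + O`. -/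
structure IsDenominator (O : Subring A) (α : A) (N : ℕ) : Prop where
  pos : 0 < N
  idealNorm_eq : idealNorm O (cuspIdeal O α) = 1 / N
  normGroup_eq : normGroup (image O) α 1 = AddSubgroup.zmultiples (1 / N : ℝ)
  smul_mem : (N : ℝ) • (α : ℍ[ℝ]) ∈ image O
  exists_normSq : ∃ k : ℤ, N * normSq (α : ℍ[ℝ]) = k
  eq_one : α ∈ O → N = 1

theorem natCast_smul_coe (k : ℕ) (x : A) : (((k : A) * x : A) : ℍ[ℝ]) = (k : ℝ) • (x : ℍ[ℝ]) := by
  rw [← Quaternion.coe_mul_eq_smul, Quaternion.coe_natCast]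
  exact congrArg (· * (x : ℍ[ℝ])) (map_natCast A.val k)

/-- The norms of the elements of Oα + O generate a group (1/N)ℤ. The greatest common divisor
computed after scaling by c is c²/N, so the ideal norm is 1/N whatever c is. -/
theorem exists_isDenominator (h : HasIntegralBasis (image O) e) (hM : IsNormMaximal (image O))
    (hO : Submodule.span ℚ (O : Set A) = ⊤) (α : A) : ∃ N, IsDenominator O α N := by
  obtain ⟨c, hc, hcI, hnorm⟩ := exists_idealNorm_eq hO α
  have hcR : (c : ℝ) ≠ 0 := by positivity
  have hint : ∀ x ∈ image O, ∀ y ∈ image O, (c : ℝ) • (x * α + y * 1) ∈ image O := by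
    intro x hx y hy
    obtain ⟨x, hx, rfl⟩ := mem_image.mp hx
    obtain ⟨y, hy, rfl⟩ := mem_image.mp hy
    rw [coe_mem_image] at *
    have h1 := hcI _ (mem_cuspIdeal.mpr ⟨x, hx, y, hy, rfl⟩)
    rw [← coe_mem_image, natCast_smul_coe] at h1
    simpa using h1
  have hG : ∀ t ∈ normGroup (image O) (α : ℍ[ℝ]) 1, ∃ k : ℤ, ((c ^ 2 : ℕ) : ℝ) * t = k := by
    intro t ht
    induction ht using AddSubgroup.closure_induction with
    | mem t ht =>
      obtain ⟨x, hx, y, hy, rfl⟩ := ht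
      obtain ⟨k, hk⟩ := h.exists_normSq_eq (hint x hx y hy)
      rw [Quaternion.normSq_smul] at hk
      exact ⟨k, by push_cast; exact hk⟩
    | zero => exact ⟨0, by simp⟩
    | add s t _ _ hs ht =>
      obtain ⟨k, hk⟩ := hs
      obtain ⟨l, hl⟩ := ht
      exact ⟨k + l, by rw [mul_add, hk, hl]; push_cast; rfl⟩
    | neg t _ ht =>
      obtain ⟨k, hk⟩ := ht
      exact ⟨-k, by rw [mul_neg, hk]; push_cast; rfl⟩
  have hone : (1 : ℝ) ∈ normGroup (image O) (α : ℍ[ℝ]) 1 := by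
    simpa using normSq_mem_normGroup (zero_mem (image O)) (one_mem (image O)) (α : ℍ[ℝ]) 1
  obtain ⟨N, hN, hGN⟩ := exists_eq_zmultiples_inv (pow_pos hc 2) hG hone
  have hNR : (N : ℝ) ≠ 0 := by positivity
  have hmul : ∀ {t}, t ∈ normGroup (image O) (α : ℍ[ℝ]) 1 → ∃ k : ℤ, N * t = k := by
    intro t ht
    rw [hGN] at ht
    obtain ⟨k, rfl⟩ := AddSubgroup.mem_zmultiples_iff.mp ht
    exact ⟨k, by rw [zsmul_eq_mul]; field_simp⟩
  have hmemN : (1 / N : ℝ) ∈ normGroup (image O) (α : ℍ[ℝ]) 1 :=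
    hGN ▸ AddSubgroup.mem_zmultiples _
  have hαG : normSq (α : ℍ[ℝ]) ∈ normGroup (image O) (α : ℍ[ℝ]) 1 := by
    simpa using normSq_mem_normGroup (one_mem (image O)) (zero_mem (image O)) (α : ℍ[ℝ]) 1
  refine ⟨N, hN, ?_, hGN, ?_, hmul hαG, ?_⟩
  · obtain ⟨m, hm⟩ := hG _ hmemN
    have hm0 : (0 : ℝ) < m := by rw [← hm]; positivity
    have hm0' : 0 < m := by exact_mod_cast hm0
    lift m to ℕ using hm0'.le
    push_cast at hm hm0
    have hmc : (c : ℝ) ^ 2 = m * N := by rw [← hm]; field_simp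
    have hgcd : gcdNorm ((fun x : A => ((c : A) * x : ℍ[ℝ])) '' (cuspIdeal O α : Set A)) = m := by
      refine IsGreatest.csSup_eq ⟨?_, ?_⟩
      · rintro _ ⟨x, hx, rfl⟩ -
        obtain ⟨a, ha, b, hb, rfl⟩ := mem_cuspIdeal.mp hx
        obtain ⟨k, hk⟩ := hmul (normSq_mem_normGroup (coe_mem_image.mpr ha)
          (coe_mem_image.mpr hb) (α : ℍ[ℝ]) 1)
        refine ⟨k, ?_⟩
        have h1 := natCast_smul_coe c (a * α + b)
        push_cast at h1 ⊢
        rw [h1, Quaternion.normSq_smul, hmc, ← hk, mul_one]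
        ring
      · intro d hd
        have hdG : ∀ t ∈ normGroup (image O) (α : ℍ[ℝ]) 1, ∃ k : ℤ, (c : ℝ) ^ 2 * t = d * k := by
          intro t ht
          induction ht using AddSubgroup.closure_induction with
          | mem t ht =>
            obtain ⟨x, hx, y, hy, rfl⟩ := ht
            obtain ⟨x, hx, rfl⟩ := mem_image.mp hx
            obtain ⟨y, hy, rfl⟩ := mem_image.mp hy
            rw [coe_mem_image] at *
            by_cases h0 : (x * α + y * 1 : ℍ[ℝ]) = 0
            · exact ⟨0, by rw [h0]; simp⟩
            have h1 := natCast_smul_coe c (x * α + y)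
            push_cast at h1
            rw [mul_one] at h0 ⊢
            obtain ⟨k, hk⟩ := hd _ ⟨_, mem_cuspIdeal.mpr ⟨x, hx, y, hy, rfl⟩, rfl⟩ (by
              push_cast
              rw [h1]
              exact smul_ne_zero hcR h0)
            push_cast at hk
            rw [h1, Quaternion.normSq_smul] at hk
            exact ⟨k, hk⟩
          | zero => exact ⟨0, by simp⟩
          | add s t _ _ hs ht =>
            obtain ⟨k, hk⟩ := hs
            obtain ⟨l, hl⟩ := ht
            exact ⟨k + l, by rw [mul_add, hk, hl]; push_cast; ring⟩
          | neg t _ ht =>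
            obtain ⟨k, hk⟩ := ht
            exact ⟨-k, by rw [mul_neg, hk]; push_cast; ring⟩
        obtain ⟨k, hk⟩ := hdG _ hmemN
        rw [hm] at hk
        have hk' : (m : ℤ) = d * k := by exact_mod_cast hk
        have : (d : ℤ) ∣ m := ⟨k, hk'⟩
        exact Int.le_of_dvd (by exact_mod_cast hm0') this |> Int.ofNat_le.mp
    rw [hnorm, hgcd]
    have h2 : normSq (c : ℍ[ℝ]) = (c : ℝ) ^ 2 := by
      rw [← Quaternion.coe_natCast, Quaternion.normSq_coe]
    rw [h2, hmc]
    field_simp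
  · obtain ⟨k, hk, hkα⟩ := exists_natCast_mul_mem hO α
    rw [← coe_mem_image, natCast_smul_coe] at hkα
    have hkR : (k : ℝ) ≠ 0 := by positivity
    obtain ⟨n, hn⟩ := hmul hαG
    -- Norm maximality is applied to N(kα), with kα in the order. Polarising the norms of α + ȳ
    -- shows that N tr(αy) is an integer, so the traces are divisible by k; the norm is k²N times
    -- the integer N n(α).
    obtain ⟨y, hy, hxy⟩ := hM (((N : ℤ) : ℝ) • ((k : ℝ) • (α : ℍ[ℝ]))) (smul_mem_of_mem N hkα) k hk
      (fun y hy => by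
        have h1 := normSq_mem_normGroup (one_mem (image O)) (h.star_mem hy) (α : ℍ[ℝ]) 1
        obtain ⟨l, hl⟩ := hmul h1
        obtain ⟨q, hq⟩ := h.exists_normSq_eq hy
        refine ⟨l - n - N * q, ?_⟩
        rw [one_mul, mul_one, normSq_add_eq, star_star, Quaternion.normSq_star] at hl
        rw [smul_mul_assoc, smul_mul_assoc, tr_smul, tr_smul]
        push_cast
        rw [← hl, ← hn, ← hq]
        ring)
      ⟨N * n, by
        rw [Quaternion.normSq_smul, Quaternion.normSq_smul]
        push_cast
        rw [← hn]
        ring⟩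
    rw [smul_comm] at hxy
    have := smul_right_injective ℍ[ℝ] hkR hxy
    push_cast at this
    rw [this]
    exact hy
  · intro hα
    have hG1 : ∀ t ∈ normGroup (image O) (α : ℍ[ℝ]) 1, ∃ k : ℤ, t = k := by
      intro t ht
      induction ht using AddSubgroup.closure_induction with
      | mem t ht =>
        obtain ⟨x, hx, y, hy, rfl⟩ := ht
        exact h.exists_normSq_eq (add_mem (mul_mem hx (coe_mem_image.mpr hα))
          (mul_mem hy (one_mem _)))
      | zero => exact ⟨0, by simp⟩
      | add s t _ _ hs ht =>
        obtain ⟨k, rfl⟩ := hs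
        obtain ⟨l, rfl⟩ := ht
        exact ⟨k + l, by push_cast; rfl⟩
      | neg t _ ht =>
        obtain ⟨k, rfl⟩ := ht
        exact ⟨-k, by push_cast; rfl⟩
    obtain ⟨k, hk⟩ := hG1 _ hmemN
    have hk0 : (0 : ℝ) < k := by rw [← hk]; positivity
    have hk1 : (1 : ℝ) ≤ k := by exact_mod_cast hk0
    rw [← hk, le_div_iff₀ (by positivity), one_mul] at hk1
    have : N ≤ 1 := by exact_mod_cast hk1
    omega

/-! ### Distances to the cusps -/

theorem cuspDist_infty (x : ℍ[ℝ] × ℝ) : cuspDist O OnePoint.infty x = 1 / x.2 := by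
  change (0 : ℝ) * _ + 1 * (1 / x.2) - tr (star 0 * _) = _
  simp [tr]

theorem cuspDist_coe {N : ℕ} (hN : IsDenominator O α N) (x : ℍ[ℝ] × ℝ) :
    cuspDist O (α : OnePoint A) x = N * (normSq (x.1 - (α : ℍ[ℝ])) + x.2 ^ 2) / x.2 := by
  change 1 / idealNorm O (cuspIdeal O α) * ((normSq x.1 + x.2 ^ 2) / x.2) +
    normSq (α : ℍ[ℝ]) / idealNorm O (cuspIdeal O α) * (1 / x.2) -
      tr (star (-((1 / idealNorm O (cuspIdeal O α)) • (α : ℍ[ℝ]))) * (-((1 / x.2) • x.1))) = _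
  rw [hN.idealNorm_eq, star_neg, neg_mul_neg, Quaternion.star_smul, smul_mul_assoc, mul_smul_comm,
    tr_smul, tr_smul, normSq_sub_eq, tr_mul_comm]
  simp only [one_div, div_inv_eq_mul]
  ring

/-- The vector `(u, v)` represents the point `β` of the projective line. -/
def IsRep (β : OnePoint A) (u v : ℍ[ℝ]) : Prop :=
  (v = 0 ∧ u ≠ 0 ∧ β = OnePoint.infty) ∨ (v ≠ 0 ∧ ∃ b : A, β = b ∧ (b : ℍ[ℝ]) * v = u)

/-- In homogeneous coordinates (u, v) the distance is the form of the point evaluated at (u, v),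
divided by the positive generator of the group of norms of Ru + Rv. Scaling the vector on the right
multiplies both by the same factor. -/
theorem IsRep.exists_cuspDist {β : OnePoint A} {u v : ℍ[ℝ]} (h : HasIntegralBasis (image O) e)
    (hM : IsNormMaximal (image O)) (hO : Submodule.span ℚ (O : Set A) = ⊤) (hβ : IsRep β u v) :
    ∃ s > 0, normGroup (image O) u v = AddSubgroup.zmultiples s ∧
      ∀ x : ℍ[ℝ] × ℝ, 0 < x.2 → cuspDist O β x = formValue u v x.1 x.2 / (x.2 * s) := by
  rcases hβ with ⟨rfl, hu, rfl⟩ | ⟨hv, b, rfl, rfl⟩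
  · have hu0 : normSq u ≠ 0 := Quaternion.normSq_ne_zero.mpr hu
    refine ⟨normSq u, lt_of_le_of_ne Quaternion.normSq_nonneg (Ne.symm hu0), ?_, fun x hx => ?_⟩
    · apply le_antisymm
      · rw [normGroup, AddSubgroup.closure_le]
        rintro _ ⟨x, hx, y, hy, rfl⟩
        obtain ⟨k, hk⟩ := h.exists_normSq_eq hx
        refine AddSubgroup.mem_zmultiples_iff.mpr ⟨k, ?_⟩
        rw [mul_zero, add_zero, map_mul, hk, zsmul_eq_mul]
      · rw [AddSubgroup.zmultiples_le]
        simpa using normSq_mem_normGroup (one_mem (image O)) (zero_mem (image O)) u 0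
    · rw [cuspDist_infty, formValue]
      simp only [mul_zero, sub_zero, map_zero, add_zero]
      have := hx.ne'
      field_simp
  · obtain ⟨N, hN⟩ := exists_isDenominator h hM hO b
    have hv0 : normSq v ≠ 0 := Quaternion.normSq_ne_zero.mpr hv
    have hv1 := lt_of_le_of_ne Quaternion.normSq_nonneg (Ne.symm hv0)
    have hN0 : (0 : ℝ) < N := by exact_mod_cast hN.pos
    refine ⟨1 / N * normSq v, by positivity, ?_, fun x hx => ?_⟩
    · have := normGroup_mul_right (R := image O) (b : ℍ[ℝ]) 1 v
      rw [one_mul] at this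
      rw [this, hN.normGroup_eq, AddMonoidHom.map_zmultiples]
      rfl
    · rw [cuspDist_coe hN, formValue, ← sub_mul, map_mul, ← Quaternion.normSq_neg ((b : ℍ[ℝ]) - x.1),
        neg_sub]
      have := hx.ne'
      field_simp

/-- The form is equivariant, and a matrix invertible over the order does not change the group of
norms. -/
theorem cuspDist_act {α β : OnePoint A} {u v : ℍ[ℝ]} (h : HasIntegralBasis (image O) e)
    (hM : IsNormMaximal (image O)) (hO : Submodule.span ℚ (O : Set A) = ⊤)
    {g : Matrix (Fin 2) (Fin 2) ℍ[ℝ]} (hg : g ∈ SL2 O) (hα : IsRep α u v)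
    (hβ : IsRep β (g 0 0 * u + g 0 1 * v) (g 1 0 * u + g 1 1 * v)) {x : ℍ[ℝ] × ℝ} (hx : 0 < x.2) :
    cuspDist O β (act g x) = cuspDist O α x := by
  obtain ⟨s, hs, hsG, hs'⟩ := hα.exists_cuspDist h hM hO
  obtain ⟨t, ht, htG, ht'⟩ := hβ.exists_cuspDist h hM hO
  obtain ⟨hdet, hm⟩ := mem_SL2_iff.mp hg
  have hQ := actDenom_pos _ _ _ _ x.1 hx hdet
  have hst : s = t := by
    refine eq_of_zmultiples_eq hs ht ?_
    rw [← hsG, ← htG]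
    refine le_antisymm ?_ (normGroup_le (hm 0 0) (hm 0 1) (hm 1 0) (hm 1 1) u v)
    obtain ⟨g', hm', -, hg'⟩ := exists_inverse h hg
    have h1 := normGroup_le (hm' 0 0) (hm' 0 1) (hm' 1 0) (hm' 1 1)
      (g 0 0 * u + g 0 1 * v) (g 1 0 * u + g 1 1 * v)
    have h2 : ∀ i, g' i 0 * (g 0 0 * u + g 0 1 * v) + g' i 1 * (g 1 0 * u + g 1 1 * v) =
        (g' * g) i 0 * u + (g' * g) i 1 * v := fun i => by
      rw [Matrix.mul_apply, Matrix.mul_apply, Fin.sum_univ_two, Fin.sum_univ_two]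
      noncomm_ring
    rw [h2, h2, hg'] at h1
    simpa using h1
  have hx' : 0 < (act g x).2 := by rw [act_eq]; exact div_pos hx hQ
  rw [ht' _ hx', hs' x hx, act_eq]
  simp only
  rw [formValue_equivariant _ _ _ _ _ _ _ hdet hx, hst]
  field_simp

end

/-! ### The action on the cusps and on the cells -/

section

variable {A : Subalgebra ℚ ℍ[ℝ]} {O : Subring A} {e : Fin 4 → ℍ[ℝ]} {α β α' β' : OnePoint A}
  {g g' : Matrix (Fin 2) (Fin 2) ℍ[ℝ]} {u v : ℍ[ℝ]}

theorem isRep_infty : IsRep (OnePoint.infty : OnePoint A) 1 0 := Or.inl ⟨rfl, one_ne_zero, rfl⟩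

theorem isRep_coe (b : A) : IsRep (b : OnePoint A) b 1 :=
  Or.inr ⟨one_ne_zero, b, rfl, mul_one _⟩

theorem IsRep.ne_zero (h : IsRep α u v) : u ≠ 0 ∨ v ≠ 0 := by
  rcases h with ⟨-, h, -⟩ | ⟨h, -⟩
  exacts [Or.inl h, Or.inr h]

theorem exists_isRep (h : HasIntegralBasis (image O) e) (hu : u ∈ image O) (hv : v ∈ image O)
    (h0 : u ≠ 0 ∨ v ≠ 0) : ∃ β : OnePoint A, IsRep β u v := by
  by_cases hv0 : v = 0
  · exact ⟨OnePoint.infty, Or.inl ⟨hv0, h0.resolve_right (not_not.mpr hv0), rfl⟩⟩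
  obtain ⟨k, hk⟩ := h.exists_normSq_eq hv
  obtain ⟨w, -, hw⟩ := mem_image.mp (mul_mem hu (h.star_mem hv))
  refine ⟨((k : ℚ)⁻¹ • w : A), Or.inr ⟨hv0, _, rfl, ?_⟩⟩
  have hk0 : (k : ℝ) ≠ 0 := by rw [← hk]; exact Quaternion.normSq_ne_zero.mpr hv0
  have h1 : (((k : ℚ)⁻¹ • w : A) : ℍ[ℝ]) = (k : ℝ)⁻¹ • (w : ℍ[ℝ]) := by
    rw [Subalgebra.coe_smul, Algebra.smul_def, Algebra.smul_def]
    simp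
  rw [h1, hw, smul_mul_assoc, mul_assoc, Quaternion.star_mul_self, hk, ← Quaternion.coe_commutes,
    Quaternion.coe_mul_eq_smul, smul_smul, inv_mul_cancel₀ hk0, one_smul]

theorem exists_isRep_mem (h : HasIntegralBasis (image O) e) (hM : IsNormMaximal (image O))
    (hO : Submodule.span ℚ (O : Set A) = ⊤) (β : OnePoint A) :
    ∃ u ∈ image O, ∃ v ∈ image O, IsRep β u v := by
  induction β using OnePoint.rec with
  | infty => exact ⟨1, one_mem _, 0, zero_mem _, isRep_infty⟩
  | coe b =>
    obtain ⟨N, hN⟩ := exists_isDenominator h hM hO b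
    refine ⟨_, hN.smul_mem, N, natCast_mem _ N, Or.inr ⟨?_, b, rfl, ?_⟩⟩
    · intro h0
      have h1 := congrArg QuaternionAlgebra.re h0
      rw [← Quaternion.coe_natCast, Quaternion.re_coe] at h1
      exact hN.pos.ne' (by exact_mod_cast h1)
    · rw [← Quaternion.coe_natCast, ← Quaternion.coe_commutes, Quaternion.coe_mul_eq_smul]

theorem apply_inverse (h : g' * g = 1) (u v : ℍ[ℝ]) :
    g' 0 0 * (g 0 0 * u + g 0 1 * v) + g' 0 1 * (g 1 0 * u + g 1 1 * v) = u ∧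
    g' 1 0 * (g 0 0 * u + g 0 1 * v) + g' 1 1 * (g 1 0 * u + g 1 1 * v) = v := by
  have h2 : ∀ i, g' i 0 * (g 0 0 * u + g 0 1 * v) + g' i 1 * (g 1 0 * u + g 1 1 * v) =
      (g' * g) i 0 * u + (g' * g) i 1 * v := fun i => by
    rw [Matrix.mul_apply, Matrix.mul_apply, Fin.sum_univ_two, Fin.sum_univ_two]
    noncomm_ring
  rw [h2, h2, h]
  simp

theorem apply_ne_zero (h : g' * g = 1) (h0 : u ≠ 0 ∨ v ≠ 0) :
    g 0 0 * u + g 0 1 * v ≠ 0 ∨ g 1 0 * u + g 1 1 * v ≠ 0 := by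
  obtain ⟨h1, h2⟩ := apply_inverse h u v
  by_contra! hcon
  rw [hcon.1, hcon.2] at h1 h2
  simp only [mul_zero, add_zero] at h1 h2
  rcases h0 with h0 | h0
  exacts [h0 h1.symm, h0 h2.symm]

theorem apply_mem (hg : ∀ i j, g i j ∈ image O) (hu : u ∈ image O) (hv : v ∈ image O) (i : Fin 2) :
    g i 0 * u + g i 1 * v ∈ image O :=
  add_mem (mul_mem (hg i 0) hu) (mul_mem (hg i 1) hv)

theorem exists_map_isRep (h : HasIntegralBasis (image O) e) (hM : IsNormMaximal (image O))
    (hO : Submodule.span ℚ (O : Set A) = ⊤) (hg : g ∈ SL2 O) (hu : u ∈ image O)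
    (hv : v ∈ image O) (hα : IsRep α u v) :
    ∃ β, IsRep β (g 0 0 * u + g 0 1 * v) (g 1 0 * u + g 1 1 * v) ∧
      ∀ x : ℍ[ℝ] × ℝ, 0 < x.2 → cuspDist O β (act g x) = cuspDist O α x := by
  obtain ⟨g', -, -, hg'⟩ := exists_inverse h hg
  obtain ⟨-, hm⟩ := mem_SL2_iff.mp hg
  obtain ⟨β, hβ⟩ := exists_isRep h (apply_mem hm hu hv 0) (apply_mem hm hu hv 1)
    (apply_ne_zero hg' hα.ne_zero)
  exact ⟨β, hβ, fun x hx => cuspDist_act h hM hO hg hα hβ hx⟩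

theorem exists_map_cusp (h : HasIntegralBasis (image O) e) (hM : IsNormMaximal (image O))
    (hO : Submodule.span ℚ (O : Set A) = ⊤) (hg : g ∈ SL2 O) (α : OnePoint A) :
    ∃ β, ∀ x : ℍ[ℝ] × ℝ, 0 < x.2 → cuspDist O β (act g x) = cuspDist O α x := by
  obtain ⟨u, hu, v, hv, hα⟩ := exists_isRep_mem h hM hO α
  obtain ⟨β, -, hβ⟩ := exists_map_isRep h hM hO hg hu hv hα
  exact ⟨β, hβ⟩

theorem exists_comap_isRep (h : HasIntegralBasis (image O) e) (hM : IsNormMaximal (image O))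
    (hO : Submodule.span ℚ (O : Set A) = ⊤) (hg : g ∈ SL2 O) (hg' : ∀ i j, g' i j ∈ image O)
    (hgg' : g * g' = 1) (hu : u ∈ image O) (hv : v ∈ image O) (hβ : IsRep β u v) :
    ∃ α, IsRep α (g' 0 0 * u + g' 0 1 * v) (g' 1 0 * u + g' 1 1 * v) ∧
      ∀ x : ℍ[ℝ] × ℝ, 0 < x.2 → cuspDist O β (act g x) = cuspDist O α x := by
  obtain ⟨α, hα⟩ := exists_isRep h (apply_mem hg' hu hv 0) (apply_mem hg' hu hv 1)
    (apply_ne_zero hgg' hβ.ne_zero)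
  refine ⟨α, hα, fun x hx => cuspDist_act h hM hO hg hα ?_ hx⟩
  rwa [(apply_inverse hgg' u v).1, (apply_inverse hgg' u v).2]

theorem exists_comap_cusp (h : HasIntegralBasis (image O) e) (hM : IsNormMaximal (image O))
    (hO : Submodule.span ℚ (O : Set A) = ⊤) (hg : g ∈ SL2 O) (β : OnePoint A) :
    ∃ α, ∀ x : ℍ[ℝ] × ℝ, 0 < x.2 → cuspDist O β (act g x) = cuspDist O α x := by
  obtain ⟨u, hu, v, hv, hβ⟩ := exists_isRep_mem h hM hO β
  obtain ⟨g', hm, hgg', -⟩ := exists_inverse h hg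
  obtain ⟨α, -, hα⟩ := exists_comap_isRep h hM hO hg hm hgg' hu hv hβ
  exact ⟨α, hα⟩

theorem act_pos (hg : g ∈ SL2 O) {x : ℍ[ℝ] × ℝ} (hx : 0 < x.2) : 0 < (act g x).2 := by
  rw [act_eq]
  exact div_pos hx (actDenom_pos _ _ _ _ x.1 hx (mem_SL2_iff.mp hg).1)

theorem formValue_act (hg : g ∈ SL2 O) {x : ℍ[ℝ] × ℝ} (hx : 0 < x.2) (u v : ℍ[ℝ]) :
    formValue (g 0 0 * u + g 0 1 * v) (g 1 0 * u + g 1 1 * v) (act g x).1 (act g x).2 /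
      (act g x).2 = formValue u v x.1 x.2 / x.2 := by
  have hdet := (mem_SL2_iff.mp hg).1
  have hQ := (actDenom_pos _ _ _ _ x.1 hx hdet).ne'
  rw [act_eq]
  simp only
  rw [formValue_equivariant _ _ _ _ _ _ _ hdet hx]
  field_simp

theorem eq_of_formValue_eq {x y : ℍ[ℝ] × ℝ} (hy : 0 < y.2)
    (h : ∀ u v, formValue u v x.1 x.2 / x.2 = formValue u v y.1 y.2 / y.2) : x = y := by
  have h1 := h 1 0
  simp only [formValue, mul_zero, sub_zero, map_one, map_zero, add_zero, one_div, inv_inj] at h1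
  have h2 := h y.1 1
  simp only [formValue, mul_one, map_one, h1, sub_self, map_zero, zero_add] at h2
  have h3 : normSq (y.1 - x.1) = 0 := by
    have := hy.ne'
    field_simp at h2
    linarith
  rw [Quaternion.normSq_eq_zero, sub_eq_zero] at h3
  exact Prod.ext h3.symm h1

/-- A point is determined by its form, so multiplicativity of the action follows from equivariance,
without computing with homographies. -/
theorem act_mul (h : HasIntegralBasis (image O) e) (hg : g ∈ SL2 O) (hg' : g' ∈ SL2 O)
    (hgg' : g * g' ∈ SL2 O) {x : ℍ[ℝ] × ℝ} (hx : 0 < x.2) :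
    act (g * g') x = act g (act g' x) := by
  refine eq_of_formValue_eq (act_pos hg (act_pos hg' hx)) fun u v => ?_
  obtain ⟨k, -, hk, -⟩ := exists_inverse h hgg'
  obtain ⟨h1, h2⟩ := apply_inverse hk u v
  have h3 := formValue_act hgg' hx (k 0 0 * u + k 0 1 * v) (k 1 0 * u + k 1 1 * v)
  have h4 := formValue_act hg (act_pos hg' hx)
    (g' 0 0 * (k 0 0 * u + k 0 1 * v) + g' 0 1 * (k 1 0 * u + k 1 1 * v))
    (g' 1 0 * (k 0 0 * u + k 0 1 * v) + g' 1 1 * (k 1 0 * u + k 1 1 * v))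
  rw [formValue_act hg' hx, ← h3] at h4
  rw [h1, h2] at h4 h3
  have h5 : ∀ i, g i 0 * (g' 0 0 * (k 0 0 * u + k 0 1 * v) + g' 0 1 * (k 1 0 * u + k 1 1 * v)) +
      g i 1 * (g' 1 0 * (k 0 0 * u + k 0 1 * v) + g' 1 1 * (k 1 0 * u + k 1 1 * v)) =
      (g * g') i 0 * (k 0 0 * u + k 0 1 * v) + (g * g') i 1 * (k 1 0 * u + k 1 1 * v) := fun i => by
    rw [Matrix.mul_apply, Matrix.mul_apply, Fin.sum_univ_two, Fin.sum_univ_two]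
    noncomm_ring
  rw [h5, h5, h1, h2] at h4
  exact h4.symm

theorem one_mem_SL2 : (1 : Matrix (Fin 2) (Fin 2) ℍ[ℝ]) ∈ SL2 O := by
  refine mem_SL2_iff.mpr ⟨by simp [sqDet, tr], fun i j => ?_⟩
  rw [Matrix.one_apply]
  split_ifs
  exacts [one_mem _, zero_mem _]

theorem act_one (x : ℍ[ℝ] × ℝ) : act 1 x = x := by
  simp [act]

theorem act_act_inverse (h : HasIntegralBasis (image O) e) (hg : g ∈ SL2 O) (hg' : g' ∈ SL2 O)
    (hgg' : g * g' = 1) {x : ℍ[ℝ] × ℝ} (hx : 0 < x.2) : act g (act g' x) = x := by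
  rw [← act_mul h hg hg' (hgg' ▸ one_mem_SL2) hx, hgg', act_one]

/-- The cells of `α` and `β` share a piece of the hyperplane of points equidistant to them. -/
def IsWall (O : Subring A) (α β : OnePoint A) : Prop :=
  ∃ U : Set (ℍ[ℝ] × ℝ), IsOpen U ∧ (U ∩ equidistant O α β).Nonempty ∧
    U ∩ equidistant O α β ⊆ fordVoronoiCell O α ∩ fordVoronoiCell O β

theorem isFourCell_iff {C : Set (ℍ[ℝ] × ℝ)} : IsFourCell O C ↔
    ∃ α β : OnePoint A, α ≠ β ∧ C = fordVoronoiCell O α ∩ fordVoronoiCell O β ∧ IsWall O α β := by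
  constructor
  · rintro ⟨α, β, h, rfl, h'⟩
    exact ⟨α, β, h, rfl, h'⟩
  · rintro ⟨α, β, h, rfl, h'⟩
    exact ⟨α, β, h, rfl, h'⟩

theorem act_mem_fordVoronoiCell (h : HasIntegralBasis (image O) e) (hM : IsNormMaximal (image O))
    (hO : Submodule.span ℚ (O : Set A) = ⊤) (hg : g ∈ SL2 O)
    (hα : ∀ x : ℍ[ℝ] × ℝ, 0 < x.2 → cuspDist O α' (act g x) = cuspDist O α x)
    {x : ℍ[ℝ] × ℝ} (hx : 0 < x.2) : act g x ∈ fordVoronoiCell O α' ↔ x ∈ fordVoronoiCell O α := by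
  constructor
  · rintro ⟨-, hle⟩
    refine ⟨hx, fun γ => ?_⟩
    obtain ⟨γ', hγ⟩ := exists_map_cusp h hM hO hg γ
    rw [← hα x hx, ← hγ x hx]
    exact hle γ'
  · rintro ⟨-, hle⟩
    refine ⟨act_pos hg hx, fun γ => ?_⟩
    obtain ⟨γ', hγ⟩ := exists_comap_cusp h hM hO hg γ
    rw [hα x hx, hγ x hx]
    exact hle γ'

theorem continuousOn_act (hg : g ∈ SL2 O) : ContinuousOn (act g) {x | 0 < x.2} := by
  have hQ : ∀ x ∈ {x : ℍ[ℝ] × ℝ | 0 < x.2}, normSq (g 1 0 * x.1 + g 1 1) +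
      x.2 ^ 2 * normSq (g 1 0) ≠ 0 := fun x hx =>
    (actDenom_pos _ _ _ _ x.1 hx (mem_SL2_iff.mp hg).1).ne'
  have hc : Continuous fun x : ℍ[ℝ] × ℝ => normSq (g 1 0 * x.1 + g 1 1) +
      x.2 ^ 2 * normSq (g 1 0) := by
    have := Quaternion.continuous_normSq
    fun_prop
  refine ContinuousOn.prodMk (ContinuousOn.smul (hc.continuousOn.inv₀ hQ) ?_)
    (ContinuousOn.div (by fun_prop) hc.continuousOn hQ)
  have : Continuous (star : ℍ[ℝ] → ℍ[ℝ]) := continuous_star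
  fun_prop

theorem image_fordVoronoiCell_inter (h : HasIntegralBasis (image O) e)
    (hM : IsNormMaximal (image O)) (hO : Submodule.span ℚ (O : Set A) = ⊤) (hg : g ∈ SL2 O)
    (hg' : g' ∈ SL2 O) (hgg' : g * g' = 1)
    (hα : ∀ x : ℍ[ℝ] × ℝ, 0 < x.2 → cuspDist O α' (act g x) = cuspDist O α x)
    (hβ : ∀ x : ℍ[ℝ] × ℝ, 0 < x.2 → cuspDist O β' (act g x) = cuspDist O β x) :
    act g '' (fordVoronoiCell O α ∩ fordVoronoiCell O β) =
      fordVoronoiCell O α' ∩ fordVoronoiCell O β' := by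
  ext y
  constructor
  · rintro ⟨x, ⟨hxα, hxβ⟩, rfl⟩
    exact ⟨(act_mem_fordVoronoiCell h hM hO hg hα hxα.1).mpr hxα,
      (act_mem_fordVoronoiCell h hM hO hg hβ hxα.1).mpr hxβ⟩
  · rintro ⟨hyα, hyβ⟩
    have hy := act_act_inverse h hg hg' hgg' hyα.1
    have hx := act_pos hg' hyα.1
    rw [← hy] at hyα hyβ
    exact ⟨act g' y, ⟨(act_mem_fordVoronoiCell h hM hO hg hα hx).mp hyα,
      (act_mem_fordVoronoiCell h hM hO hg hβ hx).mp hyβ⟩, hy⟩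

theorem IsWall.act (hw : IsWall O α β) (h : HasIntegralBasis (image O) e)
    (hM : IsNormMaximal (image O)) (hO : Submodule.span ℚ (O : Set A) = ⊤) (hg : g ∈ SL2 O)
    (hg' : g' ∈ SL2 O) (hgg' : g * g' = 1) (hg'g : g' * g = 1)
    (hα : ∀ x : ℍ[ℝ] × ℝ, 0 < x.2 → cuspDist O α' (act g x) = cuspDist O α x)
    (hβ : ∀ x : ℍ[ℝ] × ℝ, 0 < x.2 → cuspDist O β' (act g x) = cuspDist O β x) :
    IsWall O α' β' := by
  obtain ⟨U, hU, ⟨x, hxU, hx0, hx⟩, hsub⟩ := hw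
  have hpos : IsOpen {x : ℍ[ℝ] × ℝ | 0 < x.2} := isOpen_lt continuous_const continuous_snd
  refine ⟨_, (continuousOn_act hg').isOpen_inter_preimage hpos hU,
    ⟨HamiltonBianchi.act g x, ⟨act_pos hg hx0, ?_⟩, act_pos hg hx0, ?_⟩, ?_⟩
  · rw [Set.mem_preimage, act_act_inverse h hg' hg hg'g hx0]
    exact hxU
  · rw [hα x hx0, hβ x hx0, hx]
  · rintro y ⟨⟨hy0, hyU⟩, -, hy⟩
    have hyy := act_act_inverse h hg hg' hgg' hy0
    have hx' := act_pos hg' hy0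
    rw [← image_fordVoronoiCell_inter h hM hO hg hg' hgg' hα hβ]
    rw [← hyy, hα _ hx', hβ _ hx'] at hy
    exact ⟨HamiltonBianchi.act g' y, hsub ⟨hyU, hx', hy⟩, hyy⟩

theorem IsWall.symm (hw : IsWall O α β) : IsWall O β α := by
  obtain ⟨U, hU, h1, h2⟩ := hw
  have : equidistant O β α = equidistant O α β := by
    ext x
    simp only [equidistant, Set.mem_ofPred_eq, eq_comm]
  exact ⟨U, hU, this ▸ h1, by rw [this, Set.inter_comm (fordVoronoiCell O β)]; exact h2⟩

theorem cuspDist_of_mem (h : HasIntegralBasis (image O) e) (hM : IsNormMaximal (image O))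
    (hO : Submodule.span ℚ (O : Set A) = ⊤) {a : A} (ha : a ∈ O) (x : ℍ[ℝ] × ℝ) :
    cuspDist O (a : OnePoint A) x = (normSq (x.1 - (a : ℍ[ℝ])) + x.2 ^ 2) / x.2 := by
  obtain ⟨N, hN⟩ := exists_isDenominator h hM hO a
  rw [cuspDist_coe hN, hN.eq_one ha]
  simp

/-- Evaluation at the heights 1 and 2 above a finite cusp separates distance functions. -/
theorem cuspDist_injective (h : HasIntegralBasis (image O) e) (hM : IsNormMaximal (image O))
    (hO : Submodule.span ℚ (O : Set A) = ⊤)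
    (heq : ∀ x : ℍ[ℝ] × ℝ, 0 < x.2 → cuspDist O α x = cuspDist O β x) : α = β := by
  have key : ∀ b : A, ¬ ∀ x : ℍ[ℝ] × ℝ, 0 < x.2 →
      cuspDist O OnePoint.infty x = cuspDist O (b : OnePoint A) x := fun b heq => by
    obtain ⟨N, hN⟩ := exists_isDenominator h hM hO b
    have h1 := heq (b, 1) one_pos
    have h2 := heq (b, 2) two_pos
    rw [cuspDist_infty, cuspDist_coe hN] at h1 h2
    simp only [sub_self, map_zero] at h1 h2
    linarith
  induction α using OnePoint.rec with
  | infty =>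
    induction β using OnePoint.rec with
    | infty => rfl
    | coe b => exact absurd heq (key b)
  | coe a =>
    induction β using OnePoint.rec with
    | infty => exact absurd (fun x hx => (heq x hx).symm) (key a)
    | coe b =>
      obtain ⟨N, hN⟩ := exists_isDenominator h hM hO a
      obtain ⟨M, hM⟩ := exists_isDenominator h hM hO b
      have h1 := heq (a, 1) one_pos
      have h2 := heq (a, 2) two_pos
      rw [cuspDist_coe hN, cuspDist_coe hM] at h1 h2
      simp only [sub_self, map_zero] at h1 h2
      have hM0 : (0 : ℝ) < M := by exact_mod_cast hM.pos
      have h3 : normSq ((a : ℍ[ℝ]) - (b : ℍ[ℝ])) = 0 := by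
        have : (M : ℝ) * normSq ((a : ℍ[ℝ]) - (b : ℍ[ℝ])) = 0 := by linarith
        exact (mul_eq_zero.mp this).resolve_left hM0.ne'
      rw [Quaternion.normSq_eq_zero, sub_eq_zero] at h3
      rw [Subtype.ext h3]

end

/-! ### The fundamental cell -/

section

variable {A : Subalgebra ℚ ℍ[ℝ]} {O : Subring A} {e : Fin 4 → ℍ[ℝ]} {α β : OnePoint A}
  {g g' : Matrix (Fin 2) (Fin 2) ℍ[ℝ]} {u v : ℍ[ℝ]}

theorem one_le_of_mem_fordVoronoiCell_infty (h : HasIntegralBasis (image O) e)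
    (hM : IsNormMaximal (image O)) (hO : Submodule.span ℚ (O : Set A) = ⊤) {x : ℍ[ℝ] × ℝ}
    (hx : x ∈ fordVoronoiCell O OnePoint.infty) {q : ℍ[ℝ]} (hq : q ∈ image O) :
    1 ≤ normSq (x.1 - q) + x.2 ^ 2 := by
  obtain ⟨q, hqO, rfl⟩ := mem_image.mp hq
  have h1 := hx.2 q
  rw [cuspDist_infty, cuspDist_of_mem h hM hO hqO, div_le_div_iff_of_pos_right hx.1] at h1
  exact h1

theorem mem_fordVoronoiCell_infty (h : HasIntegralBasis (image O) e)
    (hM : IsNormMaximal (image O)) (hO : Submodule.span ℚ (O : Set A) = ⊤)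
    (hF : HasFloor (image O)) {x : ℍ[ℝ] × ℝ} (hx : 0 < x.2)
    (hq : ∀ q ∈ image O, 1 ≤ normSq (x.1 - q) + x.2 ^ 2) :
    x ∈ fordVoronoiCell O OnePoint.infty := by
  refine ⟨hx, fun β => ?_⟩
  induction β using OnePoint.rec with
  | infty => exact le_rfl
  | coe b =>
    obtain ⟨N, hN⟩ := exists_isDenominator h hM hO b
    obtain ⟨p, hp, μ, hμ, hle⟩ := hF b N hN.pos hN.smul_mem hN.exists_normSq
    have hN0 : (0 : ℝ) < N := by exact_mod_cast hN.pos
    have h1 : 1 / (N : ℝ) ≤ normSq (x.1 - (b : ℍ[ℝ])) + x.2 ^ 2 := by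
      have := hle x.1 x.2 hq
      have := mul_nonneg hμ.le (sub_nonneg.mpr (hq p hp))
      linarith
    rw [cuspDist_infty, cuspDist_coe hN, div_le_div_iff_of_pos_right hx]
    rwa [div_le_iff₀' hN0] at h1

/-- Equality of the distances to 0 and ∞ means lying on the unit hemisphere at 0. A point z of the
Voronoi cell has norm less than 1, because some lattice point is that close, so it lifts to height
√(1 - n(z)), and by the floor property this lift lies in the cell of ∞. -/
theorem image_fst_fundamentalCell (h : HasIntegralBasis (image O) e)
    (hM : IsNormMaximal (image O)) (hO : Submodule.span ℚ (O : Set A) = ⊤)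
    (hF : HasFloor (image O)) (hcov : ∀ x, ∃ p ∈ image O, normSq (x - p) < 1) :
    Prod.fst '' fundamentalCell O = latticeVoronoiCell O := by
  have hdist : ∀ x y : ℍ[ℝ], dist x y ^ 2 = normSq (x - y) := fun x y => by
    rw [dist_eq_norm, Quaternion.normSq_eq_norm_mul_self, sq]
  have hiff : ∀ x y z : ℍ[ℝ], dist z x ≤ dist z y ↔ normSq (z - x) ≤ normSq (z - y) :=
    fun x y z => by rw [← hdist, ← hdist, pow_le_pow_iff_left₀ dist_nonneg dist_nonneg two_ne_zero]
  have h0 : ∀ x : ℍ[ℝ] × ℝ, cuspDist O ((0 : A) : OnePoint A) x = (normSq x.1 + x.2 ^ 2) / x.2 :=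
    fun x => by rw [cuspDist_of_mem h hM hO (zero_mem O)]; simp
  ext z
  constructor
  · rintro ⟨x, ⟨h1, h2⟩, rfl⟩ q hq
    rw [hiff, sub_zero]
    have h3 := h1.2 OnePoint.infty
    rw [h0, cuspDist_infty, div_le_div_iff_of_pos_right h2.1] at h3
    linarith [one_le_of_mem_fordVoronoiCell_infty h hM hO h2 (coe_mem_image.mpr hq)]
  · intro hz
    have hz' : ∀ q ∈ image O, normSq z ≤ normSq (z - q) := by
      intro q hq
      obtain ⟨q, hqO, rfl⟩ := mem_image.mp hq
      have := hz q hqO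
      rwa [hiff, sub_zero] at this
    obtain ⟨p, hp, hlt⟩ := hcov z
    have hz1 : 0 < 1 - normSq z := by linarith [hz' p hp]
    have hr : 0 < Real.sqrt (1 - normSq z) := Real.sqrt_pos.mpr hz1
    have hsq : Real.sqrt (1 - normSq z) ^ 2 = 1 - normSq z := Real.sq_sqrt hz1.le
    have hinf : (z, Real.sqrt (1 - normSq z)) ∈ fordVoronoiCell O OnePoint.infty :=
      mem_fordVoronoiCell_infty h hM hO hF hr fun q hq => by
        simp only [hsq]
        linarith [hz' q hq]
    refine ⟨(z, Real.sqrt (1 - normSq z)), ⟨⟨hr, fun β => ?_⟩, hinf⟩, rfl⟩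
    have : cuspDist O ((0 : A) : OnePoint A) (z, Real.sqrt (1 - normSq z)) =
        cuspDist O OnePoint.infty (z, Real.sqrt (1 - normSq z)) := by
      rw [h0, cuspDist_infty]
      simp only [hsq]
      ring
    rw [this]
    exact hinf.2 β

/-! ### Transitivity for Euclidean orders -/

/-- A wall of the Ford-Voronoi cell of `∞` separates it from the cell of an element of the order
when the floor consists of unit hemispheres. -/
theorem IsWall.mem_of_hasFloor {b : A} (hw : IsWall O OnePoint.infty (b : OnePoint A))
    (h : HasIntegralBasis (image O) e) (hM : IsNormMaximal (image O))
    (hO : Submodule.span ℚ (O : Set A) = ⊤) (hF : HasFloor (image O)) : b ∈ O := by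
  obtain ⟨U, hU, ⟨⟨z, r⟩, hxU, hr, hx⟩, hsub⟩ := hw
  simp only at hr
  obtain ⟨N, hN⟩ := exists_isDenominator h hM hO b
  obtain ⟨p, hp, μ, hμ, hle⟩ := hF b N hN.pos hN.smul_mem hN.exists_normSq
  have hN0 : (0 : ℝ) < N := by exact_mod_cast hN.pos
  have heq : ∀ x : ℍ[ℝ] × ℝ, 0 < x.2 → (cuspDist O OnePoint.infty x = cuspDist O (b : OnePoint A) x
      ↔ normSq (x.1 - (b : ℍ[ℝ])) + x.2 ^ 2 = 1 / N) := fun x hx => by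
    rw [cuspDist_infty, cuspDist_coe hN, div_left_inj' hx.ne', eq_div_iff hN0.ne', eq_comm,
      mul_comm]
  -- On the wall the right side of the floor inequality is 0, so the point also lies on the unit
  -- hemisphere centred at p.
  have key : ∀ x ∈ U, 0 < x.2 → normSq (x.1 - (b : ℍ[ℝ])) + x.2 ^ 2 = 1 / N →
      normSq (x.1 - p) + x.2 ^ 2 = 1 := fun x hxU hx0 hx => by
    have h1 := (hsub ⟨hxU, hx0, (heq x hx0).mpr hx⟩).1
    have h2 := fun q hq => one_le_of_mem_fordVoronoiCell_infty h hM hO h1 (q := q) hq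
    have h3 := hle x.1 x.2 h2
    rw [hx, sub_self] at h3
    have h4 := nonpos_of_mul_nonpos_right h3 hμ
    linarith [h2 p hp]
  rw [heq _ hr] at hx
  simp only at hx
  set w : ℍ[ℝ] := b - p with hw
  -- A path on the hemisphere of b moving in the direction w = b - p. Along it n(z - p) + r² varies
  -- linearly in t with slope 2n(w); being constant near t = 0, it forces w = 0.
  let f : ℝ → ℍ[ℝ] × ℝ := fun t =>
    (z + t • w, Real.sqrt (1 / N - normSq (z + t • w - (b : ℍ[ℝ]))))
  have hg : Continuous fun t : ℝ => 1 / (N : ℝ) - normSq (z + t • w - (b : ℍ[ℝ])) := by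
    have := Quaternion.continuous_normSq
    fun_prop
  have hf : Continuous f := by
    refine Continuous.prodMk (by fun_prop) (Real.continuous_sqrt.comp hg)
  have hf0 : f 0 = (z, r) := by
    simp only [f, zero_smul, add_zero]
    rw [← hx, add_sub_cancel_left, Real.sqrt_sq hr.le]
  have hev1 : ∀ᶠ t in nhds (0 : ℝ), f t ∈ U :=
    hf.continuousAt.eventually_mem (by rw [hf0]; exact hU.mem_nhds hxU)
  have hev2 : ∀ᶠ t in nhds (0 : ℝ), 0 < 1 / (N : ℝ) - normSq (z + t • w - (b : ℍ[ℝ])) := by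
    refine hg.continuousAt.eventually_mem (isOpen_Ioi.mem_nhds ?_)
    simp only [zero_smul, add_zero, Set.mem_Ioi]
    rw [← hx, add_sub_cancel_left]
    positivity
  obtain ⟨t, ⟨ht1, ht2⟩, ht0⟩ :=
    (((hev1.and hev2).filter_mono nhdsWithin_le_nhds).and
      (self_mem_nhdsWithin (a := (0 : ℝ)) (s := {0}ᶜ))).exists
  have k1 := key (z, r) hxU hr hx
  have hft : normSq ((f t).1 - (b : ℍ[ℝ])) + (f t).2 ^ 2 = 1 / N := by
    simp only [f]
    rw [Real.sq_sqrt ht2.le]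
    ring
  have k2 := key (f t) ht1 (Real.sqrt_pos.mpr ht2) hft
  have e1 : (f t).1 - p = ((f t).1 - (b : ℍ[ℝ])) + w := by rw [hw]; abel
  have e2 : z - p = (z - (b : ℍ[ℝ])) + w := by rw [hw]; abel
  simp only at k1
  rw [e1, normSq_add_eq] at k2
  rw [e2, normSq_add_eq] at k1
  have e3 : (f t).1 - (b : ℍ[ℝ]) = (z - (b : ℍ[ℝ])) + t • w := by simp only [f]; abel
  have e4 : tr (((f t).1 - (b : ℍ[ℝ])) * star w) =
      tr ((z - (b : ℍ[ℝ])) * star w) + t * (2 * normSq w) := by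
    rw [e3, add_mul, tr_add, smul_mul_assoc, tr_smul, Quaternion.self_mul_star, tr_coe]
  rw [e4] at k2
  have h5 : t * (2 * normSq w) = 0 := by linarith
  have h6 : normSq w = 0 := by
    rcases mul_eq_zero.mp h5 with h6 | h6
    · exact absurd h6 ht0
    · linarith
  rw [Quaternion.normSq_eq_zero, hw, sub_eq_zero] at h6
  rw [← coe_mem_image, h6]
  exact hp

/-- Translations by elements of the order and the inversion. -/
def IsElementary (O : Subring A) (g : Matrix (Fin 2) (Fin 2) ℍ[ℝ]) : Prop :=
  (∃ t ∈ image O, g = !![1, t; 0, 1]) ∨ g = !![0, -1; 1, 0] ∨ g = !![0, 1; -1, 0]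

theorem sqDet_neg_left (a b c d : ℍ[ℝ]) : sqDet (-a) (-b) c d = sqDet a b c d := by
  simp [sqDet]

theorem IsElementary.mul_mem (hg : IsElementary O g) (hg' : g' ∈ SL2 O) : g * g' ∈ SL2 O := by
  obtain ⟨hdet, hm⟩ := mem_SL2_iff.mp hg'
  refine mem_SL2_iff.mpr ?_
  have he : ∀ i j, (g * g') i j = g i 0 * g' 0 j + g i 1 * g' 1 j := fun i j => by
    rw [Matrix.mul_apply, Fin.sum_univ_two]
  simp only [he]
  rcases hg with ⟨t, ht, rfl⟩ | rfl | rfl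
  · refine ⟨?_, fun i j => ?_⟩
    · simp only [Matrix.of_apply, Matrix.cons_val, one_mul, zero_mul, zero_add]
      rw [sqDet_row, hdet]
    · fin_cases i
      · simpa using add_mem (hm 0 j) ((image O).mul_mem ht (hm 1 j))
      · simpa using hm 1 j
  · refine ⟨?_, fun i j => ?_⟩
    · simp only [Matrix.of_apply, Matrix.cons_val, one_mul, zero_mul, zero_add, add_zero, neg_mul]
      rw [sqDet_neg_left, sqDet_swap, hdet]
    · fin_cases i
      · simpa using hm 1 j
      · simpa using hm 0 j
  · refine ⟨?_, fun i j => ?_⟩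
    · simp only [Matrix.of_apply, Matrix.cons_val, one_mul, zero_mul, zero_add, add_zero, neg_mul]
      rw [sqDet_swap, sqDet_neg_left, hdet]
    · fin_cases i
      · simpa using hm 1 j
      · simpa using hm 0 j

theorem IsElementary.mem_SL2 (hg : IsElementary O g) : g ∈ SL2 O := by
  simpa using hg.mul_mem one_mem_SL2

theorem IsElementary.exists_inverse (hg : IsElementary O g) :
    ∃ g', IsElementary O g' ∧ g * g' = 1 ∧ g' * g = 1 := by
  rcases hg with ⟨t, ht, rfl⟩ | rfl | rfl
  · refine ⟨!![1, -t; 0, 1], Or.inl ⟨-t, neg_mem ht, rfl⟩, ?_, ?_⟩ <;>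
      simp [Matrix.one_fin_two]
  · refine ⟨!![0, 1; -1, 0], Or.inr (Or.inr rfl), ?_, ?_⟩ <;>
      simp [Matrix.one_fin_two]
  · refine ⟨!![0, -1; 1, 0], Or.inr (Or.inl rfl), ?_, ?_⟩ <;>
      simp [Matrix.one_fin_two]

/-- The set `C'` is the image of `C` by an elementary matrix. -/
def IsMove (O : Subring A) (C C' : Set (ℍ[ℝ] × ℝ)) : Prop :=
  (∀ x ∈ C, 0 < x.2) ∧ ∃ g, IsElementary O g ∧ act g '' C = C'

theorem IsMove.symm (h : HasIntegralBasis (image O) e) {C C' : Set (ℍ[ℝ] × ℝ)}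
    (hC : IsMove O C C') : IsMove O C' C := by
  obtain ⟨h0, g, hg, rfl⟩ := hC
  obtain ⟨g', hg', h1, h2⟩ := hg.exists_inverse
  refine ⟨?_, g', hg', ?_⟩
  · rintro _ ⟨x, hx, rfl⟩
    exact act_pos hg.mem_SL2 (h0 x hx)
  · rw [Set.image_image]
    refine (Set.image_congr fun x hx => ?_).trans (Set.image_id C)
    exact act_act_inverse h hg'.mem_SL2 hg.mem_SL2 h2 (h0 x hx)

theorem exists_act_of_reflTransGen (h : HasIntegralBasis (image O) e) {C C' : Set (ℍ[ℝ] × ℝ)}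
    (hC : ∀ x ∈ C, 0 < x.2) (hr : Relation.ReflTransGen (IsMove O) C C') :
    ∃ g ∈ SL2 O, act g '' C = C' := by
  induction hr with
  | refl => exact ⟨1, one_mem_SL2, by simp [act_one]⟩
  | tail _ hm ih =>
    obtain ⟨g, hg, rfl⟩ := ih
    obtain ⟨-, k, hk, rfl⟩ := hm
    refine ⟨k * g, hk.mul_mem hg, ?_⟩
    rw [Set.image_image]
    exact Set.image_congr fun x hx => act_mul h hk.mem_SL2 hg (hk.mul_mem hg) (hC x hx)

theorem IsElementary.exists_move (hg : IsElementary O g) (h : HasIntegralBasis (image O) e)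
    (hM : IsNormMaximal (image O)) (hO : Submodule.span ℚ (O : Set A) = ⊤) (hne : α ≠ β)
    (hw : IsWall O α β) (hu : u ∈ image O) (hv : v ∈ image O) (hα : IsRep α u v) :
    ∃ α' β', IsRep α' (g 0 0 * u + g 0 1 * v) (g 1 0 * u + g 1 1 * v) ∧ α' ≠ β' ∧ IsWall O α' β' ∧
      IsMove O (fordVoronoiCell O α ∩ fordVoronoiCell O β)
        (fordVoronoiCell O α' ∩ fordVoronoiCell O β') := by
  obtain ⟨g', hg', hgg', hg'g⟩ := hg.exists_inverse
  obtain ⟨α', hα', hα''⟩ := exists_map_isRep h hM hO hg.mem_SL2 hu hv hα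
  obtain ⟨β', hβ'⟩ := exists_map_cusp h hM hO hg.mem_SL2 β
  refine ⟨α', β', hα', ?_, hw.act h hM hO hg.mem_SL2 hg'.mem_SL2 hgg' hg'g hα'' hβ',
    fun x hx => hx.1.1, g, hg,
    image_fordVoronoiCell_inter h hM hO hg.mem_SL2 hg'.mem_SL2 hgg' hα'' hβ'⟩
  rintro rfl
  exact hne (cuspDist_injective h hM hO fun x hx => by rw [← hα'' x hx, hβ' x hx])

/-- Euclid's algorithm on a vector representing α: a translation replaces u by a remainder modulo v,
the inversion exchanges the entries, and n(v) drops by at least 1. When v = 0 the cusp is ∞, its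
neighbour lies in O by the floor property, and one translation moves that neighbour to 0. -/
theorem reflTransGen_fundamentalCell (h : HasIntegralBasis (image O) e)
    (hM : IsNormMaximal (image O)) (hO : Submodule.span ℚ (O : Set A) = ⊤)
    (hE : IsEuclid (image O)) (hF : HasFloor (image O)) (n : ℕ) : ∀ {α β : OnePoint A} {u v : ℍ[ℝ]},
    α ≠ β → IsWall O α β → u ∈ image O → v ∈ image O → IsRep α u v → normSq v ≤ n →
    Relation.ReflTransGen (IsMove O) (fordVoronoiCell O α ∩ fordVoronoiCell O β)
      (fundamentalCell O) := by
  induction n with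
  | zero =>
    intro α β u v hne hw hu hv hα hn
    rw [Nat.cast_zero] at hn
    have hv0 : v = 0 := Quaternion.normSq_eq_zero.mp (le_antisymm hn Quaternion.normSq_nonneg)
    rcases hα with ⟨-, hu0, rfl⟩ | ⟨h0, -⟩
    swap
    · exact absurd hv0 h0
    induction β using OnePoint.rec with
    | infty => exact absurd rfl hne
    | coe b =>
      have hb := hw.mem_of_hasFloor h hM hO hF
      have hT : IsElementary O !![1, -(b : ℍ[ℝ]); 0, 1] :=
        Or.inl ⟨_, neg_mem (coe_mem_image.mpr hb), rfl⟩
      obtain ⟨T', hT', hTT', -⟩ := hT.exists_inverse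
      have h1 := fun x hx => cuspDist_act h hM hO hT.mem_SL2 (isRep_infty (A := A))
        (β := OnePoint.infty) (by simpa using isRep_infty) (x := x) hx
      have h2 := fun x hx => cuspDist_act h hM hO hT.mem_SL2 (isRep_coe b)
        (β := ((0 : A) : OnePoint A)) (by simpa using isRep_coe (0 : A)) (x := x) hx
      refine Relation.ReflTransGen.single ⟨fun x hx => hx.1.1, _, hT, ?_⟩
      rw [image_fordVoronoiCell_inter h hM hO hT.mem_SL2 hT'.mem_SL2 hTT' h1 h2, Set.inter_comm]
      rfl
  | succ n ih =>
    intro α β u v hne hw hu hv hα hn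
    by_cases hv0 : v = 0
    · exact ih hne hw hu hv hα (by rw [hv0, map_zero]; positivity)
    obtain ⟨c, hc, hlt⟩ := hE u hu v hv hv0
    have hT : IsElementary O !![1, -c; 0, 1] := Or.inl ⟨_, neg_mem hc, rfl⟩
    have hS : IsElementary O !![0, -1; 1, 0] := Or.inr (Or.inl rfl)
    obtain ⟨α₁, β₁, hα₁, hne₁, hw₁, hm₁⟩ := hT.exists_move h hM hO hne hw hu hv hα
    simp only [Matrix.of_apply, Matrix.cons_val, one_mul, zero_mul, zero_add, neg_mul,
      ← sub_eq_add_neg] at hα₁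
    have hu₁ : u - c * v ∈ image O := sub_mem hu (mul_mem hc hv)
    obtain ⟨α₂, β₂, hα₂, hne₂, hw₂, hm₂⟩ := hS.exists_move h hM hO hne₁ hw₁ hu₁ hv hα₁
    simp only [Matrix.of_apply, Matrix.cons_val, one_mul, zero_mul, zero_add, neg_mul,
      add_zero] at hα₂
    refine .head hm₁ (.head hm₂ (ih hne₂ hw₂ (neg_mem hv) hu₁ hα₂ ?_))
    obtain ⟨k, hk⟩ := h.exists_normSq_eq hu₁
    obtain ⟨l, hl⟩ := h.exists_normSq_eq hv
    rw [hk, hl] at hlt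
    rw [hl] at hn
    rw [hk]
    have h1 : k < l := by exact_mod_cast hlt
    have h2 : l ≤ n + 1 := by exact_mod_cast hn
    exact_mod_cast (by omega : k ≤ n)

theorem isTransitiveOnFourCells_of_isEuclid (h : HasIntegralBasis (image O) e)
    (hM : IsNormMaximal (image O)) (hO : Submodule.span ℚ (O : Set A) = ⊤)
    (hE : IsEuclid (image O)) (hF : HasFloor (image O)) : IsTransitiveOnFourCells O := by
  have key : ∀ C, IsFourCell O C → (∀ x ∈ C, 0 < x.2) ∧
      Relation.ReflTransGen (IsMove O) C (fundamentalCell O) := by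
    intro C hC
    obtain ⟨α, β, hne, rfl, hw⟩ := isFourCell_iff.mp hC
    obtain ⟨u, hu, v, hv, hα⟩ := exists_isRep_mem h hM hO α
    obtain ⟨n, hn⟩ := exists_nat_ge (normSq v)
    exact ⟨fun x hx => hx.1.1, reflTransGen_fundamentalCell h hM hO hE hF n hne hw hu hv hα hn⟩
  intro C C' hC hC'
  obtain ⟨h0, h1⟩ := key C hC
  obtain ⟨-, h2⟩ := key C' hC'
  have : Std.Symm (IsMove O) := ⟨fun _ _ => IsMove.symm h⟩
  exact exists_act_of_reflTransGen h h0 (h1.trans (Relation.ReflTransGen.stdSymm.symm _ _ h2))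

end

/-! ### Transitivity implies the existence of a Euclidean division -/

section

variable {A : Subalgebra ℚ ℍ[ℝ]} {O : Subring A} {e : Fin 4 → ℍ[ℝ]} {α β : OnePoint A}
  {g g' : Matrix (Fin 2) (Fin 2) ℍ[ℝ]} {u v : ℍ[ℝ]}

theorem finite_normSq_le (h : HasIntegralBasis (image O) e) (C : ℝ) :
    {x | x ∈ image O ∧ normSq x ≤ C}.Finite := by
  let B : Module.Basis (Fin 4) ℝ ℍ[ℝ] := basisOfLinearIndependentOfCardEqFinrank h.li
    (by rw [Quaternion.finrank_eq_four]; rfl)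
  have hB : ⇑B = e := by simp [B]
  have hb : Bornology.IsBounded {x : ℍ[ℝ] | normSq x ≤ C} := by
    refine (Metric.isBounded_closedBall (x := (0 : ℍ[ℝ])) (r := Real.sqrt C)).subset fun x hx => ?_
    rw [mem_closedBall_zero_iff]
    refine Real.le_sqrt_of_sq_le ?_
    rw [sq, ← Quaternion.normSq_eq_norm_mul_self]
    exact hx
  refine (ZSpan.setFinite_inter B hb).subset ?_
  rintro x ⟨hx, hxC⟩
  refine ⟨hxC, ?_⟩
  obtain ⟨c, rfl⟩ := (h.mem x).mp hx
  rw [hB]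
  refine Submodule.sum_mem _ fun i _ => ?_
  rw [Int.cast_smul_eq_zsmul]
  exact Submodule.smul_mem _ _ (Submodule.subset_span ⟨i, rfl⟩)

/-- The height above `z`, squared, of the hemisphere of centre `γ` equidistant to `γ` and `∞`. -/
def floorHeight (N : A → ℕ) (γ : A) (z : ℍ[ℝ]) : ℝ := 1 / N γ - normSq (z - (γ : ℍ[ℝ]))

theorem continuous_floorHeight (N : A → ℕ) (γ : A) : Continuous (floorHeight N γ) := by
  have := Quaternion.continuous_normSq
  unfold floorHeight
  fun_prop

variable {N : A → ℕ}

theorem cuspDist_infty_le_iff (hN : ∀ α, IsDenominator O α (N α)) {x : ℍ[ℝ] × ℝ} (hx : 0 < x.2)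
    (γ : A) : cuspDist O OnePoint.infty x ≤ cuspDist O (γ : OnePoint A) x ↔
      floorHeight N γ x.1 ≤ x.2 ^ 2 := by
  have hN0 : (0 : ℝ) < N γ := by exact_mod_cast (hN γ).pos
  rw [cuspDist_infty, cuspDist_coe (hN γ), div_le_div_iff_of_pos_right hx, floorHeight,
    sub_le_iff_le_add', div_le_iff₀' hN0]

theorem cuspDist_infty_eq_iff (hN : ∀ α, IsDenominator O α (N α)) {x : ℍ[ℝ] × ℝ} (hx : 0 < x.2)
    (γ : A) : cuspDist O OnePoint.infty x = cuspDist O (γ : OnePoint A) x ↔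
      x.2 ^ 2 = floorHeight N γ x.1 := by
  have hN0 : (0 : ℝ) < N γ := by exact_mod_cast (hN γ).pos
  rw [cuspDist_infty, cuspDist_coe (hN γ), div_left_inj' hx.ne', floorHeight,
    eq_sub_iff_add_eq', eq_div_iff hN0.ne', eq_comm, mul_comm]

/-- Local finiteness: a height at least τ bounds the denominator by 1/τ and keeps γ near z, so the
multiples Nγ run through finitely many lattice points. -/
theorem exists_max_floorHeight (h : HasIntegralBasis (image O) e)
    (hN : ∀ α, IsDenominator O α (N α)) {β : A} {z : ℍ[ℝ]} (hβ : 0 < floorHeight N β z) :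
    ∃ γ, ∀ γ', floorHeight N γ' z ≤ floorHeight N γ z := by
  set τ := floorHeight N β z with hτ
  obtain ⟨M, hM⟩ := exists_nat_ge (1 / τ)
  have hfin : {γ : A | τ ≤ floorHeight N γ z}.Finite := by
    have hsub : {γ : A | τ ≤ floorHeight N γ z} ⊆ ⋃ n ∈ Finset.Icc 1 M,
        (fun γ : A => (n : ℝ) • (γ : ℍ[ℝ])) ⁻¹'
          {x | x ∈ image O ∧ normSq x ≤ (M : ℝ) ^ 2 * (2 * normSq z + 2)} ∩ {γ | N γ = n} := by
      intro γ hγ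
      have hN0 : (0 : ℝ) < N γ := by exact_mod_cast (hN γ).pos
      have hN1 : (1 : ℝ) ≤ N γ := by exact_mod_cast (hN γ).pos
      have hγ' : τ ≤ 1 / N γ - normSq (z - (γ : ℍ[ℝ])) := hγ
      have h1 : τ ≤ 1 / N γ := by linarith [Quaternion.normSq_nonneg (a := z - (γ : ℍ[ℝ]))]
      have hNM : (N γ : ℝ) ≤ M := by
        refine le_trans ?_ hM
        rwa [le_div_iff₀ hβ, mul_comm, ← le_div_iff₀ hN0]
      have h2 : normSq (z - (γ : ℍ[ℝ])) ≤ 1 := by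
        have : 1 / (N γ : ℝ) ≤ 1 := by rw [div_le_one hN0]; exact hN1
        linarith
      refine Set.mem_biUnion (x := N γ) ?_ ⟨⟨(hN γ).smul_mem, ?_⟩, rfl⟩
      · rw [Finset.mem_coe, Finset.mem_Icc]
        exact ⟨(hN γ).pos, by exact_mod_cast hNM⟩
      · rw [Quaternion.normSq_smul]
        have h3 : normSq (γ : ℍ[ℝ]) ≤ 2 * normSq z + 2 := by
          have h5 : (γ : ℍ[ℝ]) = z - (z - (γ : ℍ[ℝ])) := by abel
          have h6 := normSq_sub_eq (x := z) (y := z - (γ : ℍ[ℝ]))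
          have h7 := normSq_add_eq (x := z) (y := z - (γ : ℍ[ℝ]))
          have h8 := Quaternion.normSq_nonneg (a := z + (z - (γ : ℍ[ℝ])))
          rw [← h5] at h6
          linarith
        have h4 : (N γ : ℝ) ^ 2 ≤ (M : ℝ) ^ 2 := pow_le_pow_left₀ hN0.le hNM 2
        exact mul_le_mul h4 h3 Quaternion.normSq_nonneg (sq_nonneg _)
    refine Set.Finite.subset (Set.Finite.biUnion (Finset.finite_toSet _) fun n hn => ?_) hsub
    rw [Finset.mem_coe, Finset.mem_Icc] at hn
    have hn0 : (n : ℝ) ≠ 0 := by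
      have : n ≠ 0 := by omega
      exact_mod_cast this
    refine Set.Finite.inter_of_left (Set.Finite.preimage ?_ (finite_normSq_le h _)) _
    intro x _ y _ hxy
    exact Subtype.ext (smul_right_injective ℍ[ℝ] hn0 hxy)
  obtain ⟨γ, hγ, hmax⟩ := Set.exists_max_image _ (fun γ => floorHeight N γ z) hfin ⟨β, le_refl τ⟩
  refine ⟨γ, fun γ' => ?_⟩
  by_cases hγ' : τ ≤ floorHeight N γ' z
  · exact hmax γ' hγ'
  · exact (not_le.mp hγ').le.trans hγ

/-- Near β the floor is the maximum of countably many heights, and the sets on which a given one is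
maximal are closed and cover the ball. By Baire's theorem one of them has interior points, which
gives a piece of a wall between ∞ and the corresponding cusp. -/
theorem exists_wall_of_not_covered [Countable A] (h : HasIntegralBasis (image O) e)
    (hN : ∀ α, IsDenominator O α (N α)) {β : A}
    (hβ : ∀ q ∈ image O, 1 ≤ normSq ((β : ℍ[ℝ]) - q)) :
    ∃ γ : A, γ ∉ O ∧ IsWall O OnePoint.infty (γ : OnePoint A) := by
  have hNβ : (0 : ℝ) < N β := by exact_mod_cast (hN β).pos
  have hNβ1 : (1 : ℝ) ≤ N β := by exact_mod_cast (hN β).pos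
  -- On the ball of radius δ the hemisphere of β has squared height at least 4δ - δ², while a
  -- lattice hemisphere, centred at distance at least 1 from β, has at most 1 - (1 - δ)² = 2δ - δ².
  set δ : ℝ := 1 / (4 * N β) with hδ
  have hδ0 : 0 < δ := by positivity
  have hδN : 1 / (N β : ℝ) = 4 * δ := by rw [hδ]; field_simp
  have hδ1 : δ ≤ 1 / 4 := by
    rw [hδ]; gcongr; linarith
  have hball : ∀ z ∈ Metric.ball (β : ℍ[ℝ]) δ, 4 * δ - δ ^ 2 ≤ floorHeight N β z := by
    intro z hz
    rw [mem_ball_iff_norm] at hz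
    rw [floorHeight, hδN, Quaternion.normSq_eq_norm_mul_self]
    have := norm_nonneg (z - (β : ℍ[ℝ]))
    nlinarith
  -- The complement of the ball is added so that the closed sets cover all of ℍ, as Baire's theorem
  -- requires.
  let K : Option A → Set ℍ[ℝ]
    | none => (Metric.ball (β : ℍ[ℝ]) δ)ᶜ
    | some γ => {z | ∀ γ', floorHeight N γ' z ≤ floorHeight N γ z}
  have hK : ∀ i, IsClosed (K i) := by
    rintro (_ | γ)
    · exact Metric.isOpen_ball.isClosed_compl
    · have : K (some γ) = ⋂ γ', {z | floorHeight N γ' z ≤ floorHeight N γ z} := by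
        ext z; simp [K]
      rw [this]
      exact isClosed_iInter fun γ' =>
        isClosed_le (continuous_floorHeight N γ') (continuous_floorHeight N γ)
  have hU : ⋃ i, K i = Set.univ := by
    refine Set.eq_univ_of_forall fun z => Set.mem_iUnion.mpr ?_
    by_cases hz : z ∈ Metric.ball (β : ℍ[ℝ]) δ
    · obtain ⟨γ, hγ⟩ := exists_max_floorHeight h hN (β := β) (z := z) (by
        have := hball z hz
        nlinarith)
      exact ⟨some γ, hγ⟩
    · exact ⟨none, hz⟩
  obtain ⟨z, hz, hzi⟩ := (dense_iUnion_interior_of_closed hK hU).inter_open_nonempty _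
    Metric.isOpen_ball ⟨(β : ℍ[ℝ]), Metric.mem_ball_self hδ0⟩
  obtain ⟨i, hi⟩ := Set.mem_iUnion.mp hzi
  rcases i with _ | γ
  · exact absurd hz (interior_subset hi)
  have hmax : ∀ γ', floorHeight N γ' z ≤ floorHeight N γ z := interior_subset hi
  have hpos : 4 * δ - δ ^ 2 ≤ floorHeight N γ z := (hball z hz).trans (hmax β)
  refine ⟨γ, fun hγ => ?_, ?_⟩
  · have h1 := hβ γ (coe_mem_image.mpr hγ)
    rw [floorHeight, (hN γ).eq_one hγ] at hpos
    rw [mem_ball_iff_norm] at hz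
    rw [Quaternion.normSq_eq_norm_mul_self] at h1 hpos
    have h2 : ‖(β : ℍ[ℝ]) - (γ : ℍ[ℝ])‖ ≤ ‖z - (γ : ℍ[ℝ])‖ + ‖z - (β : ℍ[ℝ])‖ := by
      have := norm_sub_le (z - (γ : ℍ[ℝ])) (z - (β : ℍ[ℝ]))
      rwa [sub_sub_sub_cancel_left] at this
    have h3 : 1 ≤ ‖(β : ℍ[ℝ]) - (γ : ℍ[ℝ])‖ := by
      by_contra! hlt
      nlinarith [norm_nonneg ((β : ℍ[ℝ]) - (γ : ℍ[ℝ]))]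
    have h4 : 1 - δ ≤ ‖z - (γ : ℍ[ℝ])‖ := by linarith
    norm_num at hpos
    nlinarith
  · have hz0 : 0 < floorHeight N γ z := by nlinarith
    have hr := Real.sqrt_pos.mpr hz0
    refine ⟨Prod.fst ⁻¹' interior (K (some γ)), isOpen_interior.preimage continuous_fst,
      ⟨(z, Real.sqrt (floorHeight N γ z)), hi, hr, ?_⟩, ?_⟩
    · rw [cuspDist_infty_eq_iff hN hr]
      exact Real.sq_sqrt hz0.le
    · rintro x ⟨hxi, hx, heq⟩
      have hxK : ∀ γ', floorHeight N γ' x.1 ≤ floorHeight N γ x.1 := interior_subset hxi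
      have hinf : ∀ δ : OnePoint A, cuspDist O OnePoint.infty x ≤ cuspDist O δ x := by
        intro δ
        induction δ using OnePoint.rec with
        | infty => exact le_rfl
        | coe γ' =>
          rw [cuspDist_infty_le_iff hN hx, (cuspDist_infty_eq_iff hN hx γ).mp heq]
          exact hxK γ'
      exact ⟨⟨hx, hinf⟩, ⟨hx, fun δ => heq ▸ hinf δ⟩⟩

/-- A centre of denominator at least 2 gives squared height at most 1/2, below 15/16; a nonzero
lattice centre has norm at least 1, so z is nearer to 0. -/
theorem floorHeight_le_near_zero (h : HasIntegralBasis (image O) e)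
    (hN : ∀ α, IsDenominator O α (N α)) {z : ℍ[ℝ]} (hz : normSq z ≤ 1 / 16) (γ : A) :
    floorHeight N γ z ≤ 1 - normSq z := by
  have hN1 : 1 ≤ N γ := (hN γ).pos
  have hexp := normSq_sub_eq (x := z) (y := (γ : ℍ[ℝ]))
  rw [floorHeight]
  rcases hN1.eq_or_lt with h1 | h2
  · have hγ : (γ : ℍ[ℝ]) ∈ image O := by simpa [← h1] using (hN γ).smul_mem
    rw [← h1]
    by_cases h0 : (γ : ℍ[ℝ]) = 0
    · rw [h0]; simp
    obtain ⟨m, hm⟩ := h.exists_normSq_eq hγ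
    have hm1 : 1 ≤ m := HasIntegralBasis.one_le_of_normSq_eq h0 hm
    have hm2 : (1 : ℝ) ≤ m := by exact_mod_cast hm1
    have h3 := Quaternion.normSq_nonneg (a := (2 : ℝ) • z - (1 / 2 : ℝ) • (γ : ℍ[ℝ]))
    rw [normSq_sub_eq, Quaternion.normSq_smul, Quaternion.normSq_smul, Quaternion.star_smul,
      smul_mul_assoc, mul_smul_comm, tr_smul, tr_smul] at h3
    norm_num
    linarith
  · have h3 := Quaternion.normSq_nonneg (a := z - (γ : ℍ[ℝ]))
    have h4 : 1 / (N γ : ℝ) ≤ 1 / 2 := by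
      have : (2 : ℝ) ≤ N γ := by exact_mod_cast h2
      gcongr
    linarith

theorem mem_fordVoronoiCell_near_zero (h : HasIntegralBasis (image O) e)
    (hN : ∀ α, IsDenominator O α (N α)) {x : ℍ[ℝ] × ℝ} (hx0 : 0 < x.2)
    (hz : normSq x.1 ≤ 1 / 16) (hx : normSq x.1 + x.2 ^ 2 = 1) :
    x ∈ fordVoronoiCell O OnePoint.infty := by
  refine ⟨hx0, fun γ => ?_⟩
  induction γ using OnePoint.rec with
  | infty => exact le_rfl
  | coe γ =>
    rw [cuspDist_infty_le_iff hN hx0]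
    linarith [floorHeight_le_near_zero h hN hz γ]

theorem isFourCell_fundamentalCell (h : HasIntegralBasis (image O) e)
    (hN : ∀ α, IsDenominator O α (N α)) : IsFourCell O (fundamentalCell O) := by
  have h0 : ∀ x : ℍ[ℝ] × ℝ, 0 < x.2 → (cuspDist O OnePoint.infty x =
      cuspDist O ((0 : A) : OnePoint A) x ↔ normSq x.1 + x.2 ^ 2 = 1) := fun x hx => by
    rw [cuspDist_infty_eq_iff hN hx, floorHeight, (hN 0).eq_one (zero_mem O)]
    simp [eq_sub_iff_add_eq']
  have hw : IsWall O OnePoint.infty ((0 : A) : OnePoint A) := by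
    refine ⟨Prod.fst ⁻¹' {z | normSq z < 1 / 16},
      (isOpen_lt Quaternion.continuous_normSq continuous_const).preimage continuous_fst,
      ⟨(0, 1), ?_, one_pos, ?_⟩, ?_⟩
    · simp
    · rw [h0 _ one_pos]; simp
    · rintro x ⟨hxz, hx0, heq⟩
      have h1 := mem_fordVoronoiCell_near_zero h hN hx0 (le_of_lt hxz) ((h0 x hx0).mp heq)
      exact ⟨h1, hx0, fun δ => heq ▸ h1.2 δ⟩
  exact isFourCell_iff.mpr ⟨_, _, OnePoint.coe_ne_infty 0, rfl, hw.symm⟩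

/-- The point `(0, 1)` lies only in the Ford-Voronoi cells of `0` and `∞`. -/
theorem IsRep.eq_zero_of_mem_fordVoronoiCell (hN : ∀ α, IsDenominator O α (N α))
    (hα : IsRep α u v) (h1 : ((0, 1) : ℍ[ℝ] × ℝ) ∈ fordVoronoiCell O α) : u = 0 ∨ v = 0 := by
  rcases hα with ⟨hv, -⟩ | ⟨-, b, rfl, rfl⟩
  · exact Or.inr hv
  · have h2 := h1.2 OnePoint.infty
    rw [cuspDist_infty, cuspDist_coe (hN b)] at h2
    simp only [zero_sub, Quaternion.normSq_neg, one_pow, div_one] at h2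
    have hN1 : (1 : ℝ) ≤ N b := by exact_mod_cast (hN b).pos
    have h3 := Quaternion.normSq_nonneg (a := (b : ℍ[ℝ]))
    have h4 : normSq (b : ℍ[ℝ]) = 0 := by nlinarith
    rw [Quaternion.normSq_eq_zero] at h4
    exact Or.inl (by rw [h4, zero_mul])

/-- A failure of division produces a 4-cell between ∞ and some γ outside the order. If g carries the
fundamental cell to it, the preimages of ∞ and γ have cells containing (0,1), so both preimages are
0 or ∞. These are conditions on the entries of the inverse matrix. -/
theorem isEuclid_of_isTransitiveOnFourCells [Countable A] (h : HasIntegralBasis (image O) e)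
    (hM : IsNormMaximal (image O)) (hO : Submodule.span ℚ (O : Set A) = ⊤)
    (hT : IsTransitiveOnFourCells O) : IsEuclid (image O) := by
  choose N hN using exists_isDenominator h hM hO
  by_contra hE
  simp only [IsEuclid, not_forall, not_exists, not_and, not_lt] at hE
  obtain ⟨a, ha, b, hb, hb0, hab⟩ := hE
  obtain ⟨-, ⟨h0, -⟩ | ⟨-, β, -, hβ⟩⟩ := exists_isRep h ha hb (Or.inr hb0)
  · exact hb0 h0
  have hb1 : 0 < normSq b :=
    lt_of_le_of_ne Quaternion.normSq_nonneg (Ne.symm (Quaternion.normSq_ne_zero.mpr hb0))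
  obtain ⟨γ, hγ, hw⟩ := exists_wall_of_not_covered h hN (β := β) fun q hq => by
    have h1 := hab q hq
    rw [← hβ, ← sub_mul, map_mul] at h1
    exact le_of_mul_le_mul_right (by rwa [one_mul]) hb1
  have hC := isFourCell_iff.mpr ⟨_, _, OnePoint.infty_ne_coe γ, rfl, hw⟩
  obtain ⟨g, hg, hgC⟩ := hT _ _ (isFourCell_fundamentalCell h hN) hC
  obtain ⟨g', hg', hgg', hg'g⟩ := exists_inverse h hg
  have hp : ((0, 1) : ℍ[ℝ] × ℝ) ∈ fundamentalCell O := by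
    have h1 := mem_fordVoronoiCell_near_zero h hN (x := (0, 1)) one_pos (by simp) (by simp)
    refine ⟨⟨one_pos, fun δ => le_trans (le_of_eq ?_) (h1.2 δ)⟩, h1⟩
    rw [cuspDist_of_mem h hM hO (zero_mem O), cuspDist_infty]
    simp
  have hgp : act g (0, 1) ∈ fordVoronoiCell O OnePoint.infty ∩
      fordVoronoiCell O (γ : OnePoint A) := hgC ▸ ⟨_, hp, rfl⟩
  obtain ⟨α₀, hα₀, hα₀'⟩ := exists_comap_isRep h hM hO hg hg' hgg' (one_mem _) (zero_mem _)
    (isRep_infty (A := A))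
  have hNγ : (N γ : ℝ) ≠ 0 := by exact_mod_cast (hN γ).pos.ne'
  have hrep : IsRep (γ : OnePoint A) ((N γ : ℝ) • (γ : ℍ[ℝ])) ((N γ : ℝ) • 1) :=
    Or.inr ⟨smul_ne_zero hNγ one_ne_zero, γ, rfl, by rw [mul_smul_comm, mul_one]⟩
  obtain ⟨α₁, hα₁, hα₁'⟩ := exists_comap_isRep h hM hO hg hg' hgg' (hN γ).smul_mem
    (by exact_mod_cast smul_mem_of_mem (N γ) (one_mem (image O))) hrep
  have k₀ := hα₀.eq_zero_of_mem_fordVoronoiCell hN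
    ((act_mem_fordVoronoiCell h hM hO hg hα₀' one_pos).mp hgp.1)
  have k₁ := hα₁.eq_zero_of_mem_fordVoronoiCell hN
    ((act_mem_fordVoronoiCell h hM hO hg hα₁' one_pos).mp hgp.2)
  simp only [mul_one, mul_zero, add_zero] at k₀
  simp only [mul_smul_comm, mul_one, ← smul_add, smul_eq_zero, hNγ, false_or] at k₁
  have d : ∀ i j, (g * g') i j = g i 0 * g' 0 j + g i 1 * g' 1 j := fun i j => by
    rw [Matrix.mul_apply, Fin.sum_univ_two]
  have d' : ∀ i j, (g' * g) i j = g' i 0 * g 0 j + g' i 1 * g 1 j := fun i j => by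
    rw [Matrix.mul_apply, Fin.sum_univ_two]
  obtain ⟨-, hm⟩ := mem_SL2_iff.mp hg
  apply hγ
  rw [← coe_mem_image]
  have d00 := d 0 0
  rw [hgg', Matrix.one_apply_eq] at d00
  have hsolve : ∀ {s t : ℍ[ℝ]} (w : ℍ[ℝ]), 1 = w * s → w ∈ image O → t ∈ image O →
      s * γ + t = 0 → (γ : ℍ[ℝ]) ∈ image O := fun {s t} w h1 hw ht hst => by
    have : (γ : ℍ[ℝ]) = -(w * t) := by
      rw [← one_mul (γ : ℍ[ℝ]), h1, mul_assoc, eq_neg_of_add_eq_zero_left hst, mul_neg]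
    rw [this]
    exact neg_mem (mul_mem hw ht)
  -- Equal preimages would give the inverse a zero row. Otherwise an entry s of the inverse has a
  -- left inverse in the order and sγ + t = 0, which puts γ in the order.
  rcases k₀ with k₀ | k₀ <;> rcases k₁ with k₁ | k₁
  · rw [k₀, zero_mul, zero_add] at k₁
    have := d' 0 0
    rw [hg'g, Matrix.one_apply_eq, k₀, k₁] at this
    simp at this
  · rw [k₀, mul_zero, zero_add] at d00
    exact hsolve _ d00 (hm 0 1) (hg' 1 1) k₁
  · rw [k₀, mul_zero, add_zero] at d00
    exact hsolve _ d00 (hm 0 0) (hg' 0 1) k₁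
  · rw [k₀, zero_mul, zero_add] at k₁
    have := d' 1 1
    rw [hg'g, Matrix.one_apply_eq, k₀, k₁] at this
    simp at this

end

end HamiltonBianchi

theorem proposition4p3 (A : Subalgebra ℚ (Quaternion ℝ))
    (hA : HamiltonBianchi.IsDefiniteQuaternionAlgebra A)
    (O : Subring A) (hO : HamiltonBianchi.IsMaximalOrder O) :
    (HamiltonBianchi.IsTransitiveOnFourCells O ↔
      HamiltonBianchi.reducedDiscriminant A ∈ ({2, 3, 5} : Set ℕ)) ∧
    (HamiltonBianchi.reducedDiscriminant A ∈ ({2, 3, 5} : Set ℕ) ↔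
      HamiltonBianchi.IsLeftEuclidean O) ∧
    (HamiltonBianchi.reducedDiscriminant A ∈ ({2, 3, 5} : Set ℕ) →
      Prod.fst '' HamiltonBianchi.fundamentalCell O =
        HamiltonBianchi.latticeVoronoiCell O) := by
  obtain ⟨e, c, h, hc⟩ := hO.1.exists_hasIntegralBasis hA
  have hM := hO.isNormMaximal hA
  have hsp := hO.1.2
  -- Countability of the set of cusps is what the Baire argument needs.
  have : Countable A := c.equivFun.injective.countable
  rw [HamiltonBianchi.reducedDiscriminant_eq h hM hc, HamiltonBianchi.isLeftEuclidean_iff]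
  have hE := fun hd => HamiltonBianchi.isEuclid_of_hasSimplex (h.hasSimplex hd)
  have hF := fun hd => HamiltonBianchi.hasFloor_of_hasSimplex (h.hasSimplex hd)
  refine ⟨⟨fun hT => h.disc_of_isEuclid hM
      (HamiltonBianchi.isEuclid_of_isTransitiveOnFourCells h hM hsp hT),
    fun hd => HamiltonBianchi.isTransitiveOnFourCells_of_isEuclid h hM hsp (hE hd) (hF hd)⟩,
    ⟨hE, h.disc_of_isEuclid hM⟩, fun hd =>
      HamiltonBianchi.image_fst_fundamentalCell h hM hsp (hF hd)
        fun x => (h.hasSimplex hd x).exists_normSq_sub_lt⟩
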